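/- Let $K$ be a number field, let $E$ be an elliptic curve over $K$ given by a Weierstrass equation, and let $Q\in E(K)$ be a non-torsion point. Let $L/K$ be a finite Galois extension, let $m\ge 0$ be an integer, and let $R\in E(L)$ be a point with $mR=Q$ which generates $L$ over $K$, i.e. $L=K(R)$ is generated by the affine coordinates of $R$. 1. Suppose that $[L:K]<m^2$ and that, for every Galois conjugate $R'=\tau(R)$ of $R$ ($\tau\in\mathrm{Gal}(L/K)$), the point $R-R'$ is a $K$-rational $m$-torsion point, i.e. $R-R'\in E(K)$ and $m(R-R')=O$. Then $Q$ is the image of a $K$-rational point under a non-trivial isogeny: there are an elliptic curve $F$ over $K$, an isogeny $\varphi:F\to E$ defined over $K$ of degree greater than $1$, and a point $P\in F(K)$ with $\varphi(P)=Q$. 2. If $m=2$ and $[L:K]\le 2$, then the hypothesis on conjugates always holds: for every Galois conjugate $R'$ of $R$, the point $R-R'$ is a $K$-rational $2$-torsion point. Here an isogeny $F\to E$ over $K$ is a group homomorphism $F(\overline K)\to E(\overline K)$ given, at all but finitely many points, by rational functions of the affine coordinates with coefficients in $K$ (the zero homomorphism is excluded), and its degree is the number of points of its kernel in $F(\overline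 K)$. -/

import Mathlib

open WeierstrassCurve WeierstrassCurve.Affine
open scoped Polynomial Polynomial.Bivariate

/-- Equality in an algebraic closure is decided classically (needed for the group law). -/
noncomputable instance AlgebraicClosure.instDecidableEqClassical (K : Type*) [Field K] :
    DecidableEq (AlgebraicClosure K) :=
  Classical.decEq _

/-- The set of affine coordinates of a point; it is empty for the point at infinity. -/
def WeierstrassCurve.Affine.Point.coords {R : Type*} [CommRing R] {W : WeierstrassCurve.Affine R} :
    W.Point → Set R
  | .zero => ∅
  | .some x y _ => {x, y}

/-- An isogeny `F → E` of elliptic curves, defined over the field `K`: a homomorphism of groups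
of geometric points which is given by rational functions `a / b` and `c / d` of the coordinates
with coefficients in `K`, at all but finitely many points.
(The zero homomorphism is excluded, since almost all points have affine images.) -/
structure EllipticIsogeny {K : Type*} [Field K] (F E : WeierstrassCurve K)
    [F.IsElliptic] [E.IsElliptic] where
  /-- The homomorphism on points over the algebraic closure. -/
  toHom : (F⁄(AlgebraicClosure K)).Point →+ (E⁄(AlgebraicClosure K)).Point
  /-- The homomorphism is given by rational functions over `K`. -/
  rational : ∃ a b c d : K[X][Y], ∀ᶠ P in Filter.cofinite,
    ∃ (x y : AlgebraicClosure K) (h : (F⁄(AlgebraicClosure K)).Nonsingular x y)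
      (x' y' : AlgebraicClosure K) (h' : (E⁄(AlgebraicClosure K)).Nonsingular x' y'),
      P = .some x y h ∧ toHom P = .some x' y' h' ∧
      Polynomial.aevalAeval x y b ≠ 0 ∧ Polynomial.aevalAeval x y d ≠ 0 ∧
      x' = Polynomial.aevalAeval x y a / Polynomial.aevalAeval x y b ∧
      y' = Polynomial.aevalAeval x y c / Polynomial.aevalAeval x y d

/-- The degree of an isogeny in characteristic zero, where every isogeny is separable:
the number of geometric points in its kernel. -/
noncomputable def EllipticIsogeny.degree {K : Type*} [Field K] [CharZero K]
    {F E : WeierstrassCurve K} [F.IsElliptic] [E.IsElliptic] (φ : EllipticIsogeny F E) : ℕ :=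
  Nat.card φ.toHom.ker

/-- `Q ∈ E(K)` is the image of a `K`-rational point of some elliptic curve over `K` under a
non-trivial isogeny over `K`, that is, one of degree greater than one. -/
def IsImageOfRationalPoint {K : Type*} [Field K] [CharZero K] [DecidableEq K]
    (E : WeierstrassCurve K) [E.IsElliptic] (Q : (E⁄K).Point) : Prop :=
  ∃ (F : WeierstrassCurve K) (_ : F.IsElliptic) (φ : EllipticIsogeny F E) (P : (F⁄K).Point),
    1 < φ.degree ∧
      φ.toHom (Point.baseChange K (AlgebraicClosure K) P) =
        Point.baseChange K (AlgebraicClosure K) Q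

/-- For every Galois conjugate `R'` of `R`, the point `R - R'` is a `K`-rational `m`-torsion
point. -/
def ConjDiffsRationalTorsion {K L : Type*} [Field K] [Field L] [Algebra K L] [DecidableEq K]
    [DecidableEq L] (E : WeierstrassCurve K) (m : ℕ) (R : (E⁄L).Point) : Prop :=
  ∀ σ : L ≃ₐ[K] L, ∃ T : (E⁄K).Point,
    m • T = 0 ∧ R - Point.map (σ : L →ₐ[K] L) R = Point.baseChange K L T

/-!
The second assertion is elementary: if `σ` generates the Galois group of a quadratic extension, then
`T = R - σ R` satisfies `σ T = -T`, and `2 T = 0` makes this `T` itself.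

For the first, the differences `R - σ R` form a finite subgroup `H` of `E(K)` (the cocycle
`σ ↦ R - σ R` has rational values, so it is a homomorphism), killed by `m` and of order less than
`m²`. In the quotient `ψ : E → E / H` all conjugates of `R` have the same image, so `P = ψ(R)` is
rational, and the isogeny `φ : E / H → E` with `φ ∘ ψ = m` maps `P` to `m R = Q`. Its kernel is
`ψ(E[m])`, which is not trivial, since `E[m]` has at least `m²` elements. Three things
have to be constructed: the quotient, the rationality of `φ`, and the torsion points.

Everything takes place in the function field `FunField W k` of the curve over an algebraically closed
field `k` of characteristic zero, the quadratic extension of `k(x)` generated by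
`η = 2y + a₁x + a₃`, with the pole order at the origin (`FunField.val`), the invariant derivation
`D = η d/dx` (`FunField.der`) and the translations by points (`FunField.transl`). The elements of
this field behave as elliptic functions of a complex variable do. The analogue of
Liouville's theorem is `FunField.eq_algebraMap_of_forall_val_le`: an even function all of whose
translates are regular at the origin is constant. The basic
fact about reduction is `valuation_coords_add_sub_lt_one`: adding a point that reduces to infinity
does not change the reduction of a point.

*The quotient.* Vélu's function `X(P) = x(P) + ∑ (x(P + c) - x(c))` plays the role of the Weierstrass
function of the lattice enlarged by `H`. As for that function, `D² X - 6 X² - b₂ X` is even without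
poles, hence constant, and integration gives a Weierstrass equation for `X` and `Y = D X / 2`
(`FunField.exists_veluE_sq_eq`). It has no double root, because a function with `D s = s (s + 2b)`
never takes the values `0` and `-2b`
(`FunField.not_veluE_sq_eq_double_root`). The translates of the point `(X, Y)` differ from it by
constant points, as all of them satisfy `D X = 2 Y` (`derivation_xc_add`); this defines `ψ`, which is
then automatically a homomorphism (`FunField.veluHom`).

*Rationality of `φ`.* Over an algebraic closure of the function field of `E / H` over `K`, choose a
preimage `P` of the generic point under `ψ`. Its conjugates differ from it by elements of `H`, so
`m P` is rational over the function field itself: its coordinates are rational functions over `K`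
on `E / H` (`FunField.exists_map_veluPullback_eq`), and specialization shows that `φ` is given by
them.

*Torsion.* Let `d n` be the degree of `x(n P)` as a rational function of `x(P)`. The forms that
express `x(P + Q) x(P - Q)` and `x(P + Q) + x(P - Q)` have no common zero (Mathlib's
`WeierstrassCurve.addSubMapCoeff_condition`), so `d (n + 1) + d (n - 1) ≥ 2 d n + 2`, and
`d n ≥ n²` (`FunField.degMul_add_le`). A general fibre of multiplication by `n` then has at least
`n²` elements.
-/

set_option linter.unusedSectionVars false

/-! ### Coordinates of points -/

namespace WeierstrassCurve.Affine.Point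

section coordinates

variable {R : Type*} [CommRing R] {W : Affine R}

/-- The `x`-coordinate of an affine point, with the junk value `0` at infinity. -/
def xc : W.Point → R
  | .zero => 0
  | .some x _ _ => x

/-- The `y`-coordinate of an affine point, with the junk value `0` at infinity. -/
def yc : W.Point → R
  | .zero => 0
  | .some _ y _ => y

/-- The odd coordinate `η = 2y + a₁x + a₃` of an affine point, with the junk value `0` at
infinity. -/
def ec : W.Point → R
  | .zero => 0
  | .some x y _ => 2 * y + W.a₁ * x + W.a₃

@[simp] lemma xc_zero : (0 : W.Point).xc = 0 := rfl
@[simp] lemma yc_zero : (0 : W.Point).yc = 0 := rfl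
@[simp] lemma ec_zero : (0 : W.Point).ec = 0 := rfl
@[simp] lemma xc_some {x y : R} (h : W.Nonsingular x y) : (some x y h).xc = x := rfl
@[simp] lemma yc_some {x y : R} (h : W.Nonsingular x y) : (some x y h).yc = y := rfl

lemma ec_of_ne_zero {P : W.Point} (hP : P ≠ 0) : P.ec = 2 * P.yc + W.a₁ * P.xc + W.a₃ := by
  cases P with
  | zero => exact absurd rfl hP
  | some x y h => rfl

lemma nonsingular_of_ne_zero {P : W.Point} (hP : P ≠ 0) : W.Nonsingular P.xc P.yc := by
  cases P with
  | zero => exact absurd rfl hP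
  | some x y h => exact h

lemma eq_some_of_ne_zero {P : W.Point} (hP : P ≠ 0) :
    P = .some (W' := W) P.xc P.yc (nonsingular_of_ne_zero hP) := by
  cases P with
  | zero => exact absurd rfl hP
  | some x y h => rfl

lemma equation_of_ne_zero {P : W.Point} (hP : P ≠ 0) :
    P.yc ^ 2 + W.a₁ * P.xc * P.yc + W.a₃ * P.yc =
      P.xc ^ 3 + W.a₂ * P.xc ^ 2 + W.a₄ * P.xc + W.a₆ :=
  (equation_iff ..).mp (nonsingular_of_ne_zero hP).1

lemma ext_coords {P Q : W.Point} (hP : P ≠ 0) (hQ : Q ≠ 0) (hx : P.xc = Q.xc)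
    (hy : P.yc = Q.yc) : P = Q := by
  cases P with
  | zero => exact absurd rfl hP
  | some x y h =>
    cases Q with
    | zero => exact absurd rfl hQ
    | some x' y' h' =>
      obtain rfl : x = x' := hx
      obtain rfl : y = y' := hy
      rfl

@[simp] lemma xc_neg (P : W.Point) : (-P).xc = P.xc := by
  cases P <;> rfl

@[simp] lemma ec_neg (P : W.Point) : (-P).ec = -P.ec := by
  cases P with
  | zero => exact _root_.neg_zero.symm
  | some x y h =>
    change 2 * W.negY x y + W.a₁ * x + W.a₃ = -(2 * y + W.a₁ * x + W.a₃)
    rw [negY]; ring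

lemma yc_neg {P : W.Point} (hP : P ≠ 0) : (-P).yc = -P.yc - W.a₁ * P.xc - W.a₃ := by
  cases P with
  | zero => exact absurd rfl hP
  | some x y h => rfl

end coordinates

section field

variable {F : Type*} [Field F] {W : Affine F}

lemma eq_or_eq_neg_of_xc_eq {P Q : W.Point} (hP : P ≠ 0) (hQ : Q ≠ 0) (h : P.xc = Q.xc) :
    P = Q ∨ P = -Q := by
  cases P with
  | zero => exact absurd rfl hP
  | some x y hh =>
    cases Q with
    | zero => exact absurd rfl hQ
    | some x' y' h' => exact X_eq_iff.mp h

variable [DecidableEq F]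

lemma add_ne_zero_of_xc_ne {P Q : W.Point} (h : P.xc ≠ Q.xc) : P + Q ≠ 0 := by
  intro h0
  rw [add_eq_zero_iff_eq_neg] at h0
  exact h (by rw [h0, xc_neg])

/-- The chord formula for the `x`-coordinate of a sum. -/
lemma xc_add {P Q : W.Point} (hP : P ≠ 0) (hQ : Q ≠ 0) (h : P.xc ≠ Q.xc) :
    (P + Q).xc = ((P.yc - Q.yc) / (P.xc - Q.xc)) ^ 2 +
      W.a₁ * ((P.yc - Q.yc) / (P.xc - Q.xc)) - W.a₂ - P.xc - Q.xc := by
  cases P with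
  | zero => exact absurd rfl hP
  | some x y hh =>
    cases Q with
    | zero => exact absurd rfl hQ
    | some x' y' h' =>
      have h : x ≠ x' := h
      rw [add_of_X_ne h]
      simp only [xc_some, yc_some, addX, slope_of_X_ne h]

/-- The chord formula for the `y`-coordinate of a sum. -/
lemma yc_add {P Q : W.Point} (hP : P ≠ 0) (hQ : Q ≠ 0) (h : P.xc ≠ Q.xc) :
    (P + Q).yc = -((P.yc - Q.yc) / (P.xc - Q.xc) * ((P + Q).xc - P.xc) + P.yc) -
      W.a₁ * (P + Q).xc - W.a₃ := by
  cases P with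
  | zero => exact absurd rfl hP
  | some x y hh =>
    cases Q with
    | zero => exact absurd rfl hQ
    | some x' y' h' =>
      have h : x ≠ x' := h
      rw [add_of_X_ne h]
      simp only [xc_some, yc_some, slope_of_X_ne h, addY, negAddY, negY]

end field

section map

variable {R S F K : Type*} [CommRing R] [CommRing S] [Field F] [Field K] {W : Affine R}
  [DecidableEq F] [DecidableEq K]
  [Algebra R S] [Algebra R F] [Algebra S F] [IsScalarTower R S F] [Algebra R K] [Algebra S K]
  [IsScalarTower R S K] (f : F →ₐ[S] K)

@[simp] lemma xc_map (P : (W⁄F).Point) : (map f P).xc = f P.xc := by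
  cases P with
  | zero => exact (_root_.map_zero f).symm
  | some x y h => rfl

@[simp] lemma yc_map (P : (W⁄F).Point) : (map f P).yc = f P.yc := by
  cases P with
  | zero => exact (_root_.map_zero f).symm
  | some x y h => rfl

@[simp] lemma ec_map (P : (W⁄F).Point) : (map f P).ec = f P.ec := by
  have h1 : f (algebraMap R F W.a₁) = algebraMap R K W.a₁ := by
    rw [IsScalarTower.algebraMap_apply R S F, f.commutes, ← IsScalarTower.algebraMap_apply]
  have h3 : f (algebraMap R F W.a₃) = algebraMap R K W.a₃ := by
    rw [IsScalarTower.algebraMap_apply R S F, f.commutes, ← IsScalarTower.algebraMap_apply]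
  cases P with
  | zero => exact (_root_.map_zero f).symm
  | some x y h =>
    change 2 * f y + algebraMap R K W.a₁ * f x + algebraMap R K W.a₃ =
      f (2 * y + algebraMap R F W.a₁ * x + algebraMap R F W.a₃)
    simp only [map_add, map_mul, map_ofNat, h1, h3]

lemma map_eq_zero {P : (W⁄F).Point} : map f P = 0 ↔ P = 0 :=
  map_eq_zero_iff (map f) (map_injective f)

end map

end WeierstrassCurve.Affine.Point

/-! ### Derivations and the group law -/

section derivation

variable {R L : Type*} [CommRing R] [Field L] [Algebra R L] [DecidableEq L] (D : Derivation R L L)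
  {W : Affine L}

/-- The pull-back of the invariant differential `dx / (2y + a₁x + a₃)` along a sum of points is the
sum of the pull-backs: if `D x = u η` at `P` and `D x = v η` at `Q`, then `D x = (u + v) η` at
`P + Q`, for a derivation `D` that kills the coefficients of the curve. -/
lemma derivation_xc_add (h₁ : D W.a₁ = 0) (h₂ : D W.a₂ = 0) {P Q : W.Point} {u v : L}
    (hP : P ≠ 0) (hQ : Q ≠ 0)
    (h : P.xc ≠ Q.xc) (hPx : D P.xc = u * (2 * P.yc + W.a₁ * P.xc + W.a₃))
    (hPy : D P.yc = u * (3 * P.xc ^ 2 + 2 * W.a₂ * P.xc + W.a₄ - W.a₁ * P.yc))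
    (hQx : D Q.xc = v * (2 * Q.yc + W.a₁ * Q.xc + W.a₃))
    (hQy : D Q.yc = v * (3 * Q.xc ^ 2 + 2 * W.a₂ * Q.xc + W.a₄ - W.a₁ * Q.yc)) :
    D (P + Q).xc = (u + v) * (2 * (P + Q).yc + W.a₁ * (P + Q).xc + W.a₃) := by
  have hd : P.xc - Q.xc ≠ 0 := sub_ne_zero.mpr h
  have eP := P.equation_of_ne_zero hP
  have eQ := Q.equation_of_ne_zero hQ
  rw [Point.yc_add hP hQ h, Point.xc_add hP hQ h]
  set x := P.xc
  set y := P.yc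
  set s := Q.xc
  set t := Q.yc
  set l := (y - t) / (x - s) with hl
  have hl' : l * (x - s) = y - t := div_mul_cancel₀ _ hd
  have hDl : D l * (x - s) = D y - D t - l * (D x - D s) := by
    have := congrArg D hl'
    simp only [Derivation.leibniz, map_sub, smul_eq_mul] at this
    linear_combination this
  have h2 : D (l ^ 2) = 2 * l * D l := by
    rw [Derivation.leibniz_pow]; simp [mul_assoc]
  simp only [map_sub, map_add, h2, Derivation.leibniz, smul_eq_mul, h₁, h₂]
  rw [hPx, hPy, hQx, hQy] at hDl
  rw [hPx, hQx]
  have hE : l * (y + t) + W.a₁ * (x * l + t) + W.a₃ * l - (x ^ 2 + x * s + s ^ 2) -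
      W.a₂ * (x + s) - W.a₄ = 0 := by
    apply mul_right_cancel₀ hd
    linear_combination eP - eQ + (y + t + W.a₁ * x + W.a₃) * hl'
  apply mul_right_cancel₀ hd
  have hy : y = t + l * (x - s) := by linear_combination -hl'
  rw [hy] at hDl hE ⊢
  linear_combination (2 * l + W.a₁) * hDl - (u - v) * (2 * l + W.a₁) * hE

end derivation

/-! ### Reduction of a translated point -/

section limit

variable {L Γ : Type*} [Field L] [LinearOrderedCommGroupWithZero Γ] (v : Valuation L Γ)

lemma Valuation.map_mul_le_of_le_one {c m : L} {M : Γ} (hc : v c ≤ 1) (hm : v m ≤ M) :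
    v (c * m) ≤ M := by
  rw [v.map_mul]; exact (mul_le_of_le_one_left' hc).trans hm

lemma Valuation.map_ofNat_le_one (n : ℕ) [n.AtLeastTwo] : v (OfNat.ofNat n : L) ≤ 1 := by
  rw [← Nat.cast_ofNat (R := L)]
  induction (OfNat.ofNat n : ℕ) with
  | zero => simp
  | succ n ih => rw [Nat.cast_succ]; exact v.map_add_le ih v.map_one.le

variable [DecidableEq L] {W : Affine L}

/-- If the point `G` reduces to infinity and `S` reduces to an affine point, then `G + S` has the
same reduction as `S`. -/
lemma valuation_coords_add_sub_lt_one (h₁ : v W.a₁ ≤ 1) (h₂ : v W.a₂ ≤ 1) (h₃ : v W.a₃ ≤ 1)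
    (h₄ : v W.a₄ ≤ 1) (h₆ : v W.a₆ ≤ 1) {G S : W.Point} (hG : 1 < v G.xc) (hS : S ≠ 0)
    (hSx : v S.xc ≤ 1) (hSy : v S.yc ≤ 1) :
    v ((G + S).xc - S.xc) < 1 ∧ v ((G + S).yc - S.yc) < 1 := by
  have hG0 : G ≠ 0 := by rintro rfl; simp at hG
  have hne : S.xc ≠ G.xc := fun h ↦ (hG.trans_le (h ▸ hSx)).false
  have eG := G.equation_of_ne_zero hG0
  have hx3 := Point.xc_add hS hG0 hne
  have hy3 := Point.yc_add hS hG0 hne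
  rw [add_comm G S]
  set x₃ := (S + G).xc
  set y₃ := (S + G).yc
  set g := G.xc
  set h := G.yc
  set s := S.xc
  set t := S.yc
  set l := (t - h) / (s - g)
  have hd : s - g ≠ 0 := sub_ne_zero.mpr hne
  have hl' : l * (s - g) = t - h := div_mul_cancel₀ _ hd
  have vn (n : ℕ) [n.AtLeastTwo] : v (OfNat.ofNat n : L) ≤ 1 := v.map_ofNat_le_one n
  have vm {a b : L} (ha : v a ≤ 1) (hb : v b ≤ 1) : v (a * b) ≤ 1 :=
    v.map_mul_le_of_le_one ha hb
  have vp {a : L} (n : ℕ) (ha : v a ≤ 1) : v (a ^ n) ≤ 1 := by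
    rw [v.map_pow]; exact pow_le_one' ha n
  have g1 : 1 ≤ v g := hG.le
  have g12 : v g ≤ v g ^ 2 := le_self_pow₀ g1 two_ne_zero
  have g23 : v g ^ 2 ≤ v g ^ 3 := pow_le_pow_right₀ g1 (by norm_num)
  have hgpos : 0 < v g := zero_lt_one.trans hG
  -- the pole orders of the coordinates are in the ratio `2 : 3`
  have hlt : v g < v h := by
    by_contra! hle
    have e3 : g ^ 3 = h * h + (W.a₁ * g) * h + W.a₃ * h - W.a₂ * g ^ 2 - W.a₄ * g - W.a₆ := by
      linear_combination -eG
    have : v (g ^ 3) ≤ v g ^ 2 := by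
      rw [e3]
      refine v.map_sub_le (v.map_sub_le (v.map_sub_le (v.map_add_le (v.map_add_le ?_ ?_) ?_) ?_)
        ?_) ?_
      · rw [v.map_mul, sq]; exact mul_le_mul' hle hle
      · rw [v.map_mul, sq]; exact mul_le_mul' (v.map_mul_le_of_le_one h₁ le_rfl) hle
      · exact v.map_mul_le_of_le_one h₃ (hle.trans g12)
      · exact v.map_mul_le_of_le_one h₂ (v.map_pow _ _).le
      · exact v.map_mul_le_of_le_one h₄ g12
      · exact h₆.trans (g1.trans g12)
    rw [v.map_pow] at this
    exact (this.trans_lt (pow_lt_pow_right₀ hG (by norm_num))).false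
  have h1 : 1 ≤ v h := hG.le.trans hlt.le
  have hB : v h ^ 2 = v g ^ 3 := by
    have hh : v (h + (W.a₁ * g + W.a₃)) = v h := v.map_add_eq_of_lt_left <|
      (v.map_add_le (v.map_mul_le_of_le_one h₁ le_rfl) (h₃.trans g1)).trans_lt hlt
    have hg : v (g ^ 3 + (W.a₂ * g ^ 2 + W.a₄ * g + W.a₆)) = v (g ^ 3) := by
      refine v.map_add_eq_of_lt_left <| (v.map_add_le (v.map_add_le
        (v.map_mul_le_of_le_one h₂ (v.map_pow g 2).le)
        (v.map_mul_le_of_le_one h₄ g12)) (h₆.trans (g1.trans g12))).trans_lt ?_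
      rw [v.map_pow]
      exact pow_lt_pow_right₀ hG (by norm_num)
    rw [← v.map_pow g, ← hg, sq]
    nth_rw 2 [← hh]
    rw [← v.map_mul]
    congr 1
    linear_combination eG
  have hlt2 : v h < v g ^ 2 := by
    refine lt_of_pow_lt_pow_left₀ 2 zero_le ?_
    rw [hB, ← pow_mul]
    exact pow_lt_pow_right₀ hG (by norm_num)
  have hvd : v (s - g) = v g := v.map_sub_eq_of_lt_right (hSx.trans_lt hG)
  set e := 2 * t + W.a₁ * s + W.a₃
  have ve : v e ≤ 1 := v.map_add_le (v.map_add_le (vm (vn 2) hSy) (vm h₁ hSx)) h₃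
  set α := 3 * s ^ 2 + 2 * W.a₂ * s + W.a₄ - W.a₁ * t
  have va : v α ≤ 1 := v.map_sub_le (v.map_add_le (v.map_add_le (vm (vn 3) (vp 2 hSx))
    (vm (vm (vn 2) h₂) hSx)) h₄) (vm h₁ hSy)
  set β := W.a₆ + t ^ 2 + W.a₁ * (t * s) - W.a₂ * s ^ 2 - 2 * s ^ 3
  have vb : v β ≤ 1 := v.map_sub_le (v.map_sub_le (v.map_add_le (v.map_add_le h₆ (vp 2 hSy))
    (vm h₁ (vm hSy hSx))) (vm h₂ (vp 2 hSx))) (vm (vn 2) (vp 3 hSx))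
  have hX : (x₃ - s) * (s - g) ^ 2 = -(e * h) + α * g + β := by
    rw [hx3]
    linear_combination (l * (s - g) + (t - h) + W.a₁ * (s - g)) * hl' + eG
  have key : v (x₃ - s) < 1 := by
    have : v ((x₃ - s) * (s - g) ^ 2) ≤ v h := by
      rw [hX]
      refine v.map_add_le (v.map_add_le ?_ ?_) (vb.trans h1)
      · rw [v.map_neg]; exact v.map_mul_le_of_le_one ve le_rfl
      · exact v.map_mul_le_of_le_one va hlt.le
    rw [v.map_mul, v.map_pow, hvd] at this
    by_contra! hc
    exact (hlt2.trans_le ((le_mul_of_one_le_left' hc).trans this)).false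
  refine ⟨key, ?_⟩
  have hY : y₃ - t = -(l * (x₃ - s) + e) - W.a₁ * (x₃ - s) := by
    rw [hy3]; ring
  have hN : (l * (x₃ - s) + e) * (g - s) ^ 3 = (α + e * W.a₁) * (g * h) +
      (β + e * t + e * W.a₃) * h - (e * W.a₂ + 3 * (e * s)) * g ^ 2 +
      (3 * (e * s ^ 2) - α * t - e * W.a₄) * g - (β * t + e * W.a₆ + e * s ^ 3) := by
    linear_combination (h - t) * hX - e * eG - (x₃ - s) * (s - g) ^ 2 * hl'
  have vgs : v (g - s) = v g := by rw [← hvd, v.map_sub_swap]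
  have hM : v ((l * (x₃ - s) + e) * (g - s) ^ 3) ≤ v g * v h := by
    have gh : v h ≤ v g * v h := le_mul_of_one_le_left' g1
    have gg : v g ^ 2 ≤ v g * v h := by rw [sq]; exact mul_le_mul_right hlt.le _
    rw [hN]
    refine v.map_sub_le (v.map_add_le (v.map_sub_le (v.map_add_le ?_ ?_) ?_) ?_) ?_
    · exact v.map_mul_le_of_le_one (v.map_add_le va (vm ve h₁)) (v.map_mul _ _).le
    · exact v.map_mul_le_of_le_one (v.map_add_le (v.map_add_le vb (vm ve hSy)) (vm ve h₃)) gh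
    · exact v.map_mul_le_of_le_one (v.map_add_le (vm ve h₂) (vm (vn 3) (vm ve hSx)))
        ((v.map_pow _ _).le.trans gg)
    · exact v.map_mul_le_of_le_one (v.map_sub_le (v.map_sub_le (vm (vn 3) (vm ve (vp 2 hSx)))
        (vm va hSy)) (vm ve h₄)) (hlt.le.trans gh)
    · exact (v.map_add_le (v.map_add_le (vm vb hSy) (vm ve h₆)) (vm ve (vp 3 hSx))).trans
        (h1.trans gh)
  have hlte : v (l * (x₃ - s) + e) < 1 := by
    rw [v.map_mul, v.map_pow, vgs] at hM
    by_contra! hc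
    have h3 : v g * v h < v g ^ 3 := by
      rw [pow_succ']
      exact (mul_lt_mul_iff_right₀ hgpos).mpr hlt2
    exact (h3.trans_le ((le_mul_of_one_le_left' hc).trans hM)).false
  rw [hY]
  refine v.map_sub_lt (by rwa [v.map_neg]) ?_
  rw [v.map_mul]
  exact (mul_le_of_le_one_left' h₁).trans_lt key

end limit

/-! ### The derivative and the pole order at infinity of a rational function -/

namespace RatFunc

variable {k : Type*} [Field k]

/-- The formal derivative `(p / q)' = (p' q - p q') / q²` of a rational function. -/
noncomputable def deriv (r : RatFunc k) : RatFunc k :=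
  algebraMap k[X] _ (r.num.derivative * r.denom - r.num * r.denom.derivative) /
    algebraMap k[X] _ (r.denom ^ 2)

lemma deriv_div (p q : k[X]) (hq : q ≠ 0) :
    deriv (algebraMap k[X] (RatFunc k) p / algebraMap k[X] (RatFunc k) q) =
      algebraMap k[X] _ (p.derivative * q - p * q.derivative) / algebraMap k[X] _ (q ^ 2) := by
  set r := algebraMap k[X] (RatFunc k) p / algebraMap k[X] (RatFunc k) q with hr
  have hd := r.denom_ne_zero
  have h : r.num * q = p * r.denom := by
    apply RatFunc.algebraMap_injective k
    rw [map_mul, map_mul]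
    have h1 := RatFunc.num_div_denom r
    have hq' : algebraMap k[X] (RatFunc k) q ≠ 0 := RatFunc.algebraMap_ne_zero hq
    have hd' : algebraMap k[X] (RatFunc k) r.denom ≠ 0 := RatFunc.algebraMap_ne_zero hd
    rw [← div_eq_div_iff hd' hq', h1, hr]
  have h' := congrArg Polynomial.derivative h
  rw [Polynomial.derivative_mul, Polynomial.derivative_mul] at h'
  rw [deriv, div_eq_div_iff (RatFunc.algebraMap_ne_zero (pow_ne_zero 2 hd))
    (RatFunc.algebraMap_ne_zero (pow_ne_zero 2 hq)), ← map_mul, ← map_mul]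
  congr 1
  linear_combination q * r.denom * h' -
    (q * r.denom.derivative + q.derivative * r.denom) * h

lemma exists_div (r : RatFunc k) : ∃ p q : k[X], q ≠ 0 ∧
    r = algebraMap k[X] (RatFunc k) p / algebraMap k[X] (RatFunc k) q :=
  ⟨r.num, r.denom, r.denom_ne_zero, (RatFunc.num_div_denom r).symm⟩

lemma deriv_add (r s : RatFunc k) : deriv (r + s) = deriv r + deriv s := by
  obtain ⟨a, b, hb, rfl⟩ := exists_div r
  obtain ⟨c, d, hd, rfl⟩ := exists_div s
  have hb' : algebraMap k[X] (RatFunc k) b ≠ 0 := RatFunc.algebraMap_ne_zero hb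
  have hd' : algebraMap k[X] (RatFunc k) d ≠ 0 := RatFunc.algebraMap_ne_zero hd
  rw [div_add_div _ _ hb' hd', ← map_mul, ← map_mul, ← map_add, ← map_mul,
    deriv_div _ _ (mul_ne_zero hb hd), deriv_div _ _ hb, deriv_div _ _ hd]
  simp only [Polynomial.derivative_mul, map_add, map_sub, map_mul,
    map_pow]
  field_simp
  ring

lemma deriv_mul (r s : RatFunc k) : deriv (r * s) = r * deriv s + s * deriv r := by
  obtain ⟨a, b, hb, rfl⟩ := exists_div r
  obtain ⟨c, d, hd, rfl⟩ := exists_div s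
  have hb' : algebraMap k[X] (RatFunc k) b ≠ 0 := RatFunc.algebraMap_ne_zero hb
  have hd' : algebraMap k[X] (RatFunc k) d ≠ 0 := RatFunc.algebraMap_ne_zero hd
  rw [div_mul_div_comm, ← map_mul, ← map_mul,
    deriv_div _ _ (mul_ne_zero hb hd), deriv_div _ _ hb, deriv_div _ _ hd]
  simp only [Polynomial.derivative_mul, map_add, map_sub, map_mul, map_pow]
  field_simp
  ring

lemma deriv_algebraMap (p : k[X]) :
    deriv (algebraMap k[X] (RatFunc k) p) = algebraMap k[X] _ p.derivative := by
  have := deriv_div p 1 one_ne_zero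
  simpa using this

@[simp] lemma deriv_C (c : k) : deriv (RatFunc.C c) = 0 := by
  rw [← RatFunc.algebraMap_C, deriv_algebraMap]; simp

@[simp] lemma deriv_zero : deriv (0 : RatFunc k) = 0 := by
  simpa using deriv_C (0 : k)

@[simp] lemma deriv_X : deriv (RatFunc.X : RatFunc k) = 1 := by
  rw [← RatFunc.algebraMap_X, deriv_algebraMap]; simp

section infty

open WithZero

variable [DecidableEq (RatFunc k)]

lemma inftyValuation_algebraMap {p : k[X]} (hp : p ≠ 0) :
    RatFunc.inftyValuation k (algebraMap k[X] (RatFunc k) p) = exp (p.natDegree : ℤ) :=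
  RatFunc.inftyValuation.polynomial k hp

lemma inftyValuation_div {p q : k[X]} (hp : p ≠ 0) (hq : q ≠ 0) :
    RatFunc.inftyValuation k (algebraMap k[X] (RatFunc k) p / algebraMap k[X] (RatFunc k) q) =
      exp ((p.natDegree : ℤ) - q.natDegree) := by
  rw [map_div₀, inftyValuation_algebraMap hp, inftyValuation_algebraMap hq, exp_sub]

omit [DecidableEq (RatFunc k)] in
lemma natDegree_derivative_mul_sub_lt {p q : k[X]} (h : p.derivative * q - p * q.derivative ≠ 0) :
    (p.derivative * q - p * q.derivative).natDegree + 1 ≤ p.natDegree + q.natDegree := by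
  have := Polynomial.natDegree_wronskian_lt_add (a := q) (b := p)
    (by rw [Polynomial.wronskian]; intro h'; exact h (by linear_combination h'))
  rw [Polynomial.wronskian, show q * p.derivative - q.derivative * p =
    p.derivative * q - p * q.derivative by ring] at this
  omega

/-- Differentiation lowers the pole order at infinity. -/
lemma inftyValuation_deriv_le (r : RatFunc k) :
    RatFunc.inftyValuation k (deriv r) ≤ RatFunc.inftyValuation k r * exp (-1) := by
  obtain ⟨p, q, hq, rfl⟩ := exists_div r
  rw [deriv_div _ _ hq]
  by_cases hp : p = 0
  · simp [hp]
  by_cases hw : p.derivative * q - p * q.derivative = 0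
  · rw [hw]; simp
  rw [inftyValuation_div hp hq, inftyValuation_div hw (pow_ne_zero 2 hq), ← exp_add,
    Polynomial.natDegree_pow]
  have := natDegree_derivative_mul_sub_lt hw
  exact exp_le_exp.mpr (by push_cast; omega)

/-- In characteristic zero, differentiation lowers the pole order at infinity by exactly one unless
that order is zero. -/
lemma inftyValuation_deriv_eq [CharZero k] {r : RatFunc k}
    (hr : RatFunc.inftyValuation k r ≠ 1) :
    RatFunc.inftyValuation k (deriv r) = RatFunc.inftyValuation k r * exp (-1) := by
  obtain ⟨p, q, hq, rfl⟩ := exists_div r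
  rw [deriv_div _ _ hq]
  by_cases hp : p = 0
  · simp [hp]
  rw [inftyValuation_div hp hq] at hr ⊢
  have hne : (p.natDegree : k) - q.natDegree ≠ 0 := by
    rw [sub_ne_zero]
    intro h
    exact hr (by rw [Nat.cast_injective h]; simp)
  have hle : (p.derivative * q - p * q.derivative).natDegree ≤ p.natDegree + q.natDegree - 1 := by
    by_cases hw : p.derivative * q - p * q.derivative = 0
    · simp [hw]
    · have := natDegree_derivative_mul_sub_lt hw; omega
  -- the two leading terms combine to `(deg p - deg q) · lc p · lc q`
  have hpos : p.natDegree ≠ 0 ∨ q.natDegree ≠ 0 := by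
    by_contra! h
    exact hne (by simp [h.1, h.2])
  have hc : (p.derivative * q - p * q.derivative).coeff (p.natDegree + q.natDegree - 1) =
      ((p.natDegree : k) - q.natDegree) * (p.leadingCoeff * q.leadingCoeff) := by
    have h1 : (p.derivative * q).coeff (p.natDegree + q.natDegree - 1) =
        p.natDegree * (p.leadingCoeff * q.leadingCoeff) := by
      rcases Nat.eq_zero_or_pos p.natDegree with h0 | h0
      · rw [Polynomial.derivative_of_natDegree_zero h0]; simp [h0]
      · rw [show p.natDegree + q.natDegree - 1 = (p.natDegree - 1) + q.natDegree by omega,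
          Polynomial.coeff_mul_add_eq_of_natDegree_le (Polynomial.natDegree_derivative_le p) le_rfl,
          Polynomial.coeff_derivative, Nat.sub_add_cancel h0, Polynomial.coeff_natDegree,
          Polynomial.coeff_natDegree, Nat.cast_sub h0]
        push_cast; ring
    have h2 : (p * q.derivative).coeff (p.natDegree + q.natDegree - 1) =
        q.natDegree * (p.leadingCoeff * q.leadingCoeff) := by
      rcases Nat.eq_zero_or_pos q.natDegree with h0 | h0
      · rw [Polynomial.derivative_of_natDegree_zero h0]; simp [h0]
      · rw [show p.natDegree + q.natDegree - 1 = p.natDegree + (q.natDegree - 1) by omega,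
          Polynomial.coeff_mul_add_eq_of_natDegree_le le_rfl (Polynomial.natDegree_derivative_le q),
          Polynomial.coeff_derivative, Nat.sub_add_cancel h0, Polynomial.coeff_natDegree,
          Polynomial.coeff_natDegree, Nat.cast_sub h0]
        push_cast; ring
    rw [Polynomial.coeff_sub, h1, h2]; ring
  have hc0 : (p.derivative * q - p * q.derivative).coeff (p.natDegree + q.natDegree - 1) ≠ 0 := by
    rw [hc]
    exact mul_ne_zero hne (mul_ne_zero (Polynomial.leadingCoeff_ne_zero.mpr hp)
      (Polynomial.leadingCoeff_ne_zero.mpr hq))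
  have hw : p.derivative * q - p * q.derivative ≠ 0 := fun h ↦ hc0 (by rw [h]; simp)
  have hdeg := le_antisymm hle (Polynomial.le_natDegree_of_ne_zero hc0)
  rw [inftyValuation_div hw (pow_ne_zero 2 hq), ← exp_add, hdeg, Polynomial.natDegree_pow]
  congr 1
  push_cast
  omega

/-- A rational function without pole at infinity has a value there. -/
lemma exists_inftyValuation_sub_C_lt_one {r : RatFunc k} (hr : RatFunc.inftyValuation k r ≤ 1) :
    ∃ c : k, RatFunc.inftyValuation k (r - RatFunc.C c) < 1 := by
  rcases hr.lt_or_eq with h | h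
  · exact ⟨0, by simpa using h⟩
  obtain ⟨p, q, hq, rfl⟩ := exists_div r
  have hp : p ≠ 0 := by rintro rfl; simp at h
  rw [inftyValuation_div hp hq, exp_eq_one] at h
  have hdeg : p.degree = q.degree := by
    rw [Polynomial.degree_eq_natDegree hp, Polynomial.degree_eq_natDegree hq]
    congr 1; omega
  refine ⟨p.leadingCoeff / q.leadingCoeff, ?_⟩
  have hlc := Polynomial.leadingCoeff_ne_zero.mpr hq
  set c := p.leadingCoeff / q.leadingCoeff with hc
  have hc0 : c ≠ 0 := div_ne_zero (Polynomial.leadingCoeff_ne_zero.mpr hp) hlc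
  have e : algebraMap k[X] (RatFunc k) p / algebraMap k[X] (RatFunc k) q - RatFunc.C c =
      algebraMap k[X] (RatFunc k) (p - Polynomial.C c * q) / algebraMap k[X] (RatFunc k) q := by
    have hq' : algebraMap k[X] (RatFunc k) q ≠ 0 := RatFunc.algebraMap_ne_zero hq
    rw [map_sub, map_mul, RatFunc.algebraMap_C]
    field_simp
  rw [e]
  by_cases h0 : p - Polynomial.C c * q = 0
  · rw [h0]; simp
  rw [inftyValuation_div h0 hq, ← exp_zero]
  have hlt := Polynomial.degree_sub_lt_left (p := p) (q := Polynomial.C c * q)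
    (by rw [Polynomial.degree_C_mul hc0, hdeg]) hp
    (by rw [Polynomial.leadingCoeff_mul, Polynomial.leadingCoeff_C, hc, div_mul_cancel₀ _ hlc])
  have := Polynomial.natDegree_lt_natDegree h0 hlt
  exact exp_lt_exp.mpr (by omega)

end infty

end RatFunc

/-! ### The function field of an elliptic curve -/

namespace WeierstrassCurve

variable {R : Type*} [CommRing R] (W : WeierstrassCurve R) (A : Type*) [CommRing A] [Algebra R A]

instance [W.IsElliptic] : (WeierstrassCurve.baseChange W A).IsElliptic :=
  inferInstanceAs (W.map (algebraMap R A)).IsElliptic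

lemma baseChange_b₂ : (WeierstrassCurve.baseChange W A).b₂ = algebraMap R A W.b₂ := W.map_b₂ _
lemma baseChange_b₄ : (WeierstrassCurve.baseChange W A).b₄ = algebraMap R A W.b₄ := W.map_b₄ _
lemma baseChange_b₆ : (WeierstrassCurve.baseChange W A).b₆ = algebraMap R A W.b₆ := W.map_b₆ _

end WeierstrassCurve

lemma Polynomial.natDegree_Psi2Sq_of_charZero {k : Type*} [Field k] [CharZero k]
    (W : WeierstrassCurve k) : W.Ψ₂Sq.natDegree = 3 :=
  W.natDegree_Ψ₂Sq (by norm_num)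

instance RatFunc.fact_sq_ne_Psi2Sq {k : Type*} [Field k] [CharZero k] (W : WeierstrassCurve k) :
    Fact (∀ r : RatFunc k, r ^ 2 ≠ algebraMap k[X] (RatFunc k) W.Ψ₂Sq + 0 * r) := by
  refine ⟨fun r hr ↦ ?_⟩
  classical
  have h3 := Polynomial.natDegree_Psi2Sq_of_charZero W
  have hne : W.Ψ₂Sq ≠ 0 := by intro h; rw [h] at h3; simp at h3
  have hr0 : r ≠ 0 := by
    rintro rfl
    refine RatFunc.algebraMap_ne_zero hne ?_
    linear_combination -hr
  have := congrArg RatFunc.intDegree hr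
  rw [zero_mul, add_zero, sq, RatFunc.intDegree_mul hr0 hr0, RatFunc.intDegree_polynomial, h3] at this
  omega

/-- The function field over `k` of a Weierstrass curve `W` over a subfield `K`, in characteristic
zero: the quadratic extension of `k(x)` generated by `η = 2y + a₁x + a₃`, whose square is
`4x³ + b₂x² + 2b₄x + b₆`. -/
abbrev FunField {K : Type*} [Field K] (W : WeierstrassCurve K) (k : Type*) [Field k]
    [Algebra K k] : Type _ :=
  QuadraticAlgebra (RatFunc k) (algebraMap k[X] (RatFunc k) (W⁄k).Ψ₂Sq) 0

/-- Equality of rational functions is decided classically. -/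
noncomputable instance RatFunc.instDecidableEqClassical (k : Type*) [Field k] :
    DecidableEq (RatFunc k) :=
  Classical.decEq _

/-- Equality in a quadratic algebra is decided classically. -/
noncomputable instance QuadraticAlgebra.instDecidableEqClassical {R : Type*} (a b : R) :
    DecidableEq (QuadraticAlgebra R a b) :=
  Classical.decEq _

namespace FunField

variable {K : Type*} [Field K] (W : WeierstrassCurve K) (k : Type*) [Field k] [Algebra K k]

/-- The function `x`. -/
noncomputable def x : FunField W k := ⟨RatFunc.X, 0⟩

/-- The function `η = 2y + a₁x + a₃`. -/
noncomputable def e : FunField W k := ⟨0, 1⟩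

variable {W k}

lemma algebraMap_apply (c : k) : algebraMap k (FunField W k) c = ⟨RatFunc.C c, 0⟩ := rfl

lemma algebraMap_ratFunc (r : RatFunc k) : algebraMap (RatFunc k) (FunField W k) r = ⟨r, 0⟩ := rfl

lemma eq_re_add_im_mul (f : FunField W k) : f = algebraMap (RatFunc k) _ f.re +
    algebraMap (RatFunc k) _ f.im * e W k := by
  ext <;> simp [e]

lemma aeval_x (p : k[X]) :
    Polynomial.aeval (x W k) p = algebraMap (RatFunc k) _ (algebraMap k[X] (RatFunc k) p) := by
  have : x W k = algebraMap (RatFunc k) _ RatFunc.X := rfl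
  rw [this, Polynomial.aeval_algebraMap_apply, RatFunc.aeval_X_left_eq_algebraMap]

lemma e_sq : e W k ^ 2 = Polynomial.aeval (x W k) (W⁄k).Ψ₂Sq := by
  rw [aeval_x]
  ext <;> simp [e, sq]

lemma aeval_Psi2Sq {L : Type*} [Field L] [Algebra k L] [Algebra K L] [IsScalarTower K k L] (t : L) :
    Polynomial.aeval t (W⁄k).Ψ₂Sq = 4 * t ^ 3 + (W⁄L).b₂ * t ^ 2 + 2 * (W⁄L).b₄ * t + (W⁄L).b₆ := by
  have h (c : K) : algebraMap k L (algebraMap K k c) = algebraMap K L c :=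
    (IsScalarTower.algebraMap_apply K k L c).symm
  simp only [Ψ₂Sq, baseChange_b₂, baseChange_b₄, baseChange_b₆, map_add, map_mul, map_pow,
    Polynomial.aeval_C, Polynomial.aeval_X, map_ofNat, h]

lemma Psi2Sq_ec {L : Type*} [Field L] {C : Affine L} {P : C.Point} (hP : P ≠ 0) :
    P.ec ^ 2 = 4 * P.xc ^ 3 + C.b₂ * P.xc ^ 2 + 2 * C.b₄ * P.xc + C.b₆ := by
  rw [Point.ec_of_ne_zero hP, b₂, b₄, b₆]
  linear_combination 4 * P.equation_of_ne_zero hP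

section charZero

variable [CharZero k]

variable (W k) in
/-- The function `y = (η - a₁x - a₃) / 2`. -/
noncomputable def y : FunField W k :=
  (e W k - (W⁄(FunField W k)).a₁ * x W k - (W⁄(FunField W k)).a₃) / 2

lemma two_mul_y : 2 * y W k + (W⁄(FunField W k)).a₁ * x W k + (W⁄(FunField W k)).a₃ = e W k := by
  rw [y, mul_div_cancel₀ _ two_ne_zero]; ring

lemma equation_xy : (W⁄(FunField W k)).Equation (x W k) (y W k) := by
  rw [equation_iff]
  have h := e_sq (W := W) (k := k)
  rw [aeval_Psi2Sq, ← two_mul_y, b₂, b₄, b₆] at h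
  have h4 : (4 : FunField W k) ≠ 0 := by norm_num
  apply mul_left_cancel₀ h4
  linear_combination h

variable [W.IsElliptic]

variable (W k) in
/-- The generic point `(x, y)`. -/
noncomputable def gen : (W⁄(FunField W k)).Point :=
  .some (x W k) (y W k) (equation_iff_nonsingular.mp equation_xy)

@[simp] lemma gen_xc : (gen W k).xc = x W k := rfl
@[simp] lemma gen_yc : (gen W k).yc = y W k := rfl
@[simp] lemma gen_ec : (gen W k).ec = e W k := two_mul_y

lemma gen_ne_zero : gen W k ≠ 0 := Point.some_ne_zero _

variable {L : Type*} [Field L] [Algebra k L] [Algebra K L] [IsScalarTower K k L]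

/-- The specialization of functions at a point with transcendental `x`-coordinate. -/
noncomputable def lift (G : (W⁄L).Point) (hG : G ≠ 0) (ht : Transcendental k G.xc) :
    FunField W k →ₐ[k] L :=
  letI φ : RatFunc k →ₐ[k] L := RatFunc.liftAlgHom (Polynomial.aeval G.xc)
    (nonZeroDivisors_le_comap_nonZeroDivisors_of_injective _
      (transcendental_iff_injective.mp ht))
  AlgHom.ofLinearMap
    { toFun := fun f ↦ φ f.re + φ f.im * G.ec
      map_add' := fun f g ↦ by simp only [QuadraticAlgebra.re_add, QuadraticAlgebra.im_add, map_add]; ring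
      map_smul' := fun c f ↦ by
        simp only [QuadraticAlgebra.re_smul, QuadraticAlgebra.im_smul, map_smul, RingHom.id_apply,
          smul_add, smul_mul_assoc] }
    (by simp [QuadraticAlgebra.re_one, QuadraticAlgebra.im_one])
    (fun f g ↦ by
      have h : φ (algebraMap k[X] (RatFunc k) (W⁄k).Ψ₂Sq) = G.ec ^ 2 := by
        rw [Psi2Sq_ec hG, ← aeval_Psi2Sq (W := W) (k := k)]
        have := RatFunc.liftAlgHom_apply_div (Polynomial.aeval G.xc)
          (nonZeroDivisors_le_comap_nonZeroDivisors_of_injective _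
            (transcendental_iff_injective.mp ht)) (W⁄k).Ψ₂Sq 1
        simpa using this
      simp only [LinearMap.coe_mk, AddHom.coe_mk, QuadraticAlgebra.re_mul, QuadraticAlgebra.im_mul,
        map_add, map_mul, map_zero, h]
      ring)

omit [W.IsElliptic] in
lemma lift_x (G : (W⁄L).Point) (hG : G ≠ 0) (ht : Transcendental k G.xc) :
    lift G hG ht (x W k) = G.xc := by
  have := RatFunc.liftAlgHom_apply_div (Polynomial.aeval G.xc)
          (nonZeroDivisors_le_comap_nonZeroDivisors_of_injective _
            (transcendental_iff_injective.mp ht)) Polynomial.X 1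
  simp at this
  simp [lift, x, this]

omit [W.IsElliptic] in
lemma lift_e (G : (W⁄L).Point) (hG : G ≠ 0) (ht : Transcendental k G.xc) :
    lift G hG ht (e W k) = G.ec := by
  simp [lift, e]

variable [DecidableEq L]

lemma map_lift_gen (G : (W⁄L).Point) (hG : G ≠ 0) (ht : Transcendental k G.xc) :
    Point.map (lift G hG ht) (gen W k) = G := by
  refine Point.ext_coords (fun h ↦ gen_ne_zero (Point.map_eq_zero _ |>.mp h)) hG ?_ ?_
  · rw [Point.xc_map, gen_xc, lift_x]
  · have : CharZero L := charZero_of_injective_algebraMap (algebraMap k L).injective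
    have h2 : (2 : L) ≠ 0 := two_ne_zero
    have h := Point.ec_map (lift G hG ht) (gen W k)
    rw [gen_ec, lift_e] at h
    rw [Point.ec_of_ne_zero (fun h ↦ gen_ne_zero (Point.map_eq_zero _ |>.mp h)),
      Point.ec_of_ne_zero hG, Point.xc_map, gen_xc, lift_x] at h
    exact mul_left_cancel₀ h2 (by linear_combination h)

lemma algHom_ext {f g : FunField W k →ₐ[k] L} (h : Point.map f (gen W k) = Point.map g (gen W k)) :
    f = g := by
  have hx : f (x W k) = g (x W k) := by
    simpa using congrArg Point.xc h
  have he : f (e W k) = g (e W k) := by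
    simpa using congrArg Point.ec h
  have hp (p : k[X]) : f (algebraMap (RatFunc k) _ (algebraMap k[X] (RatFunc k) p)) =
      g (algebraMap (RatFunc k) _ (algebraMap k[X] (RatFunc k) p)) := by
    rw [← aeval_x, ← Polynomial.aeval_algHom_apply, ← Polynomial.aeval_algHom_apply, hx]
  have hr (r : RatFunc k) : f (algebraMap (RatFunc k) _ r) = g (algebraMap (RatFunc k) _ r) := by
    rw [← RatFunc.num_div_denom r, map_div₀, map_div₀, map_div₀, hp, hp]
  ext a
  rw [eq_re_add_im_mul a, map_add, map_mul, map_add, map_mul, hr, hr, he]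

end charZero

end FunField

/-! ### The pole order at the origin -/

namespace FunField

open WithZero

variable {K : Type*} [Field K] (W : WeierstrassCurve K) (k : Type*) [Field k] [Algebra K k]
  [CharZero k]

/-- An even and an odd pole order are different. -/
lemma exp_parity {a b : ℤᵐ⁰} (h : a ^ 2 = b ^ 2 * exp (3 : ℤ)) : a = 0 ∧ b = 0 := by
  by_cases ha : a = 0
  · refine ⟨ha, ?_⟩
    rw [ha, zero_pow two_ne_zero, eq_comm, mul_eq_zero] at h
    exact pow_eq_zero_iff two_ne_zero |>.mp (h.resolve_right exp_ne_zero)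
  by_cases hb : b = 0
  · rw [hb, zero_pow two_ne_zero, zero_mul] at h
    exact absurd (pow_eq_zero_iff two_ne_zero |>.mp h) ha
  exfalso
  rw [← exp_log ha, ← exp_log hb, ← exp_nsmul, ← exp_nsmul, ← exp_add, exp_inj] at h
  simp only [nsmul_eq_mul] at h
  push_cast at h
  omega

lemma inftyValuation_norm (z : FunField W k) :
    RatFunc.inftyValuation k (QuadraticAlgebra.norm z) =
      max (RatFunc.inftyValuation k z.re ^ 2) (RatFunc.inftyValuation k z.im ^ 2 * exp 3) := by
  have h3 := Polynomial.natDegree_Psi2Sq_of_charZero (W⁄k)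
  have hne : (W⁄k).Ψ₂Sq ≠ 0 := by intro h; rw [h] at h3; simp at h3
  have hP : RatFunc.inftyValuation k (algebraMap k[X] (RatFunc k) (W⁄k).Ψ₂Sq) = exp 3 := by
    rw [RatFunc.inftyValuation_algebraMap hne, h3]; rfl
  have e : QuadraticAlgebra.norm z =
      z.re ^ 2 - z.im ^ 2 * algebraMap k[X] (RatFunc k) (W⁄k).Ψ₂Sq := by
    rw [QuadraticAlgebra.norm_def]; ring
  have e1 : RatFunc.inftyValuation k (z.re ^ 2) = RatFunc.inftyValuation k z.re ^ 2 := map_pow _ _ _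
  have e2 : RatFunc.inftyValuation k (z.im ^ 2 * algebraMap k[X] (RatFunc k) (W⁄k).Ψ₂Sq) =
      RatFunc.inftyValuation k z.im ^ 2 * exp 3 := by rw [map_mul, map_pow, hP]
  rw [e]
  rcases lt_trichotomy (RatFunc.inftyValuation k z.re ^ 2)
    (RatFunc.inftyValuation k z.im ^ 2 * exp 3) with h | h | h
  · rw [max_eq_right h.le, ← e2, Valuation.map_sub_eq_of_lt_right]
    rwa [e1, e2]
  · obtain ⟨h1, h2⟩ := exp_parity h
    rw [map_eq_zero] at h1 h2
    simp [h1, h2]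
  · rw [max_eq_left h.le, ← e1, Valuation.map_sub_eq_of_lt_left]
    rwa [e1, e2]

/-- The valuation of the function field at the origin of the curve, written multiplicatively:
a function with a pole of order `n` has value `exp n`. -/
noncomputable def val : Valuation (FunField W k) ℤᵐ⁰ where
  toFun z := RatFunc.inftyValuation k (QuadraticAlgebra.norm z)
  map_zero' := by simp
  map_one' := by simp
  map_mul' a b := by rw [map_mul, map_mul]
  map_add_le_max' a b := by
    simp only [inftyValuation_norm, QuadraticAlgebra.re_add, QuadraticAlgebra.im_add]
    have sq_max (c d : ℤᵐ⁰) : max c d ^ 2 = max (c ^ 2) (d ^ 2) := by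
      rcases le_total c d with h | h
      · rw [max_eq_right h, max_eq_right (pow_le_pow_left₀ zero_le h 2)]
      · rw [max_eq_left h, max_eq_left (pow_le_pow_left₀ zero_le h 2)]
    have h1 := pow_le_pow_left₀ zero_le ((RatFunc.inftyValuation k).map_add a.re b.re) 2
    have h2 := mul_le_mul_left (pow_le_pow_left₀ zero_le ((RatFunc.inftyValuation k).map_add a.im b.im) 2) (exp 3)
    rw [sq_max] at h1 h2
    refine max_le (h1.trans (max_le ?_ ?_)) (h2.trans ?_)
    · exact (le_max_left _ _).trans (le_max_left _ _)
    · exact (le_max_left _ _).trans (le_max_right _ _)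
    · rcases max_choice (RatFunc.inftyValuation k a.im ^ 2) (RatFunc.inftyValuation k b.im ^ 2)
        with h | h <;> rw [h]
      · exact (le_max_right _ _).trans (le_max_left _ _)
      · exact (le_max_right _ _).trans (le_max_right _ _)

variable {W k}

lemma val_eq (z : FunField W k) : val W k z =
    max (RatFunc.inftyValuation k z.re ^ 2) (RatFunc.inftyValuation k z.im ^ 2 * exp 3) :=
  inftyValuation_norm W k z

lemma val_mk_zero (r : RatFunc k) : val W k ⟨r, 0⟩ = RatFunc.inftyValuation k r ^ 2 := by
  rw [val_eq]; simp

lemma val_zero_mk (r : RatFunc k) : val W k ⟨0, r⟩ = RatFunc.inftyValuation k r ^ 2 * exp 3 := by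
  rw [val_eq]; simp

lemma val_algebraMap {c : k} (hc : c ≠ 0) : val W k (algebraMap k _ c) = 1 := by
  rw [algebraMap_apply, val_mk_zero, RatFunc.inftyValuation.C k hc, one_pow]

lemma val_algebraMap_le (c : k) : val W k (algebraMap k _ c) ≤ 1 := by
  by_cases hc : c = 0
  · simp [hc]
  · exact (val_algebraMap hc).le

lemma eq_zero_of_val_lt_one {c : k} (h : val W k (algebraMap k _ c) < 1) : c = 0 := by
  by_contra hc
  exact h.ne (val_algebraMap hc)

lemma val_algebraMap_le' (c : K) : val W k (algebraMap K _ c) ≤ 1 := by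
  rw [IsScalarTower.algebraMap_apply K k (FunField W k)]
  exact val_algebraMap_le _

lemma val_x : val W k (x W k) = exp 2 := by
  rw [x, val_mk_zero, RatFunc.inftyValuation.X, ← exp_nsmul]; rfl

lemma val_e : val W k (e W k) = exp 3 := by
  rw [e, val_zero_mk]; simp

/-! ### The invariant derivation -/

variable (W k) in
/-- The invariant derivation `η d/dx` of the function field. -/
noncomputable def der : Derivation k (FunField W k) (FunField W k) :=
  Derivation.mk'
    { toFun := fun f ↦ ⟨f.im.deriv * algebraMap k[X] _ (W⁄k).Ψ₂Sq +
        f.im * algebraMap k[X] _ ((W⁄k).Ψ₂Sq.derivative) / 2, f.re.deriv⟩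
      map_add' := fun f g ↦ by
        ext
        · simp only [QuadraticAlgebra.im_add, QuadraticAlgebra.re_add, RatFunc.deriv_add]; ring
        · simp only [QuadraticAlgebra.im_add, QuadraticAlgebra.re_add, RatFunc.deriv_add]
      map_smul' := fun c f ↦ by
        have h (r : RatFunc k) : (c • r).deriv = c • r.deriv := by
          rw [RatFunc.smul_eq_C_mul, RatFunc.smul_eq_C_mul, RatFunc.deriv_mul, RatFunc.deriv_C]
          ring
        ext
        · simp only [QuadraticAlgebra.im_smul, QuadraticAlgebra.re_smul, RingHom.id_apply, h]
          simp only [RatFunc.smul_eq_C_mul]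
          ring
        · simp only [QuadraticAlgebra.im_smul, QuadraticAlgebra.re_smul, RingHom.id_apply, h] }
    (fun f g ↦ by
      ext
      · simp only [LinearMap.coe_mk, AddHom.coe_mk, QuadraticAlgebra.re_mul,
          QuadraticAlgebra.im_mul, QuadraticAlgebra.re_add, smul_eq_mul, RatFunc.deriv_add,
          RatFunc.deriv_mul, zero_mul, RatFunc.deriv_zero]
        ring
      · simp only [LinearMap.coe_mk, AddHom.coe_mk, QuadraticAlgebra.re_mul,
          QuadraticAlgebra.im_mul, QuadraticAlgebra.im_add, smul_eq_mul, RatFunc.deriv_add,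
          RatFunc.deriv_mul, zero_mul, RatFunc.deriv_algebraMap]
        field_simp
        ring)

lemma der_re (f : FunField W k) : (der W k f).re = f.im.deriv * algebraMap k[X] _ (W⁄k).Ψ₂Sq +
    f.im * algebraMap k[X] _ ((W⁄k).Ψ₂Sq.derivative) / 2 := rfl

lemma der_im (f : FunField W k) : (der W k f).im = f.re.deriv := rfl

lemma der_algebraMap' (c : K) : der W k (algebraMap K _ c) = 0 := by
  rw [IsScalarTower.algebraMap_apply K k (FunField W k)]
  exact Derivation.map_algebraMap _ _

lemma der_ofNat (n : ℕ) [n.AtLeastTwo] : der W k (OfNat.ofNat n : FunField W k) = 0 := by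
  have := (der W k).map_algebraMap (OfNat.ofNat n : k)
  rwa [map_ofNat] at this

lemma der_x : der W k (x W k) = e W k := by
  ext
  · rw [der_re]; simp [x, e, RatFunc.deriv]
  · rw [der_im]; simp [x, e]

lemma der_e : der W k (e W k) =
    6 * x W k ^ 2 + (W⁄(FunField W k)).b₂ * x W k + (W⁄(FunField W k)).b₄ := by
  have h := congrArg (der W k) (e_sq (W := W) (k := k))
  have he : e W k ≠ 0 := by
    intro h
    have := val_e (W := W) (k := k)
    rw [h, map_zero] at this
    exact exp_ne_zero this.symm
  rw [aeval_Psi2Sq] at h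
  simp only [Derivation.leibniz_pow, map_add, Derivation.leibniz, der_x, baseChange_b₂,
    baseChange_b₄, baseChange_b₆, der_algebraMap', smul_eq_mul, nsmul_eq_mul] at h ⊢
  apply mul_left_cancel₀ (mul_ne_zero two_ne_zero he)
  push_cast at h
  have d2 : der W k (2 : FunField W k) = 0 := der_ofNat 2
  have d4 : der W k (4 : FunField W k) = 0 := der_ofNat 4
  rw [d2, d4] at h
  linear_combination h

lemma inftyValuation_der_re {f : FunField W k} : RatFunc.inftyValuation k (der W k f).re =
    RatFunc.inftyValuation k f.im * exp 2 := by
  by_cases h0 : f.im = 0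
  · rw [der_re, h0]; simp
  have h3 := Polynomial.natDegree_Psi2Sq_of_charZero (W⁄k)
  have hne : (W⁄k).Ψ₂Sq ≠ 0 := by intro h; rw [h] at h3; simp at h3
  have hP : RatFunc.inftyValuation k (algebraMap k[X] (RatFunc k) (W⁄k).Ψ₂Sq) = exp 3 := by
    rw [RatFunc.inftyValuation_algebraMap hne, h3]; rfl
  -- `2 q (q' f + q f' / 2)` is the derivative of `q² f`, which has odd order at infinity
  have e : (2 : RatFunc k) * f.im * (der W k f).re =
      RatFunc.deriv (f.im ^ 2 * algebraMap k[X] _ (W⁄k).Ψ₂Sq) := by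
    rw [der_re, sq]
    simp only [RatFunc.deriv_mul, RatFunc.deriv_algebraMap]
    field_simp
    ring
  have h2 : RatFunc.inftyValuation k (2 : RatFunc k) = 1 := by
    have := RatFunc.inftyValuation.C k (k := (2 : k)) two_ne_zero
    rwa [map_ofNat] at this
  have hv := congrArg (RatFunc.inftyValuation k) e
  have hn : RatFunc.inftyValuation k (f.im ^ 2 * algebraMap k[X] _ (W⁄k).Ψ₂Sq) =
    RatFunc.inftyValuation k f.im ^ 2 * exp 3 := by rw [map_mul, map_pow, hP]
  rw [RatFunc.inftyValuation_deriv_eq, hn, map_mul, map_mul, h2, one_mul, sq, mul_assoc, mul_assoc,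
    ← exp_add] at hv
  · exact mul_left_cancel₀ ((map_ne_zero _).mpr h0) hv
  · rw [hn]
    intro h
    exact one_ne_zero (exp_parity (a := 1) (by rw [h, one_pow])).1

lemma exp_sq (n : ℤ) : (exp n) ^ 2 = exp (2 * n) := by
  rw [← exp_nsmul]; simp

/-- Differentiation raises the pole order at the origin by at most one. -/
lemma val_der_le (f : FunField W k) : val W k (der W k f) ≤ val W k f * exp 1 := by
  rw [val_eq, val_eq, inftyValuation_der_re, der_im, mul_pow, exp_sq]
  refine max_le ?_ ?_
  · refine le_trans ?_ (mul_le_mul_left (le_max_right _ _) _)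
    rw [mul_assoc, ← exp_add]; rfl
  · refine le_trans ?_ (mul_le_mul_left (le_max_left _ _) _)
    refine (mul_le_mul_left (pow_le_pow_left₀ zero_le (RatFunc.inftyValuation_deriv_le _) 2) _).trans ?_
    rw [mul_pow, exp_sq, mul_assoc, ← exp_add]; rfl

/-- Differentiation raises the pole order at the origin by exactly one, unless that order is zero. -/
lemma val_der_eq {f : FunField W k} (hf : val W k f ≠ 1) :
    val W k (der W k f) = val W k f * exp 1 := by
  refine (val_der_le f).antisymm ?_
  by_cases hre : RatFunc.inftyValuation k f.re = 1
  · have hlt : 1 < RatFunc.inftyValuation k f.im ^ 2 * exp 3 := by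
      by_contra! h
      exact hf (by rw [val_eq, hre, one_pow, max_eq_left h])
    rw [val_eq f, val_eq, hre, one_pow, max_eq_right hlt.le, inftyValuation_der_re, mul_pow, exp_sq,
      mul_assoc, ← exp_add]
    exact le_max_left _ _
  · rw [val_eq, val_eq, inftyValuation_der_re, der_im, RatFunc.inftyValuation_deriv_eq hre,
      mul_pow, mul_pow, exp_sq, exp_sq]
    rcases max_choice (RatFunc.inftyValuation k f.re ^ 2)
      (RatFunc.inftyValuation k f.im ^ 2 * exp 3) with h | h <;> rw [h]
    · refine le_trans (le_of_eq ?_) (le_max_right _ _)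
      rw [mul_assoc, ← exp_add]; rfl
    · refine le_trans (le_of_eq ?_) (le_max_left _ _)
      rw [mul_assoc, ← exp_add]; rfl

/-- A function without pole at the origin has a value there. -/
lemma exists_val_sub_lt_one {f : FunField W k} (hf : val W k f ≤ 1) :
    ∃ c : k, val W k (f - algebraMap k _ c) < 1 := by
  rw [val_eq, max_le_iff] at hf
  obtain ⟨c, hc⟩ := RatFunc.exists_inftyValuation_sub_C_lt_one (r := f.re)
    ((pow_le_one_iff two_ne_zero).mp hf.1)
  refine ⟨c, ?_⟩
  rw [val_eq, algebraMap_apply]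
  simp only [QuadraticAlgebra.re_sub, QuadraticAlgebra.im_sub, sub_zero]
  refine max_lt (pow_lt_one₀ zero_le hc two_ne_zero) (hf.2.lt_of_ne fun h ↦ ?_)
  exact one_ne_zero (exp_parity (a := 1) (by rw [h, one_pow])).1

/-- The constants of the invariant derivation are the elements of `k`. -/
lemma eq_algebraMap_of_der_eq_zero {f : FunField W k} (hf : der W k f = 0) :
    ∃ c : k, f = algebraMap k _ c := by
  have key {g : FunField W k} (hg : der W k g = 0) (h1 : val W k g ≠ 1) : g = 0 := by
    have := val_der_eq h1
    rw [hg, map_zero, eq_comm, mul_eq_zero] at this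
    exact (map_eq_zero _).mp (this.resolve_right exp_ne_zero)
  by_cases h1 : val W k f = 1
  · obtain ⟨c, hc⟩ := exists_val_sub_lt_one h1.le
    refine ⟨c, sub_eq_zero.mp (key ?_ hc.ne)⟩
    rw [map_sub, hf, Derivation.map_algebraMap, sub_zero]
  · exact ⟨0, by rw [key hf h1, map_zero]⟩

end FunField

/-! ### Translations of the function field -/

lemma WeierstrassCurve.Affine.Point.exists_xc_eq {F : Type*} [Field F] [IsAlgClosed F]
    (C : Affine F) [C.IsElliptic] (a : F) : ∃ P : C.Point, P ≠ 0 ∧ P.xc = a := by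
  obtain ⟨b, hb⟩ := IsAlgClosed.exists_root (Polynomial.X ^ 2 +
    Polynomial.C (C.a₁ * a + C.a₃) * Polynomial.X -
    Polynomial.C (a ^ 3 + C.a₂ * a ^ 2 + C.a₄ * a + C.a₆)) (by
      have : (Polynomial.X ^ 2 + Polynomial.C (C.a₁ * a + C.a₃) * Polynomial.X -
        Polynomial.C (a ^ 3 + C.a₂ * a ^ 2 + C.a₄ * a + C.a₆) : F[X]).degree = 2 := by
          compute_degree!
      rw [this]; norm_num)
  have he : C.Equation a b := by
    rw [equation_iff]
    simp only [Polynomial.IsRoot.def, Polynomial.eval_sub, Polynomial.eval_add,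
      Polynomial.eval_pow, Polynomial.eval_X, Polynomial.eval_mul, Polynomial.eval_C] at hb
    linear_combination hb
  exact ⟨.some a b (equation_iff_nonsingular.mp he), some_ne_zero _, rfl⟩

/-- An element of an extension that is algebraic over an algebraically closed field is constant. -/
lemma IsAlgebraic.exists_algebraMap_eq {k L : Type*} [Field k] [IsAlgClosed k] [Field L]
    [Algebra k L] {t : L} (ht : IsAlgebraic k t) : ∃ a : k, t = algebraMap k L a := by
  have h := IsAlgClosed.degree_eq_one_of_irreducible k (minpoly.irreducible ht.isIntegral)
  obtain ⟨a, ha⟩ := minpoly.mem_range_of_degree_eq_one k t h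
  exact ⟨a, ha.symm⟩

namespace FunField

open WithZero

variable {K : Type*} [Field K] {W : WeierstrassCurve K} {k : Type*} [Field k] [Algebra K k]
  [CharZero k]

lemma aeval_sub_lt_one {t : FunField W k} {a : k} (ht : val W k (t - algebraMap k _ a) < 1)
    (p : k[X]) : val W k (Polynomial.aeval t p - algebraMap k _ (p.eval a)) < 1 := by
  have ht1 : val W k t ≤ 1 := by
    have := (val W k).map_add_le ht.le (val_algebraMap_le a)
    rwa [sub_add_cancel] at this
  have hle (q : k[X]) : val W k (Polynomial.aeval t q) ≤ 1 := by
    induction q using Polynomial.induction_on' with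
    | add p q hp hq => rw [map_add]; exact (val W k).map_add_le hp hq
    | monomial n c =>
      rw [Polynomial.aeval_monomial]
      refine (val W k).map_mul_le_of_le_one (val_algebraMap_le c) ?_
      rw [map_pow]; exact pow_le_one' ht1 n
  obtain ⟨q, hq⟩ := Polynomial.X_sub_C_dvd_sub_C_eval (a := a) (p := p)
  have := congrArg (Polynomial.aeval t) hq
  simp only [map_sub, map_mul, Polynomial.aeval_C, Polynomial.aeval_X] at this
  rw [this, map_mul]
  exact (mul_le_of_le_one_right' (hle q)).trans_lt ht

variable [DecidableEq k]

/-- A function-field point that reduces to infinity, translated by a constant point, reduces to that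
constant point. -/
lemma val_coords_add_sub_lt_one {C : WeierstrassCurve K} {G : (C⁄(FunField W k)).Point}
    (hG : 1 < val W k G.xc) {S : (C⁄k).Point} (hS : S ≠ 0) :
    val W k ((G + Point.baseChange k _ S).xc - algebraMap k _ S.xc) < 1 ∧
      val W k ((G + Point.baseChange k _ S).yc - algebraMap k _ S.yc) < 1 := by
  have hx : (Point.baseChange k (FunField W k) S).xc = algebraMap k _ S.xc := Point.xc_map _ S
  have hy : (Point.baseChange k (FunField W k) S).yc = algebraMap k _ S.yc := Point.yc_map _ S
  rw [← hx, ← hy]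
  refine valuation_coords_add_sub_lt_one (val W k) ?_ ?_ ?_ ?_ ?_ hG
    (fun h ↦ hS ((Point.map_eq_zero _).mp h)) ?_ ?_
  · rw [baseChange_a₁]; exact val_algebraMap_le' _
  · rw [baseChange_a₂]; exact val_algebraMap_le' _
  · rw [baseChange_a₃]; exact val_algebraMap_le' _
  · rw [baseChange_a₄]; exact val_algebraMap_le' _
  · rw [baseChange_a₆]; exact val_algebraMap_le' _
  · rw [hx]; exact val_algebraMap_le _
  · rw [hy]; exact val_algebraMap_le _

variable [W.IsElliptic]

omit [DecidableEq k] in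
lemma one_lt_val_gen : 1 < val W k (gen W k).xc := by
  rw [gen_xc, val_x, ← exp_zero, exp_lt_exp]; norm_num

/-- The generic point translated by a constant point. -/
noncomputable def translate (Q : (W⁄k).Point) : (W⁄(FunField W k)).Point :=
  gen W k + Point.baseChange k _ Q

@[simp] lemma translate_zero : translate (0 : (W⁄k).Point) = gen W k := by
  rw [translate, map_zero, add_zero]

lemma gen_ne_baseChange (Q : (W⁄k).Point) : gen W k ≠ Point.baseChange k _ Q := by
  intro h
  have h1 := one_lt_val_gen (W := W) (k := k)
  rw [h, Point.xc_map] at h1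
  exact (h1.trans_le (val_algebraMap_le _)).false

lemma translate_ne_zero (Q : (W⁄k).Point) : translate Q ≠ 0 := by
  intro h
  rw [translate, add_eq_zero_iff_eq_neg, ← map_neg] at h
  exact gen_ne_baseChange _ h

lemma val_translate_xc {Q : (W⁄k).Point} (hQ : Q ≠ 0) :
    val W k ((translate Q).xc - algebraMap k _ Q.xc) < 1 :=
  (val_coords_add_sub_lt_one one_lt_val_gen hQ).1

lemma val_translate_ec {Q : (W⁄k).Point} (hQ : Q ≠ 0) :
    val W k ((translate Q).ec - algebraMap k _ Q.ec) < 1 := by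
  obtain ⟨h1, h2⟩ := val_coords_add_sub_lt_one (W := W) (k := k) one_lt_val_gen hQ
  have e : (translate Q).ec - algebraMap k _ Q.ec = 2 * ((translate Q).yc - algebraMap k _ Q.yc) +
      algebraMap K _ W.a₁ * ((translate Q).xc - algebraMap k _ Q.xc) := by
    rw [Point.ec_of_ne_zero (translate_ne_zero Q), Point.ec_of_ne_zero hQ, baseChange_a₁,
      baseChange_a₃, baseChange_a₁, baseChange_a₃, map_add, map_add, map_mul, map_mul, map_ofNat,
      ← IsScalarTower.algebraMap_apply, ← IsScalarTower.algebraMap_apply]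
    ring
  rw [e]
  refine (val W k).map_add_lt ?_ ?_
  · rw [map_mul]
    exact (mul_le_of_le_one_left' ((val W k).map_ofNat_le_one 2)).trans_lt h2
  · rw [map_mul]
    exact (mul_le_of_le_one_left' (val_algebraMap_le' _)).trans_lt h1

lemma translate_xc_ne_algebraMap (Q : (W⁄k).Point) (a : k) :
    (translate Q).xc ≠ algebraMap k _ a := by
  intro h
  by_cases hQ : Q = 0
  · subst hQ
    rw [translate_zero] at h
    have h1 := one_lt_val_gen (W := W) (k := k)
    rw [h] at h1
    exact (h1.trans_le (val_algebraMap_le _)).false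
  · have hlt := val_translate_xc hQ
    rw [h, ← map_sub] at hlt
    have := eq_zero_of_val_lt_one hlt
    rw [sub_eq_zero] at this
    have hx : (translate Q).xc = (Point.baseChange k (FunField W k) Q).xc := by
      rw [h, this]; exact (Point.xc_map (Algebra.ofId k (FunField W k)) Q).symm
    rcases Point.eq_or_eq_neg_of_xc_eq (translate_ne_zero Q)
      (fun h ↦ hQ ((Point.map_eq_zero _).mp h)) hx with h' | h'
    · exact gen_ne_zero (add_eq_right.mp h')
    · rw [translate, ← eq_sub_iff_add_eq, ← map_neg, ← map_sub] at h'
      exact gen_ne_baseChange _ h'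

lemma translate_transcendental [IsAlgClosed k] (Q : (W⁄k).Point) :
    Transcendental k (translate Q).xc := by
  intro h
  obtain ⟨a, ha⟩ := h.exists_algebraMap_eq
  exact translate_xc_ne_algebraMap Q a ha

omit [DecidableEq k] [W.IsElliptic] in
lemma der_y : der W k (y W k) = 3 * x W k ^ 2 + 2 * (W⁄(FunField W k)).a₂ * x W k +
    (W⁄(FunField W k)).a₄ - (W⁄(FunField W k)).a₁ * y W k := by
  have h := congrArg (der W k) (two_mul_y (W := W) (k := k))
  have d2 : der W k (2 : FunField W k) = 0 := der_ofNat 2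
  rw [baseChange_a₁, baseChange_a₃] at h
  simp only [map_add, Derivation.leibniz, der_x, der_e, der_algebraMap', smul_eq_mul, d2] at h
  rw [b₂, b₄] at h
  rw [← two_mul_y, baseChange_a₁] at h
  apply mul_left_cancel₀ (two_ne_zero (α := FunField W k))
  rw [baseChange_a₁, baseChange_a₃] at *
  linear_combination h

lemma der_translate_xc (Q : (W⁄k).Point) : der W k (translate Q).xc = (translate Q).ec := by
  by_cases hQ : Q = 0
  · subst hQ; simp [der_x]
  have hQ' : Point.baseChange k (FunField W k) Q ≠ 0 := fun h ↦ hQ ((Point.map_eq_zero _).mp h)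
  have hx : (Point.baseChange k (FunField W k) Q).xc = algebraMap k _ Q.xc := Point.xc_map _ Q
  have hy : (Point.baseChange k (FunField W k) Q).yc = algebraMap k _ Q.yc := Point.yc_map _ Q
  have ha₁ : der W k (W⁄(FunField W k)).a₁ = 0 := by rw [baseChange_a₁]; exact der_algebraMap' _
  have ha₂ : der W k (W⁄(FunField W k)).a₂ = 0 := by rw [baseChange_a₂]; exact der_algebraMap' _
  rw [Point.ec_of_ne_zero (translate_ne_zero Q), translate,
    derivation_xc_add (der W k) (u := 1) (v := 0) ha₁ ha₂ gen_ne_zero hQ']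
  · ring
  · rw [hx, gen_xc]
    intro h
    refine translate_xc_ne_algebraMap (0 : (W⁄k).Point) Q.xc ?_
    rw [translate_zero, gen_xc, h]
  · rw [gen_xc, gen_yc, der_x, two_mul_y, one_mul]
  · rw [gen_xc, gen_yc, der_y, one_mul]
  · rw [hx, Derivation.map_algebraMap, zero_mul]
  · rw [hy, Derivation.map_algebraMap, zero_mul]

lemma der_translate_ec (Q : (W⁄k).Point) : der W k (translate Q).ec =
    6 * (translate Q).xc ^ 2 + algebraMap K _ W.b₂ * (translate Q).xc + algebraMap K _ W.b₄ := by
  have h := congrArg (der W k) (Psi2Sq_ec (translate_ne_zero Q))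
  have he : (translate Q).ec ≠ 0 := by
    intro h
    rw [← der_translate_xc] at h
    obtain ⟨c, hc⟩ := eq_algebraMap_of_der_eq_zero h
    exact translate_xc_ne_algebraMap Q c hc
  simp only [Derivation.leibniz_pow, map_add, Derivation.leibniz, der_translate_xc, baseChange_b₂,
    baseChange_b₄, baseChange_b₆, der_algebraMap', smul_eq_mul, nsmul_eq_mul] at h ⊢
  apply mul_left_cancel₀ (mul_ne_zero two_ne_zero he)
  push_cast at h
  have d2 : der W k (2 : FunField W k) = 0 := der_ofNat 2
  have d4 : der W k (4 : FunField W k) = 0 := der_ofNat 4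
  rw [d2, d4] at h
  linear_combination h

section isAlgClosed

variable [IsAlgClosed k]

/-- The automorphism `f(P) ↦ f(P + Q)` of the function field. -/
noncomputable def transl (Q : (W⁄k).Point) : FunField W k →ₐ[k] FunField W k :=
  lift (translate Q) (translate_ne_zero Q) (translate_transcendental Q)

lemma map_transl_translate (Q P : (W⁄k).Point) :
    Point.map (transl Q) (translate P) = translate (Q + P) := by
  rw [translate, map_add, transl, map_lift_gen, Point.map_baseChange, translate, translate, map_add,
    add_assoc]

/-- The automorphism `f(P) ↦ f(-P)` of the function field. -/
noncomputable def conj : FunField W k →ₐ[k] FunField W k :=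
  lift (-gen W k) (neg_ne_zero.mpr gen_ne_zero) (by
    rw [Point.xc_neg]
    have := translate_transcendental (0 : (W⁄k).Point)
    rwa [translate_zero] at this)

lemma map_conj_translate (P : (W⁄k).Point) :
    Point.map conj (translate P) = -translate (-P) := by
  rw [translate, map_add, conj, map_lift_gen, Point.map_baseChange, translate, map_neg]
  abel

lemma im_eq_zero_of_conj_eq {f : FunField W k} (hf : conj f = f) : f.im = 0 := by
  have hx : conj (x W k) = x W k := by rw [conj, lift_x, Point.xc_neg, gen_xc]
  have he : conj (e W k) = -e W k := by rw [conj, lift_e, Point.ec_neg, gen_ec]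
  have hp (p : k[X]) : conj (algebraMap (RatFunc k) _ (algebraMap k[X] (RatFunc k) p)) =
      algebraMap (RatFunc k) (FunField W k) (algebraMap k[X] (RatFunc k) p) := by
    rw [← aeval_x, ← Polynomial.aeval_algHom_apply, hx]
  have hr (r : RatFunc k) : conj (algebraMap (RatFunc k) (FunField W k) r) =
      algebraMap (RatFunc k) _ r := by
    rw [← RatFunc.num_div_denom r, map_div₀, map_div₀, hp, hp]
  have h := hf
  rw [eq_re_add_im_mul f, map_add, map_mul, hr, hr, he] at h
  have h' := congrArg QuadraticAlgebra.im h
  simp [e] at h'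
  simpa [neg_eq_self] using h'

/-- An even function without poles is constant. -/
lemma eq_algebraMap_of_forall_val_le {f : FunField W k} (hf : conj f = f)
    (h : ∀ Q : (W⁄k).Point, val W k (transl Q f) ≤ 1) : ∃ c : k, f = algebraMap k _ c := by
  have him := im_eq_zero_of_conj_eq hf
  have hfr : f = algebraMap (RatFunc k) _ f.re := by
    ext
    · simp
    · simpa using him
  set r := f.re with hr
  -- a pole of `f` at `x = a` is seen at a point with this `x`-coordinate
  have hdeg : r.denom.degree = 0 := by
    by_contra hd
    obtain ⟨a, ha⟩ := IsAlgClosed.exists_root r.denom hd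
    obtain ⟨Q, hQ, rfl⟩ := Point.exists_xc_eq (W⁄k) a
    have e : transl Q f = Polynomial.aeval (translate Q).xc r.num /
        Polynomial.aeval (translate Q).xc r.denom := by
      have hp (p : k[X]) : transl Q (algebraMap (RatFunc k) _ (algebraMap k[X] (RatFunc k) p)) =
          Polynomial.aeval (translate Q).xc p := by
        rw [← aeval_x, ← Polynomial.aeval_algHom_apply, transl, lift_x]
      rw [hfr, ← RatFunc.num_div_denom r, map_div₀, map_div₀, hp, hp, RatFunc.num_div_denom]
    have hden : val W k (Polynomial.aeval (translate Q).xc r.denom) < 1 := by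
      have := aeval_sub_lt_one (val_translate_xc hQ) r.denom
      rwa [show r.denom.eval Q.xc = 0 from ha, map_zero, sub_zero] at this
    have hnum0 : r.num.eval Q.xc ≠ 0 := by
      intro h0
      obtain ⟨u, w, huw⟩ := r.isCoprime_num_denom
      have := congrArg (Polynomial.eval Q.xc) huw
      simp [h0, show r.denom.eval Q.xc = 0 from ha] at this
    have hnum : val W k (Polynomial.aeval (translate Q).xc r.num) = 1 := by
      have h1 := aeval_sub_lt_one (val_translate_xc hQ) r.num
      rw [← val_algebraMap (W := W) hnum0] at h1 ⊢
      have := (val W k).map_add_eq_of_lt_left h1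
      rwa [add_sub_cancel] at this
    have hden0 : Polynomial.aeval (translate Q).xc r.denom ≠ 0 := by
      intro h0
      exact translate_transcendental Q ⟨r.denom, r.denom_ne_zero, h0⟩
    have hle := h Q
    rw [e, map_div₀, hnum, div_le_one₀ (by rwa [zero_lt_iff, ne_eq, map_eq_zero])] at hle
    exact (hle.trans_lt hden).false
  have hd1 : r.denom = 1 := Polynomial.eq_one_of_monic_natDegree_zero r.monic_denom
    (Polynomial.natDegree_eq_of_degree_eq_some hdeg)
  have hre : r = algebraMap k[X] (RatFunc k) r.num := by
    conv_lhs => rw [← RatFunc.num_div_denom r, hd1, map_one, div_one]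
  have h0 := h 0
  have hid : transl (0 : (W⁄k).Point) = AlgHom.id k (FunField W k) := by
    refine algHom_ext ?_
    rw [transl, map_lift_gen, translate_zero]
    exact (Point.map_id _).symm
  rw [hid, AlgHom.id_apply, hfr, hre] at h0
  have h0' : RatFunc.inftyValuation k (algebraMap k[X] (RatFunc k) r.num) ≤ 1 := by
    rw [algebraMap_ratFunc, val_mk_zero] at h0
    exact (pow_le_one_iff two_ne_zero).mp h0
  have hn : r.num.natDegree = 0 := by
    by_cases hz : r.num = 0
    · rw [hz]; simp
    rw [RatFunc.inftyValuation_algebraMap hz, ← exp_zero, exp_le_exp] at h0'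
    omega
  refine ⟨r.num.coeff 0, ?_⟩
  rw [hfr, hre, Polynomial.eq_C_of_natDegree_eq_zero hn, RatFunc.algebraMap_C]
  simp [algebraMap_apply]
  rfl

end isAlgClosed

end FunField

/-! ### Vélu's functions -/

namespace WeierstrassCurve.Affine.Point

variable {K : Type*} [Field K] [DecidableEq K] {W : WeierstrassCurve K}

/-- Version of `map_baseChange` for algebra homomorphisms over an extension of the base field. -/
lemma map_baseChange_of_tower {S A B : Type*} [Field A] [Field B] [DecidableEq A] [DecidableEq B]
    [CommRing S] [Algebra K S] [Algebra S A] [Algebra S B] [Algebra K A] [Algebra K B]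
    [IsScalarTower K S A] [IsScalarTower K S B] (f : A →ₐ[S] B) (c : (W⁄K).Point) :
    Point.map f (Point.baseChange K A c) = Point.baseChange K B c := by
  by_cases hc : c = 0
  · subst hc; simp
  refine ext_coords ?_ ?_ ?_ ?_
  · rwa [ne_eq, map_eq_zero, baseChange, map_eq_zero]
  · rwa [ne_eq, baseChange, map_eq_zero]
  · rw [xc_map, baseChange, baseChange, xc_map, xc_map]
    exact (f.restrictScalars K).commutes _
  · rw [yc_map, baseChange, baseChange, yc_map, yc_map]
    exact (f.restrictScalars K).commutes _

variable (H : AddSubgroup (W⁄K).Point) [Fintype H] {A : Type*} [Field A] [DecidableEq A]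
  [Algebra K A]

/-- Vélu's function `X(P) = x(P) + ∑ (x(P + c) - x(c))`, the sum being over the non-zero elements
of a finite subgroup `H`. With the convention `x(0) = 0` the term `x(P)` belongs to `c = 0`. -/
noncomputable def veluX (P : (W⁄A).Point) : A :=
  ∑ c : H, (P + Point.baseChange K A c.1).xc - algebraMap K A (∑ c : H, c.1.xc)

/-- Vélu's odd function `∑ η(P + c)`, the derivative of `veluX`. -/
noncomputable def veluE (P : (W⁄A).Point) : A :=
  ∑ c : H, (P + Point.baseChange K A c.1).ec

/-- The derivative of `veluE`. -/
noncomputable def veluD (P : (W⁄A).Point) : A :=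
  ∑ c : H, (6 * (P + Point.baseChange K A c.1).xc ^ 2 +
    algebraMap K A W.b₂ * (P + Point.baseChange K A c.1).xc + algebraMap K A W.b₄)

section invariance

lemma veluX_add (P : (W⁄A).Point) (c : H) :
    veluX H (P + Point.baseChange K A c.1) = veluX H P := by
  rw [veluX, veluX]
  congr 1
  refine Fintype.sum_equiv (Equiv.addLeft c) _ _ fun d ↦ ?_
  rw [add_assoc, ← map_add]; rfl

lemma veluE_add (P : (W⁄A).Point) (c : H) :
    veluE H (P + Point.baseChange K A c.1) = veluE H P := by
  rw [veluE, veluE]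
  refine Fintype.sum_equiv (Equiv.addLeft c) _ _ fun d ↦ ?_
  rw [add_assoc, ← map_add]; rfl

lemma veluD_add (P : (W⁄A).Point) (c : H) :
    veluD H (P + Point.baseChange K A c.1) = veluD H P := by
  rw [veluD, veluD]
  refine Fintype.sum_equiv (Equiv.addLeft c) _ _ fun d ↦ ?_
  rw [add_assoc P, ← map_add]; rfl

omit [Fintype H] in
lemma neg_add_baseChange (P : (W⁄A).Point) (c : H) : -P + Point.baseChange K A c.1 =
    -(P + Point.baseChange K A (Equiv.neg H c).1) := by
  simp [add_comm]

@[simp] lemma veluX_neg (P : (W⁄A).Point) : veluX H (-P) = veluX H P := by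
  rw [veluX, veluX]
  congr 1
  refine Fintype.sum_equiv (Equiv.neg H) _ _ fun d ↦ ?_
  rw [neg_add_baseChange, xc_neg]

@[simp] lemma veluD_neg (P : (W⁄A).Point) : veluD H (-P) = veluD H P := by
  rw [veluD, veluD]
  refine Fintype.sum_equiv (Equiv.neg H) _ _ fun d ↦ ?_
  rw [neg_add_baseChange, xc_neg]

end invariance

section functoriality

variable {S B : Type*} [Field B] [DecidableEq B] [CommRing S] [Algebra K S] [Algebra S A]
  [Algebra S B] [Algebra K B] [IsScalarTower K S A] [IsScalarTower K S B] (f : A →ₐ[S] B)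

lemma veluX_map (P : (W⁄A).Point) : veluX H (Point.map f P) = f (veluX H P) := by
  have h (c : K) : f (algebraMap K A c) = algebraMap K B c := (f.restrictScalars K).commutes c
  simp only [veluX, map_sub, map_sum, h]
  congr 1
  refine Finset.sum_congr rfl fun c _ ↦ ?_
  rw [← map_baseChange_of_tower f, ← map_add, xc_map]

lemma veluE_map (P : (W⁄A).Point) : veluE H (Point.map f P) = f (veluE H P) := by
  simp only [veluE, map_sum]
  refine Finset.sum_congr rfl fun c _ ↦ ?_
  rw [← map_baseChange_of_tower f, ← map_add, ec_map]

lemma veluD_map (P : (W⁄A).Point) : veluD H (Point.map f P) = f (veluD H P) := by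
  have h (c : K) : f (algebraMap K A c) = algebraMap K B c := (f.restrictScalars K).commutes c
  simp only [veluD, map_sum, map_add, map_mul, map_pow, map_ofNat, h]
  refine Finset.sum_congr rfl fun c _ ↦ ?_
  rw [← map_baseChange_of_tower f, ← map_add, xc_map]

end functoriality

end WeierstrassCurve.Affine.Point

namespace FunField

open WithZero Point

variable {K : Type*} [Field K] [DecidableEq K] {W : WeierstrassCurve K} [W.IsElliptic]
  (H : AddSubgroup (W⁄K).Point) [Fintype H]
  {k : Type*} [Field k] [Algebra K k] [CharZero k] [DecidableEq k]

lemma translate_add_baseChange (Q : (W⁄k).Point) (c : (W⁄K).Point) :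
    translate Q + Point.baseChange K (FunField W k) c = translate (Q + Point.baseChange K k c) := by
  rw [translate, translate, map_add, add_assoc]
  congr 2
  exact (map_baseChange_of_tower (Algebra.ofId k (FunField W k)) c).symm

lemma der_veluX (Q : (W⁄k).Point) : der W k (veluX H (translate Q)) = veluE H (translate Q) := by
  simp only [veluX, veluE, map_sub, map_sum, translate_add_baseChange, der_translate_xc,
    der_algebraMap']
  simp

lemma der_veluE (Q : (W⁄k).Point) : der W k (veluE H (translate Q)) = veluD H (translate Q) := by
  simp only [veluE, veluD, map_sum, translate_add_baseChange, der_translate_ec]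

lemma add_baseChange_ne_zero {Q : (W⁄k).Point}
    (hQ : Q ∉ H.map (Point.baseChange K k)) (c : H) : Q + Point.baseChange K k c.1 ≠ 0 := by
  intro h
  rw [add_eq_zero_iff_eq_neg, ← map_neg] at h
  exact hQ ⟨_, H.neg_mem c.2, h.symm⟩

lemma val_veluX_sub {Q : (W⁄k).Point} (hQ : Q ∉ H.map (Point.baseChange K k)) :
    val W k (veluX H (translate Q) - algebraMap k _ (veluX H Q)) < 1 := by
  simp only [veluX, translate_add_baseChange, map_sub, map_sum,
    ← IsScalarTower.algebraMap_apply K k (FunField W k), sub_sub_sub_cancel_right,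
    ← Finset.sum_sub_distrib]
  exact (val W k).map_sum_lt one_ne_zero fun c _ ↦ val_translate_xc (add_baseChange_ne_zero H hQ c)

lemma val_veluE_sub {Q : (W⁄k).Point} (hQ : Q ∉ H.map (Point.baseChange K k)) :
    val W k (veluE H (translate Q) - algebraMap k _ (veluE H Q)) < 1 := by
  simp only [veluE, translate_add_baseChange, map_sum, ← Finset.sum_sub_distrib]
  exact (val W k).map_sum_lt one_ne_zero fun c _ ↦ val_translate_ec (add_baseChange_ne_zero H hQ c)

omit [DecidableEq K] in
lemma val_le_one_of_sub_lt {f : FunField W k} {c : k} (h : val W k (f - algebraMap k _ c) < 1) :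
    val W k f ≤ 1 := by
  have := (val W k).map_add_le h.le (val_algebraMap_le c)
  rwa [sub_add_cancel] at this

/-- The difference of Vélu's `X` and `x` vanishes at infinity. -/
lemma val_veluX_sub_x : val W k (veluX H (gen W k) - x W k) < 1 := by
  have h0 : (0 : H) ∈ Finset.univ := Finset.mem_univ _
  have e : veluX H (gen W k) - x W k = ∑ c ∈ Finset.univ.erase (0 : H),
      ((translate (Point.baseChange K k c.1)).xc -
        algebraMap k _ (Point.baseChange K k c.1).xc) := by
    have hx (c : (W⁄K).Point) : algebraMap k (FunField W k) (Point.baseChange K k c).xc =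
        algebraMap K _ c.xc := by
      rw [Point.baseChange, xc_map, IsScalarTower.algebraMap_apply K k]; rfl
    rw [veluX, ← Finset.add_sum_erase _ _ h0, ← Finset.add_sum_erase _ _ h0, ← translate_zero]
    simp only [translate_add_baseChange, hx, Finset.sum_sub_distrib, map_add, map_sum]
    simp only [ZeroMemClass.coe_zero, _root_.map_zero, translate_zero, gen_xc, xc_zero,
      _root_.zero_add]
    ring
  rw [e]
  refine (val W k).map_sum_lt one_ne_zero fun c hc ↦ val_translate_xc fun h ↦ ?_
  rw [Point.baseChange, Point.map_eq_zero] at h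
  exact Finset.ne_of_mem_erase hc (Subtype.ext h)

lemma val_veluX_gen : val W k (veluX H (gen W k)) = exp 2 := by
  rw [← sub_add_cancel (veluX H (gen W k)) (x W k), ← val_x (W := W) (k := k)]
  refine (val W k).map_add_eq_of_lt_right ((val_veluX_sub_x H).trans ?_)
  exact one_lt_val_gen

lemma veluX_gen_ne_algebraMap (c : k) : veluX H (gen W k) ≠ algebraMap k _ c := by
  intro h
  have h2 := val_veluX_gen (W := W) (k := k) H
  have h1 : (1 : ℤᵐ⁰) < exp 2 := by rw [← exp_zero, exp_lt_exp]; norm_num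
  rw [← h2, h] at h1
  exact (h1.trans_le (val_algebraMap_le _)).false

lemma veluX_translate_of_mem {Q : (W⁄k).Point} (hQ : Q ∈ H.map (Point.baseChange K k)) :
    veluX H (translate Q) = veluX H (gen W k) := by
  obtain ⟨c, hc, rfl⟩ := hQ
  have := veluX_add H (translate (0 : (W⁄k).Point)) ⟨c, hc⟩
  rwa [translate_add_baseChange, zero_add, translate_zero] at this

lemma veluE_translate_of_mem {Q : (W⁄k).Point} (hQ : Q ∈ H.map (Point.baseChange K k)) :
    veluE H (translate Q) = veluE H (gen W k) := by
  obtain ⟨c, hc, rfl⟩ := hQ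
  have := veluE_add H (translate (0 : (W⁄k).Point)) ⟨c, hc⟩
  rwa [translate_add_baseChange, zero_add, translate_zero] at this

lemma veluD_translate_of_mem {Q : (W⁄k).Point} (hQ : Q ∈ H.map (Point.baseChange K k)) :
    veluD H (translate Q) = veluD H (gen W k) := by
  obtain ⟨c, hc, rfl⟩ := hQ
  have := veluD_add H (translate (0 : (W⁄k).Point)) ⟨c, hc⟩
  rwa [translate_add_baseChange, zero_add, translate_zero] at this

variable [IsAlgClosed k]

omit [DecidableEq K] in
/-- An even function vanishing at infinity vanishes there to order at least two. -/
lemma val_le_of_conj_eq {f : FunField W k} (hf : conj f = f) (h : val W k f < 1) :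
    val W k f ≤ exp (-2) := by
  have hfr : f = ⟨f.re, 0⟩ := by
    ext
    · simp
    · simpa using im_eq_zero_of_conj_eq hf
  rw [hfr, val_mk_zero] at h ⊢
  have h1 : RatFunc.inftyValuation k f.re < 1 := by
    by_contra! hc
    exact (h.trans_le (one_le_pow₀ hc)).false
  have h2 : RatFunc.inftyValuation k f.re ≤ exp (-1) := by
    rw [← exp_zero] at h1
    generalize RatFunc.inftyValuation k f.re = u at h1
    rcases eq_or_ne u 0 with rfl | hu
    · exact zero_le
    · rw [← exp_log hu] at h1 ⊢
      rw [exp_lt_exp] at h1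
      rw [exp_le_exp]
      omega
  calc _ ≤ exp (-1 : ℤ) ^ 2 := pow_le_pow_left₀ zero_le h2 2
    _ = exp (-2) := by rw [exp_sq]; norm_num

omit [DecidableEq K] in
lemma map_conj_gen : Point.map conj (gen W k) = -gen W k := by
  have := map_conj_translate (0 : (W⁄k).Point)
  rwa [_root_.neg_zero, translate_zero] at this

omit [DecidableEq K] in
lemma map_transl_gen (Q : (W⁄k).Point) : Point.map (transl Q) (gen W k) = translate Q := by
  have := map_transl_translate Q (0 : (W⁄k).Point)
  rwa [_root_.add_zero, translate_zero] at this

omit [DecidableEq K] in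
lemma conj_x : conj (x W k) = x W k := by
  have := congrArg Point.xc (map_conj_gen (W := W) (k := k))
  rwa [xc_map, xc_neg] at this

lemma conj_veluX : conj (veluX H (gen W k)) = veluX H (gen W k) := by
  rw [← veluX_map, map_conj_gen, veluX_neg]

lemma conj_veluD : conj (veluD H (gen W k)) = veluD H (gen W k) := by
  rw [← veluD_map, map_conj_gen, veluD_neg]

/-- A value that Vélu's `X` does not take would give an even function without poles. -/
lemma exists_val_veluX_sub_lt_one (c : k) : ∃ Q : (W⁄k).Point,
    val W k (veluX H (translate Q) - algebraMap k _ c) < 1 := by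
  by_contra! h
  have hne : veluX H (gen W k) - algebraMap k _ c ≠ 0 :=
    sub_ne_zero.mpr (veluX_gen_ne_algebraMap H c)
  obtain ⟨d, hd⟩ := eq_algebraMap_of_forall_val_le (W := W) (k := k)
    (f := (veluX H (gen W k) - algebraMap k _ c)⁻¹) (by
      rw [map_inv₀, map_sub, conj_veluX, AlgHom.commutes]) (fun Q ↦ by
      rw [map_inv₀, map_sub, ← veluX_map, map_transl_gen, AlgHom.commutes, map_inv₀]
      exact inv_le_one_of_one_le₀ (h Q))
  refine veluX_gen_ne_algebraMap H (d⁻¹ + c) ?_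
  rw [inv_eq_iff_eq_inv] at hd
  rw [map_add, map_inv₀, ← hd, sub_add_cancel]

/-- Vélu's `X` takes every value. -/
lemma exists_veluX_eq (c : k) : ∃ Q : (W⁄k).Point, Q ∉ H.map (Point.baseChange K k) ∧
    veluX H Q = c := by
  obtain ⟨Q, hQ⟩ := exists_val_veluX_sub_lt_one (W := W) H c
  have hm : Q ∉ H.map (Point.baseChange K k) := by
    intro hm
    have := val_le_one_of_sub_lt hQ
    rw [veluX_translate_of_mem H hm, val_veluX_gen, ← exp_zero, exp_le_exp] at this
    norm_num at this
  refine ⟨Q, hm, sub_eq_zero.mp (eq_zero_of_val_lt_one (W := W) (k := k) ?_)⟩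
  have := (val W k).map_sub_lt hQ (val_veluX_sub H hm)
  rwa [sub_sub_sub_cancel_left, ← map_sub] at this

/-- The second derivative of Vélu's `X` is a quadratic polynomial in `X`. -/
lemma exists_veluD_eq : ∃ a : k, ∀ Q : (W⁄k).Point, veluD H (translate Q) =
    6 * veluX H (translate Q) ^ 2 + algebraMap K _ W.b₂ * veluX H (translate Q) +
      algebraMap k _ a := by
  have h6 := (val W k).map_ofNat_le_one 6
  have hb (c : K) : val W k (algebraMap K _ c) ≤ 1 := val_algebraMap_le' c
  have hcK (g : FunField W k →ₐ[k] FunField W k) (c : K) :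
      g (algebraMap K _ c) = algebraMap K _ c := (g.restrictScalars K).commutes c
  have hsum (s : Finset H) (Q : (W⁄k).Point)
      (hs : ∀ c ∈ s, Q + Point.baseChange K k c.1 ≠ 0) :
      val W k (∑ c ∈ s, (6 * (translate (Q + Point.baseChange K k c.1)).xc ^ 2 +
        algebraMap K _ W.b₂ * (translate (Q + Point.baseChange K k c.1)).xc +
          algebraMap K _ W.b₄)) ≤ 1 := by
    refine (val W k).map_sum_le fun c hc ↦ ?_
    have hx := val_le_one_of_sub_lt (val_translate_xc (hs c hc))
    refine (val W k).map_add_le ((val W k).map_add_le ?_ ?_) (hb _)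
    · exact (val W k).map_mul_le_of_le_one h6 (by rw [map_pow]; exact pow_le_one' hx 2)
    · exact (val W k).map_mul_le_of_le_one (hb _) hx
  obtain ⟨a, ha⟩ := eq_algebraMap_of_forall_val_le (W := W) (k := k)
    (f := veluD H (gen W k) - (6 * veluX H (gen W k) ^ 2 +
      algebraMap K _ W.b₂ * veluX H (gen W k))) (by
      simp only [map_sub, map_add, map_mul, map_pow, map_ofNat, conj_veluX, conj_veluD, hcK])
    (fun Q ↦ by
      simp only [map_sub, map_add, map_mul, map_pow, map_ofNat, ← veluX_map, ← veluD_map, hcK,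
        map_transl_gen]
      by_cases hQ : Q ∈ H.map (Point.baseChange K k)
      · rw [veluX_translate_of_mem H hQ, veluD_translate_of_mem H hQ]
        set r := veluX H (gen W k) - x W k with hr
        have hr1 : val W k r < 1 := val_veluX_sub_x H
        have hr2 : val W k r ≤ exp (-2) := by
          refine val_le_of_conj_eq ?_ hr1
          rw [hr, map_sub, conj_veluX, conj_x]
        have hX : veluX H (gen W k) = x W k + r := by rw [hr]; ring
        have hD : veluD H (gen W k) = 6 * x W k ^ 2 + algebraMap K _ W.b₂ * x W k +
            algebraMap K _ W.b₄ + ∑ c ∈ Finset.univ.erase (0 : H),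
              (6 * (translate (0 + Point.baseChange K k c.1)).xc ^ 2 +
              algebraMap K _ W.b₂ * (translate (0 + Point.baseChange K k c.1)).xc +
              algebraMap K _ W.b₄) := by
          rw [veluD, ← Finset.add_sum_erase _ _ (Finset.mem_univ (0 : H)), ← translate_zero]
          simp only [translate_add_baseChange]
          simp
        have e : veluD H (gen W k) - (6 * veluX H (gen W k) ^ 2 +
            algebraMap K _ W.b₂ * veluX H (gen W k)) = algebraMap K _ W.b₄ +
            ∑ c ∈ Finset.univ.erase (0 : H),
              (6 * (translate (0 + Point.baseChange K k c.1)).xc ^ 2 +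
              algebraMap K _ W.b₂ * (translate (0 + Point.baseChange K k c.1)).xc +
              algebraMap K _ W.b₄) - 6 * (2 * (x W k * r)) - 6 * r ^ 2 -
              algebraMap K _ W.b₂ * r := by
          rw [hD, hX]; ring
        rw [e]
        refine (val W k).map_sub_le ((val W k).map_sub_le ((val W k).map_sub_le
          ((val W k).map_add_le (hb _) (hsum _ _ fun c hc h ↦ ?_)) ?_) ?_) ?_
        · rw [_root_.zero_add, Point.baseChange, Point.map_eq_zero] at h
          exact Finset.ne_of_mem_erase hc (Subtype.ext h)
        · refine (val W k).map_mul_le_of_le_one h6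
            ((val W k).map_mul_le_of_le_one ((val W k).map_ofNat_le_one 2) ?_)
          rw [map_mul, val_x]
          calc _ ≤ exp (2 : ℤ) * exp (-2) := mul_le_mul_right hr2 _
            _ = 1 := by rw [← exp_add]; simp
        · exact (val W k).map_mul_le_of_le_one h6 (by rw [map_pow]; exact pow_le_one' hr1.le 2)
        · exact (val W k).map_mul_le_of_le_one (hb _) hr1.le
      · have hx := val_le_one_of_sub_lt (val_veluX_sub H hQ)
        refine (val W k).map_sub_le ?_ ((val W k).map_add_le ?_ ?_)
        · rw [veluD]
          simp only [translate_add_baseChange]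
          exact hsum _ _ fun c _ ↦ add_baseChange_ne_zero H hQ c
        · exact (val W k).map_mul_le_of_le_one h6 (by rw [map_pow]; exact pow_le_one' hx 2)
        · exact (val W k).map_mul_le_of_le_one (hb _) hx)
  refine ⟨a, fun Q ↦ ?_⟩
  have h := congrArg (transl Q) ha
  simp only [map_sub, map_add, map_mul, map_pow, map_ofNat, ← veluX_map, ← veluD_map, hcK,
        map_transl_gen, AlgHom.commutes] at h
  linear_combination h

/-- Vélu's functions satisfy a Weierstrass equation. -/
lemma exists_veluE_sq_eq : ∃ a d : k, ∀ Q : (W⁄k).Point, veluE H (translate Q) ^ 2 =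
    4 * veluX H (translate Q) ^ 3 + algebraMap K _ W.b₂ * veluX H (translate Q) ^ 2 +
      2 * algebraMap k _ a * veluX H (translate Q) + algebraMap k _ d := by
  obtain ⟨a, ha⟩ := exists_veluD_eq (W := W) (k := k) H
  obtain ⟨d, hd⟩ := eq_algebraMap_of_der_eq_zero (W := W) (k := k)
    (f := veluE H (gen W k) ^ 2 - (4 * veluX H (gen W k) ^ 3 + algebraMap K _ W.b₂ *
      veluX H (gen W k) ^ 2 + 2 * algebraMap k _ a * veluX H (gen W k))) (by
    have h := ha 0
    have h1 := der_veluX H (0 : (W⁄k).Point)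
    have h2 := der_veluE H (0 : (W⁄k).Point)
    rw [translate_zero] at h h1 h2
    have d2 : der W k (2 : FunField W k) = 0 := der_ofNat 2
    have d4 : der W k (4 : FunField W k) = 0 := der_ofNat 4
    simp only [map_sub, map_add, Derivation.leibniz, Derivation.leibniz_pow, smul_eq_mul,
      nsmul_eq_mul, h1, h2, h, d2, d4, der_algebraMap', Derivation.map_algebraMap]
    push_cast
    ring)
  refine ⟨a, d, fun Q ↦ ?_⟩
  have hcK (g : FunField W k →ₐ[k] FunField W k) (c : K) :
      g (algebraMap K _ c) = algebraMap K _ c := (g.restrictScalars K).commutes c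
  have h := congrArg (transl Q) hd
  simp only [map_sub, map_add, map_mul, map_pow, map_ofNat, ← veluX_map, ← veluE_map, hcK,
        map_transl_gen, AlgHom.commutes] at h
  linear_combination h

lemma veluE_gen_ne_zero : veluE H (gen W k) ≠ 0 := by
  intro h
  have h1 := der_veluX H (0 : (W⁄k).Point)
  rw [translate_zero, h] at h1
  obtain ⟨c, hc⟩ := eq_algebraMap_of_der_eq_zero h1
  exact veluX_gen_ne_algebraMap H c hc

/-- Vélu's equation has no double root `u`: otherwise the curve would be parametrized by a function
`s` with `D s = s (s + 2b)` and `X - u = s (s + 2b)`, and a function with `D s = s (s + 2b)` takes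
neither of the values `0` and `-2b`. -/
lemma not_veluE_sq_eq_double_root {u w : k} (h : ∀ Q : (W⁄k).Point, veluE H (translate Q) ^ 2 =
    4 * (veluX H (translate Q) - algebraMap k _ u) ^ 2 *
      (veluX H (translate Q) - algebraMap k _ w)) : False := by
  obtain ⟨Q, hQ⟩ := exists_val_veluX_sub_lt_one (W := W) H u
  obtain ⟨b, hb⟩ := IsAlgClosed.exists_pow_nat_eq (u - w) two_pos
  have hE0 : veluE H (translate Q) ≠ 0 := by
    rw [← map_transl_gen, veluE_map, ne_eq, _root_.map_eq_zero]
    exact veluE_gen_ne_zero H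
  have hE := h Q
  have hX := der_veluX H Q
  have hXu : veluX H (translate Q) - algebraMap k _ u ≠ 0 := by
    intro h0
    rw [h0] at hE
    exact hE0 (by simpa using hE)
  set X := veluX H (translate Q)
  set E := veluE H (translate Q)
  set s := E / (2 * (X - algebraMap k _ u)) - algebraMap k _ b with hs
  have hb' : (algebraMap k (FunField W k) b) ^ 2 = algebraMap k _ u - algebraMap k _ w := by
    rw [← map_pow, hb, map_sub]
  have hts : 2 * (X - algebraMap k _ u) * (s + algebraMap k _ b) = E := by
    rw [hs]; field_simp; ring
  have ht0 : s + algebraMap k _ b ≠ 0 := by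
    intro h0; rw [h0, mul_zero] at hts; exact hE0 hts.symm
  have ht2 : (s + algebraMap k _ b) ^ 2 = X - algebraMap k _ w := by
    apply mul_left_cancel₀ (pow_ne_zero 2 (mul_ne_zero (two_ne_zero (α := FunField W k)) hXu))
    rw [mul_pow, show (2 : FunField W k) ^ 2 = 4 by norm_num, ← hE, ← hts]; ring
  have hXs : X - algebraMap k _ u = s * (s + 2 * algebraMap k _ b) := by
    linear_combination -ht2 + hb'
  have hds : der W k s = s * (s + 2 * algebraMap k _ b) := by
    rw [← hXs]
    apply mul_left_cancel₀ (mul_ne_zero (two_ne_zero (α := FunField W k)) ht0)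
    have := congrArg (der W k) ht2
    simp only [map_sub, map_add, Derivation.leibniz_pow, smul_eq_mul, nsmul_eq_mul,
      Derivation.map_algebraMap] at this
    push_cast at this
    rw [hX, ← hts] at this
    linear_combination this
  have hds' : der W k (s + 2 * algebraMap k _ b) = s * (s + 2 * algebraMap k _ b) := by
    have d2 : der W k (2 : FunField W k) = 0 := der_ofNat 2
    rw [map_add, hds, Derivation.leibniz, d2, Derivation.map_algebraMap]
    simp
  have hs0 : s ≠ 0 := by rintro h0; rw [h0, zero_mul] at hXs; exact hXu hXs
  have hs0' : s + 2 * algebraMap k _ b ≠ 0 := by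
    rintro h0; rw [h0, mul_zero] at hXs; exact hXu hXs
  have h2b : val W k (2 * algebraMap k _ b) ≤ 1 :=
    (val W k).map_mul_le_of_le_one ((val W k).map_ofNat_le_one 2) (val_algebraMap_le b)
  -- a function with a zero has a derivative with a larger value
  have key {f g : FunField W k} (hf : f ≠ 0) (hf1 : val W k f < 1) (hg : val W k g ≤ 1)
      (hd : der W k f = f * g) : False := by
    have h1 := val_der_eq hf1.ne
    rw [hd, map_mul] at h1
    have h2 := mul_left_cancel₀ ((_root_.map_ne_zero _).mpr hf) h1
    rw [h2, ← exp_zero, exp_le_exp] at hg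
    norm_num at hg
  rw [hXs, map_mul] at hQ
  by_cases hs1 : val W k s < 1
  · exact key hs0 hs1 ((val W k).map_add_le hs1.le h2b) hds
  · have h1 : val W k (s + 2 * algebraMap k _ b) < 1 := by
      by_contra! hc
      exact hQ.not_ge (one_le_mul (not_lt.mp hs1) hc)
    refine key hs0' h1 (g := s) ?_ (by rw [hds']; ring)
    have := (val W k).map_sub_le h1.le h2b
    rwa [add_sub_cancel_right] at this

end FunField

/-! ### The quotient curve -/

namespace FunField

open WithZero Point

variable {K : Type*} [Field K] [DecidableEq K] {W : WeierstrassCurve K} [W.IsElliptic]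
  (H : AddSubgroup (W⁄K).Point) [Fintype H]

section relation

variable {k : Type*} [Field k] [Algebra K k] [CharZero k] [DecidableEq k]

/-- Vélu's functions satisfy the Weierstrass equation with constants `a` and `d`. -/
def VeluRel (a d : k) : Prop :=
  ∀ Q : (W⁄k).Point, veluE H (translate Q) ^ 2 =
    4 * veluX H (translate Q) ^ 3 + algebraMap K _ W.b₂ * veluX H (translate Q) ^ 2 +
      2 * algebraMap k _ a * veluX H (translate Q) + algebraMap k _ d

variable {H}

lemma VeluRel.eval {a d : k} (h : VeluRel H a d) {Q : (W⁄k).Point}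
    (hQ : Q ∉ H.map (Point.baseChange K k)) : veluE H Q ^ 2 =
      4 * veluX H Q ^ 3 + algebraMap K _ W.b₂ * veluX H Q ^ 2 + 2 * a * veluX H Q + d := by
  have h := h Q
  have hX := val_veluX_sub H hQ
  have hE := val_veluE_sub H hQ
  have hX1 := val_le_one_of_sub_lt hX
  have hE1 := val_le_one_of_sub_lt hE
  rw [← sub_eq_zero]
  refine eq_zero_of_val_lt_one (W := W) (k := k) ?_
  simp only [map_sub, map_add, map_mul, map_pow, map_ofNat,
    ← IsScalarTower.algebraMap_apply K k (FunField W k)]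
  set X := veluX H (translate Q)
  set E := veluE H (translate Q)
  set X₀ := algebraMap k (FunField W k) (veluX H Q)
  set E₀ := algebraMap k (FunField W k) (veluE H Q)
  have hX₀ : val W k X₀ ≤ 1 := val_algebraMap_le _
  have hE₀ : val W k E₀ ≤ 1 := val_algebraMap_le _
  have h4 := (val W k).map_ofNat_le_one 4
  have h2 := (val W k).map_ofNat_le_one 2
  have hb : val W k (algebraMap K _ W.b₂) ≤ 1 := val_algebraMap_le' _
  have ha : val W k (algebraMap k _ a) ≤ 1 := val_algebraMap_le _
  have vm {f g : FunField W k} (hf : val W k f ≤ 1) (hg : val W k g ≤ 1) : val W k (f * g) ≤ 1 :=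
    (val W k).map_mul_le_of_le_one hf hg
  have vp {f : FunField W k} (n : ℕ) (hf : val W k f ≤ 1) : val W k (f ^ n) ≤ 1 := by
    rw [map_pow]; exact pow_le_one' hf n
  have e : E₀ ^ 2 - (4 * X₀ ^ 3 + algebraMap K _ W.b₂ * X₀ ^ 2 + 2 * algebraMap k _ a * X₀ +
      algebraMap k _ d) = (4 * (X ^ 2 + X * X₀ + X₀ ^ 2) + algebraMap K _ W.b₂ * (X + X₀) +
        2 * algebraMap k _ a) * (X - X₀) - (E + E₀) * (E - E₀) := by
    linear_combination h
  rw [e]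
  refine (val W k).map_sub_lt ?_ ?_
  · rw [map_mul]
    refine (mul_le_of_le_one_left' ?_).trans_lt hX
    exact (val W k).map_add_le ((val W k).map_add_le (vm h4 ((val W k).map_add_le
      ((val W k).map_add_le (vp 2 hX1) (vm hX1 hX₀)) (vp 2 hX₀)))
      (vm hb ((val W k).map_add_le hX1 hX₀))) (vm h2 ha)
  · rw [map_mul]
    exact (mul_le_of_le_one_left' ((val W k).map_add_le hE1 hE₀)).trans_lt hE

variable [IsAlgClosed k] {k' : Type*} [Field k'] [Algebra K k'] [CharZero k'] [DecidableEq k']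
  [IsAlgClosed k']

lemma notMem_map_baseChange (f : k →ₐ[K] k') {Q : (W⁄k).Point}
    (hQ : Q ∉ H.map (Point.baseChange K k)) :
    Point.map f Q ∉ H.map (Point.baseChange K k') := by
  rintro ⟨c, hc, h⟩
  rw [← map_baseChange_of_tower f] at h
  exact hQ ⟨c, hc, map_injective f h⟩

/-- The constants of Vélu's equation do not depend on the field of constants. -/
lemma VeluRel.map_eq {a d : k} {a' d' : k'} (h : VeluRel H a d) (h' : VeluRel H a' d')
    (f : k →ₐ[K] k') : f a = a' ∧ f d = d' := by
  obtain ⟨Q, hQ, hQX⟩ := exists_veluX_eq (k := k) H 0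
  obtain ⟨P, hP, hPX⟩ := exists_veluX_eq (k := k) H 1
  have hQ1 := congrArg f (h.eval hQ)
  have hP1 := congrArg f (h.eval hP)
  have hQ2 := h'.eval (notMem_map_baseChange f hQ)
  have hP2 := h'.eval (notMem_map_baseChange f hP)
  simp only [map_add, map_mul, map_pow, map_ofNat, AlgHom.commutes, veluX_map, veluE_map, hQX,
    hPX, _root_.map_zero, map_one] at hQ1 hP1 hQ2 hP2
  have hd : f d = d' := by linear_combination -hQ1 + hQ2
  refine ⟨?_, hd⟩
  apply mul_left_cancel₀ (two_ne_zero (α := k'))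
  linear_combination -hP1 + hP2 - hd

variable (H) in
lemma exists_veluRel [CharZero K] : ∃ a d : K,
    VeluRel H (algebraMap K (AlgebraicClosure K) a) (algebraMap K (AlgebraicClosure K) d) := by
  obtain ⟨a, d, h⟩ := exists_veluE_sq_eq (k := AlgebraicClosure K) H
  have h : VeluRel H a d := h
  obtain ⟨a, rfl⟩ := (InfiniteGalois.mem_range_algebraMap_iff_fixed a).mpr fun σ ↦
    (h.map_eq h σ.toAlgHom).1
  obtain ⟨d, rfl⟩ := (InfiniteGalois.mem_range_algebraMap_iff_fixed d).mpr fun σ ↦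
    (h.map_eq h σ.toAlgHom).2
  exact ⟨a, d, h⟩

lemma VeluRel.of_algebraicClosure [CharZero K] {a d : K}
    (h : VeluRel H (algebraMap K (AlgebraicClosure K) a) (algebraMap K (AlgebraicClosure K) d)) :
    VeluRel H (algebraMap K k a) (algebraMap K k d) := by
  obtain ⟨a', d', h'⟩ := exists_veluE_sq_eq (k := k) H
  have h' : VeluRel H a' d' := h'
  obtain ⟨rfl, rfl⟩ := h.map_eq h' (IsAlgClosed.lift (R := K))
  simpa only [AlgHom.commutes] using h'

end relation

variable [CharZero K]

/-- The quotient of the curve `W` by the finite subgroup `H`, by Vélu's formulas. -/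
noncomputable def veluCurve : WeierstrassCurve K :=
  ⟨0, W.b₂ / 4, 0, (exists_veluRel H).choose / 2, (exists_veluRel H).choose_spec.choose / 4⟩

variable {k : Type*} [Field k] [Algebra K k] [CharZero k] [DecidableEq k] [IsAlgClosed k]

lemma veluE_sq (Q : (W⁄k).Point) : (veluE H (translate Q) / 2) ^ 2 =
    veluX H (translate Q) ^ 3 + algebraMap K _ (veluCurve H).a₂ * veluX H (translate Q) ^ 2 +
      algebraMap K _ (veluCurve H).a₄ * veluX H (translate Q) +
      algebraMap K _ (veluCurve H).a₆ := by
  have h := (exists_veluRel H).choose_spec.choose_spec.of_algebraicClosure (k := k) Q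
  simp only [veluCurve, map_div₀, map_ofNat, ← IsScalarTower.algebraMap_apply] at h ⊢
  linear_combination h / 4

/-- A singular equation would have a double root. -/
instance : (veluCurve H).IsElliptic := by
  set F := veluCurve H with hF
  have hb₂ : F.b₂ = W.b₂ := by simp [F, veluCurve, b₂]; ring
  have ha : F.a₁ = 0 ∧ F.a₃ = 0 := ⟨rfl, rfl⟩
  refine ⟨isUnit_iff_ne_zero.mpr fun hΔ ↦ ?_⟩
  have hdisc : F.twoTorsionPolynomial.discr = 0 := by
    rw [twoTorsionPolynomial_discr, hΔ, mul_zero]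
  have h4 : F.twoTorsionPolynomial.a ≠ 0 := by
    simp [twoTorsionPolynomial]
  obtain ⟨u, v, w, hr⟩ := (Cubic.splits_iff_roots_eq_three
    (φ := algebraMap K (AlgebraicClosure K)) h4).mp (IsAlgClosed.splits _)
  have hb := Cubic.b_eq_three_roots h4 hr
  have hc := Cubic.c_eq_three_roots h4 hr
  have hd := Cubic.d_eq_three_roots h4 hr
  have hne := (Cubic.discr_ne_zero_iff_roots_ne h4 hr).not.mp (not_not.mpr hdisc)
  simp only [twoTorsionPolynomial, map_mul, map_ofNat, b₂, b₄, b₆, ha.1, ha.2, map_add, map_pow,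
    _root_.map_zero] at hb hc hd
  let L := FunField W (AlgebraicClosure K)
  have hAK (c : K) : algebraMap K L c = algebraMap (AlgebraicClosure K) L (algebraMap K _ c) :=
    IsScalarTower.algebraMap_apply ..
  have key (Q : (W⁄(AlgebraicClosure K)).Point) : veluE H (translate Q) ^ 2 =
      4 * (veluX H (translate Q) - algebraMap _ L u) *
        (veluX H (translate Q) - algebraMap _ L v) * (veluX H (translate Q) - algebraMap _ L w) := by
    have h := veluE_sq H Q
    have hb := congrArg (algebraMap (AlgebraicClosure K) L) hb
    have hc := congrArg (algebraMap (AlgebraicClosure K) L) hc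
    have hd := congrArg (algebraMap (AlgebraicClosure K) L) hd
    simp only [map_mul, map_add, map_neg, map_ofNat, map_pow, _root_.map_zero] at hb hc hd
    rw [hAK, hAK, hAK] at h
    linear_combination 4 * h + veluX H (translate Q) ^ 2 * hb + veluX H (translate Q) * hc + hd
  by_cases huv : u = v
  · subst huv
    exact not_veluE_sq_eq_double_root H (u := u) (w := w) fun Q ↦ by rw [key Q]; ring
  by_cases huw : u = w
  · subst huw
    exact not_veluE_sq_eq_double_root H (u := u) (w := v) fun Q ↦ by rw [key Q]; ring
  by_cases hvw : v = w
  · subst hvw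
    exact not_veluE_sq_eq_double_root H (u := v) (w := u) fun Q ↦ by rw [key Q]; ring
  exact hne ⟨huv, huw, hvw⟩

/-- The point with Vélu's coordinates on the quotient curve over the function field, at the generic
point translated by `Q`. -/
noncomputable def veluPoint (Q : (W⁄k).Point) : ((veluCurve H)⁄(FunField W k)).Point :=
  .some (veluX H (translate Q)) (veluE H (translate Q) / 2) <| equation_iff_nonsingular.mp <| by
    have h := veluE_sq H Q
    rw [equation_iff, baseChange_a₁, baseChange_a₂, baseChange_a₃, baseChange_a₄, baseChange_a₆,
      show (veluCurve H).a₁ = 0 from rfl, show (veluCurve H).a₃ = 0 from rfl, _root_.map_zero]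
    linear_combination h

lemma veluPoint_ne_zero (Q : (W⁄k).Point) : veluPoint H Q ≠ 0 := some_ne_zero _

@[simp] lemma veluPoint_xc (Q : (W⁄k).Point) : (veluPoint H Q).xc = veluX H (translate Q) := rfl

@[simp] lemma veluPoint_yc (Q : (W⁄k).Point) : (veluPoint H Q).yc = veluE H (translate Q) / 2 :=
  rfl

lemma map_transl_veluPoint (Q P : (W⁄k).Point) :
    Point.map (transl Q) (veluPoint H P) = veluPoint H (Q + P) := by
  refine ext_coords (fun h ↦ veluPoint_ne_zero H P ((Point.map_eq_zero _).mp h))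
    (veluPoint_ne_zero H _) ?_ ?_
  · rw [xc_map, veluPoint_xc, veluPoint_xc, ← veluX_map, map_transl_translate]
  · rw [yc_map, veluPoint_yc, veluPoint_yc, map_div₀, map_ofNat, ← veluE_map, map_transl_translate]

/-- The translate of Vélu's point by `Q` differs from it by a constant point, as both have the same
logarithmic derivative `DX / 2Y = 1`. -/
lemma exists_veluPoint_eq (Q : (W⁄k).Point) : ∃ S : ((veluCurve H)⁄k).Point,
    veluPoint H Q = veluPoint H (0 : (W⁄k).Point) + Point.baseChange k _ S := by
  set F := veluCurve H
  have ha (c : K) : der W k (algebraMap K _ c) = 0 := der_algebraMap' c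
  have e₁ : (F⁄(FunField W k)).a₁ = 0 := by
    rw [baseChange_a₁, show F.a₁ = 0 from rfl, _root_.map_zero]
  have e₃ : (F⁄(FunField W k)).a₃ = 0 := by
    rw [baseChange_a₃, show F.a₃ = 0 from rfl, _root_.map_zero]
  have h2 (P : (W⁄k).Point) : der W k (veluPoint H P).yc = 3 * (veluPoint H P).xc ^ 2 +
      2 * (F⁄(FunField W k)).a₂ * (veluPoint H P).xc + (F⁄(FunField W k)).a₄ := by
    have h := congrArg (der W k) (veluE_sq H P)
    have hE0 : veluE H (translate P) ≠ 0 := by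
      rw [← map_transl_gen, veluE_map, ne_eq, _root_.map_eq_zero]
      exact veluE_gen_ne_zero H
    rw [baseChange_a₂, baseChange_a₄, veluPoint_xc, veluPoint_yc]
    apply mul_left_cancel₀ hE0
    simp only [map_add, Derivation.leibniz, Derivation.leibniz_pow, ha, smul_eq_mul, nsmul_eq_mul,
      der_veluX] at h
    push_cast at h
    linear_combination h
  have h1 (P : (W⁄k).Point) : der W k (veluPoint H P).xc = 2 * (veluPoint H P).yc := by
    rw [veluPoint_xc, veluPoint_yc, der_veluX]; ring
  by_cases hX : (veluPoint H Q).xc = (veluPoint H (0 : (W⁄k).Point)).xc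
  · refine ⟨0, ?_⟩
    rw [_root_.map_zero, _root_.add_zero]
    refine ext_coords (veluPoint_ne_zero H _) (veluPoint_ne_zero H _) hX ?_
    have := congrArg (der W k) hX
    rw [h1, h1] at this
    exact mul_left_cancel₀ two_ne_zero this
  have hne : (veluPoint H Q).xc ≠ (-veluPoint H (0 : (W⁄k).Point)).xc := by rwa [xc_neg]
  have hD := derivation_xc_add (der W k) (W := (F⁄(FunField W k))) (u := 1) (v := -1)
    (by rw [baseChange_a₁]; exact ha _) (by rw [baseChange_a₂]; exact ha _)
    (veluPoint_ne_zero H Q) (neg_ne_zero.mpr (veluPoint_ne_zero H 0)) hne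
    (by rw [h1, e₁, e₃]; ring) (by rw [h2, e₁]; ring)
    (by rw [xc_neg, yc_neg (veluPoint_ne_zero H 0), h1, e₁, e₃]; ring)
    (by
      rw [xc_neg, yc_neg (veluPoint_ne_zero H 0), e₁, e₃, zero_mul, sub_zero, sub_zero, map_neg, h2]
      ring)
  rw [add_neg_cancel, zero_mul] at hD
  set R := veluPoint H Q + -veluPoint H (0 : (W⁄k).Point) with hR
  have hR0 : R ≠ 0 := add_ne_zero_of_xc_ne hne
  obtain ⟨s, hs⟩ := eq_algebraMap_of_der_eq_zero hD
  have hRe := equation_of_ne_zero hR0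
  obtain ⟨S₀, hS₀, hS₀x⟩ := Point.exists_xc_eq (F⁄k) s
  have hx : R.xc = (Point.baseChange k (FunField W k) S₀).xc := by
    rw [hs, Point.baseChange, xc_map, hS₀x]; rfl
  have hS0' : Point.baseChange k (FunField W k) S₀ ≠ 0 := by
    rwa [ne_eq, Point.baseChange, Point.map_eq_zero]
  rcases eq_or_eq_neg_of_xc_eq hR0 hS0' hx with h | h
  · exact ⟨S₀, by rw [← h, hR]; abel⟩
  · exact ⟨-S₀, by rw [map_neg, ← h, hR]; abel⟩

variable (k) in
/-- The quotient map `E → E / H` on points over an algebraically closed field. -/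
noncomputable def veluHom : (W⁄k).Point →+ ((veluCurve H)⁄k).Point :=
  AddMonoidHom.mk' (fun Q ↦ (exists_veluPoint_eq H Q).choose) fun Q P ↦ by
    have hQ := (exists_veluPoint_eq H Q).choose_spec
    have hP := (exists_veluPoint_eq H P).choose_spec
    have hQP := (exists_veluPoint_eq H (Q + P)).choose_spec
    have h := congrArg (Point.map (transl Q)) hP
    rw [map_transl_veluPoint, map_add, map_transl_veluPoint, Point.map_baseChange, hQP,
      _root_.add_zero, hQ, add_assoc] at h
    apply map_injective (Algebra.ofId k (FunField W k))
    rw [map_add]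
    exact add_left_cancel h

lemma veluPoint_eq (Q : (W⁄k).Point) :
    veluPoint H Q = veluPoint H (0 : (W⁄k).Point) + Point.baseChange k _ (veluHom H k Q) :=
  (exists_veluPoint_eq H Q).choose_spec

lemma veluHom_eq_zero_iff {Q : (W⁄k).Point} :
    veluHom H k Q = 0 ↔ Q ∈ H.map (Point.baseChange K k) := by
  have h := veluPoint_eq H Q
  constructor
  · intro h0
    by_contra hQ
    rw [h0, _root_.map_zero, _root_.add_zero] at h
    have hX := congrArg xc h
    rw [veluPoint_xc, veluPoint_xc, translate_zero] at hX
    have := val_le_one_of_sub_lt (val_veluX_sub H hQ)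
    rw [hX, val_veluX_gen, ← exp_zero, exp_le_exp] at this
    norm_num at this
  · intro hQ
    have hQ0 : veluPoint H Q = veluPoint H (0 : (W⁄k).Point) := by
      refine ext_coords (veluPoint_ne_zero H _) (veluPoint_ne_zero H _) ?_ ?_
      · rw [veluPoint_xc, veluPoint_xc, veluX_translate_of_mem H hQ, translate_zero]
      · rw [veluPoint_yc, veluPoint_yc, veluE_translate_of_mem H hQ, translate_zero]
    rw [hQ0] at h
    exact (Point.map_eq_zero _).mp (left_eq_add.mp h)

lemma veluHom_coords {Q : (W⁄k).Point} (hQ : Q ∉ H.map (Point.baseChange K k)) :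
    (veluHom H k Q).xc = veluX H Q ∧ (veluHom H k Q).yc = veluE H Q / 2 := by
  have hS : veluHom H k Q ≠ 0 := fun h ↦ hQ ((veluHom_eq_zero_iff H).mp h)
  obtain ⟨h1, h2⟩ := val_coords_add_sub_lt_one (W := W) (k := k) (G := veluPoint H (0 : (W⁄k).Point)) (by
    rw [veluPoint_xc, translate_zero, val_veluX_gen, ← exp_zero, exp_lt_exp]; norm_num) hS
  rw [← veluPoint_eq] at h1 h2
  refine ⟨sub_eq_zero.mp (eq_zero_of_val_lt_one (W := W) (k := k) ?_),
    sub_eq_zero.mp (eq_zero_of_val_lt_one (W := W) (k := k) ?_)⟩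
  · have := (val W k).map_sub_lt (val_veluX_sub H hQ) h1
    rwa [veluPoint_xc, sub_sub_sub_cancel_left, ← map_sub] at this
  · have h3 := val_veluE_sub H hQ
    have := (val W k).map_sub_lt (x := algebraMap k _ (1 / 2) *
      (veluE H (translate Q) - algebraMap k _ (veluE H Q))) (by
        rw [map_mul]; exact (mul_le_of_le_one_left' (val_algebraMap_le _)).trans_lt h3) h2
    rw [veluPoint_yc] at this
    convert this using 2
    simp only [map_sub, map_div₀, map_one, map_ofNat]
    ring

lemma veluHom_surjective : Function.Surjective (veluHom H k) := by
  intro S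
  by_cases hS : S = 0
  · exact ⟨0, by rw [hS, _root_.map_zero]⟩
  obtain ⟨Q, hQ, hX⟩ := exists_veluX_eq (k := k) H S.xc
  have hQ0 : veluHom H k Q ≠ 0 := fun h ↦ hQ ((veluHom_eq_zero_iff H).mp h)
  rcases eq_or_eq_neg_of_xc_eq hS hQ0 (by rw [(veluHom_coords H hQ).1, hX]) with h | h
  · exact ⟨Q, h.symm⟩
  · exact ⟨-Q, by rw [map_neg, h]⟩

/-- The quotient map is defined over the base field. -/
lemma veluHom_map {k' : Type*} [Field k'] [Algebra K k'] [CharZero k'] [DecidableEq k']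
    [IsAlgClosed k'] (f : k →ₐ[K] k') (Q : (W⁄k).Point) :
    veluHom H k' (Point.map f Q) = Point.map f (veluHom H k Q) := by
  by_cases hQ : Q ∈ H.map (Point.baseChange K k)
  · rw [(veluHom_eq_zero_iff H).mpr hQ, _root_.map_zero, veluHom_eq_zero_iff]
    obtain ⟨c, hc, rfl⟩ := hQ
    exact ⟨c, hc, (map_baseChange_of_tower f c).symm⟩
  have hQ' := notMem_map_baseChange f hQ
  refine ext_coords (fun h ↦ hQ' ((veluHom_eq_zero_iff H).mp h)) (fun h ↦ hQ ?_) ?_ ?_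
  · exact (veluHom_eq_zero_iff H).mp ((Point.map_eq_zero f).mp h)
  · rw [(veluHom_coords H hQ').1, xc_map, (veluHom_coords H hQ).1, veluX_map]
  · rw [(veluHom_coords H hQ').2, yc_map, (veluHom_coords H hQ).2, veluE_map, map_div₀, map_ofNat]

end FunField

/-! ### The parallelogram inequality for degrees -/

namespace WeierstrassCurve.Affine.Point

variable {F : Type*} [Field F] [DecidableEq F] {W : Affine F}

lemma xc_add_add_xc_sub {P Q : W.Point} (hP : P ≠ 0) (hQ : Q ≠ 0) (h : P.xc ≠ Q.xc) :
    (P.xc - Q.xc) ^ 2 * ((P + Q).xc + (P - Q).xc) =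
      2 * (P.xc * Q.xc) * (P.xc + Q.xc) + W.b₂ * (P.xc * Q.xc) + W.b₄ * (P.xc + Q.xc) + W.b₆ := by
  have eP := P.equation_of_ne_zero hP
  have eQ := Q.equation_of_ne_zero hQ
  have hd : P.xc - Q.xc ≠ 0 := sub_ne_zero.mpr h
  rw [sub_eq_add_neg P Q, xc_add hP hQ h, xc_add hP (neg_ne_zero.mpr hQ) (by rwa [xc_neg]), xc_neg,
    yc_neg hQ, b₂, b₄, b₆]
  field_simp
  linear_combination 2 * eP + 2 * eQ

lemma xc_add_mul_xc_sub {P Q : W.Point} (hP : P ≠ 0) (hQ : Q ≠ 0) (h : P.xc ≠ Q.xc) :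
    (P.xc - Q.xc) ^ 2 * ((P + Q).xc * (P - Q).xc) =
      (P.xc * Q.xc) ^ 2 - W.b₄ * (P.xc * Q.xc) - W.b₆ * (P.xc + Q.xc) - W.b₈ := by
  have eP := P.equation_of_ne_zero hP
  have eQ := Q.equation_of_ne_zero hQ
  have hd : P.xc - Q.xc ≠ 0 := sub_ne_zero.mpr h
  rw [sub_eq_add_neg P Q, xc_add hP hQ h, xc_add hP (neg_ne_zero.mpr hQ) (by rwa [xc_neg]), xc_neg,
    yc_neg hQ, b₄, b₆, b₈]
  generalize P.xc = x at *
  generalize P.yc = y at *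
  generalize Q.xc = s at *
  generalize Q.yc = t at *
  field_simp
  linear_combination ((y - t) * (y + t + W.a₁ * s + W.a₃) + (x - s) * ((x ^ 2 + x * s + s ^ 2) +
    W.a₂ * (x + s) + W.a₄ - W.a₁ * y) + W.a₁ * (x - s) * (2 * y + W.a₁ * x + W.a₃) +
    2 * (W.a₂ + x + s) * (x - s) ^ 2) * (eP - eQ) -
    (W.a₁ ^ 2 + 4 * (W.a₂ + x + s)) * (x - s) ^ 2 * eP

lemma xc_add_self {P : W.Point} (he : P.ec ≠ 0) : P + P ≠ 0 ∧ P.ec ^ 2 * (P + P).xc =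
    P.xc ^ 4 - W.b₄ * P.xc ^ 2 - 2 * W.b₆ * P.xc - W.b₈ := by
  cases P with
  | zero => exact absurd rfl he
  | some x y h =>
    have hy : y ≠ W.negY x y := by
      intro hy
      refine he ?_
      rw [negY] at hy
      change 2 * y + W.a₁ * x + W.a₃ = 0
      linear_combination hy
    rw [add_self_of_Y_ne hy]
    refine ⟨some_ne_zero _, ?_⟩
    have h1 := (equation_iff ..).mp h.1
    simp only [xc_some, addX, slope_of_Y_ne rfl hy]
    change (2 * y + W.a₁ * x + W.a₃) ^ 2 * _ = _
    have he' : 2 * y + W.a₁ * x + W.a₃ ≠ 0 := he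
    rw [show y - W.negY x y = 2 * y + W.a₁ * x + W.a₃ by rw [negY]; ring, b₄, b₆, b₈]
    field_simp
    linear_combination -(W.a₁ ^ 2 + 4 * W.a₂ + 8 * x) * h1

end WeierstrassCurve.Affine.Point

namespace Polynomial

variable {k : Type*} [Field k] [CharZero k]

section generic

lemma derivative_mul_sub_ne_zero {p q : k[X]} (h : IsCoprime p q)
    (hd : 0 < max p.natDegree q.natDegree) :
    derivative p * q - p * derivative q ≠ 0 := by
  have aux {f : k[X]} (hf : f ∣ derivative f) : f.natDegree = 0 := by
    by_contra hn
    refine hn (derivative_eq_zero.mp ?_)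
    exact eq_zero_of_dvd_of_natDegree_lt hf (natDegree_derivative_lt hn)
  intro h0
  rw [sub_eq_zero] at h0
  have hp := aux (h.dvd_of_dvd_mul_right (Dvd.intro _ h0.symm))
  have hq := aux (h.symm.dvd_of_dvd_mul_left (Dvd.intro_left _ h0))
  omega

/-- All but finitely many fibres of the rational function `p / q` have `max (deg p) (deg q)`
elements. -/
lemma exists_card_fiber_eq [IsAlgClosed k] {p q : k[X]} (h : IsCoprime p q)
    (hd : 0 < max p.natDegree q.natDegree) :
    ∃ c : k, ∃ s : Finset k, s.card = max p.natDegree q.natDegree ∧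
      ∀ a ∈ s, p.eval a = c * q.eval a ∧ q.eval a ≠ 0 := by
  classical
  set d := max p.natDegree q.natDegree with hd'
  set w := derivative p * q - p * derivative q with hw
  obtain ⟨c, hc⟩ := Infinite.exists_notMem_finset
    (insert (p.coeff d / q.coeff d) (w.roots.toFinset.image fun a ↦ p.eval a / q.eval a))
  simp only [Finset.mem_insert, Finset.mem_image, Multiset.mem_toFinset, not_or,
    not_exists, not_and] at hc
  obtain ⟨hc1, hc2⟩ := hc
  set f := p - C c * q with hf
  have hcoeff : f.coeff d ≠ 0 := by
    rw [hf, coeff_sub, coeff_C_mul]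
    intro h0
    by_cases hq : q.coeff d = 0
    · rw [hq, mul_zero, sub_zero] at h0
      have h1 : p.natDegree ≠ d := fun e ↦ by
        have : p ≠ 0 := by rintro rfl; simp at e; omega
        exact this (leadingCoeff_eq_zero.mp (by rw [leadingCoeff, e, h0]))
      have h2 : q.natDegree ≠ d := fun e ↦ by
        have : q ≠ 0 := by rintro rfl; simp at e; omega
        exact this (leadingCoeff_eq_zero.mp (by rw [leadingCoeff, e, hq]))
      omega
    · refine hc1 ?_
      field_simp
      linear_combination -h0
  have hf0 : f ≠ 0 := by intro h0; rw [h0] at hcoeff; simp at hcoeff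
  have hdeg : f.natDegree = d := by
    refine le_antisymm ?_ (le_natDegree_of_ne_zero hcoeff)
    refine (natDegree_sub_le _ _).trans ?_
    have := natDegree_C_mul_le c q
    omega
  have hroot {a : k} (ha : f.IsRoot a) : p.eval a = c * q.eval a ∧ q.eval a ≠ 0 := by
    have h1 : p.eval a = c * q.eval a := by
      have : f.eval a = 0 := ha
      simp only [hf, eval_sub, eval_mul, eval_C] at this
      linear_combination this
    refine ⟨h1, fun h0 ↦ ?_⟩
    obtain ⟨u, v, huv⟩ := h
    have := congrArg (eval a) huv
    simp [h0, h1] at this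
  have hnd : f.roots.Nodup := by
    rw [Multiset.nodup_iff_count_le_one]
    intro a
    rw [count_roots]
    by_contra! hlt
    obtain ⟨h1, h2⟩ := (one_lt_rootMultiplicity_iff_isRoot hf0).mp hlt
    obtain ⟨h3, h4⟩ := hroot h1
    have h2 : (derivative f).eval a = 0 := h2
    simp only [hf, derivative_sub, derivative_mul, derivative_C, eval_sub, eval_mul, eval_C,
      zero_mul, zero_add] at h2
    refine hc2 a ?_ (by rw [h3]; field_simp)
    rw [mem_roots (derivative_mul_sub_ne_zero h hd)]
    simp only [IsRoot.def, eval_sub, eval_mul]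
    linear_combination q.eval a * h2 - (derivative q).eval a * h3
  refine ⟨c, f.roots.toFinset, ?_, fun a ha ↦ ?_⟩
  · rw [Multiset.toFinset_card_of_nodup hnd, ← hdeg]
    exact ((IsAlgClosed.splits f).natDegree_eq_card_roots).symm
  · exact hroot (isRoot_of_mem_roots (Multiset.mem_toFinset.mp ha))

end generic

end Polynomial

namespace WeierstrassCurve

variable {k : Type*} [Field k] [CharZero k] (C : WeierstrassCurve k) [C.IsElliptic]

/-- The fourth powers of the variables are combinations of the forms `addSubMap`, with quadratic
coefficients; for values of the variables that are polynomials. -/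
lemma exists_sum_mul_aeval_addSubMap (v : Fin 3 → k[X]) {N : ℕ} (hv : ∀ i, (v i).natDegree ≤ N)
    (i : Fin 3) : ∃ c : Fin 3 → k[X], (∀ j, (c j).natDegree ≤ 2 * N) ∧
      ∑ j, c j * MvPolynomial.aeval v (addSubMap C j) = v i ^ 4 := by
  have h : ∑ j : Fin 3, (MvPolynomial.C (↑C.Δ'⁻¹ : k) * addSubMapCoeff C (i, j)) *
      addSubMap C j = MvPolynomial.X i ^ 4 := by
    refine MvPolynomial.funext fun x ↦ ?_
    have := addSubMapCoeff_condition C x i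
    simpa only [map_sum, map_mul, map_pow, MvPolynomial.eval_X] using this
  refine ⟨fun j ↦ MvPolynomial.aeval v (MvPolynomial.C (↑C.Δ'⁻¹ : k) * addSubMapCoeff C (i, j)),
    fun j ↦ ?_, ?_⟩
  · exact MvPolynomial.aeval_natDegree_le _
      ((isHomogeneous_addSubMapCoeff C (i, j)).C_mul _).totalDegree_le _ hv
  · have := congrArg (MvPolynomial.aeval v) h
    simpa only [map_sum, map_mul, map_pow, MvPolynomial.aeval_X] using this

/-- The forms of `addSubMap` at the symmetric square of `(p : q)` and `(X : 1)`. -/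
noncomputable def addSubPoly (p q : k[X]) (j : Fin 3) : k[X] :=
  MvPolynomial.aeval ![Polynomial.X * p, p + Polynomial.X * q, q] (addSubMap C j)

/-- The degree of `x(P + Q)`, `x(P - Q)` grows at least as the parallelogram law predicts, since the
forms `addSubMap` have no common zero. -/
lemma two_mul_max_natDegree_add_two_le {p q p₁ q₁ p₂ q₂ : k[X]} (h : IsCoprime p q)
    (hne : ![p₁ * p₂, p₁ * q₂ + p₂ * q₁, q₁ * q₂] ≠ 0)
    (hS : ∀ i j, ![p₁ * p₂, p₁ * q₂ + p₂ * q₁, q₁ * q₂] i * C.addSubPoly p q j =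
      ![p₁ * p₂, p₁ * q₂ + p₂ * q₁, q₁ * q₂] j * C.addSubPoly p q i) :
    2 * max p.natDegree q.natDegree + 2 ≤
      max p₁.natDegree q₁.natDegree + max p₂.natDegree q₂.natDegree := by
  set T := C.addSubPoly p q with hT
  set S := ![p₁ * p₂, p₁ * q₂ + p₂ * q₁, q₁ * q₂] with hS'
  set v := ![Polynomial.X * p, p + Polynomial.X * q, q] with hv
  set d := max p.natDegree q.natDegree with hd
  have hvd (i : Fin 3) : (v i).natDegree ≤ d + 1 := by
    have h1 := Polynomial.natDegree_mul_le (p := (Polynomial.X : k[X])) (q := p)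
    have h2 := Polynomial.natDegree_mul_le (p := (Polynomial.X : k[X])) (q := q)
    have h3 := Polynomial.natDegree_add_le p (Polynomial.X * q)
    rw [Polynomial.natDegree_X] at h1 h2
    fin_cases i
    · change (Polynomial.X * p).natDegree ≤ _; omega
    · change (p + Polynomial.X * q).natDegree ≤ _; omega
    · change q.natDegree ≤ _; omega
  choose c hc hcv using C.exists_sum_mul_aeval_addSubMap v hvd
  -- the forms are coprime
  have hspan : Ideal.span (Set.range T) = ⊤ := by
    rw [← Ideal.radical_eq_top]
    set I := Ideal.span (Set.range T)
    have hmem (i : Fin 3) : v i ∈ I.radical :=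
      ⟨4, hcv i ▸ I.sum_mem fun j _ ↦ I.mul_mem_left _ (Ideal.subset_span (Set.mem_range_self j))⟩
    have hq : q ∈ I.radical := hmem 2
    have hp : p ∈ I.radical := by
      have h1 := I.radical.sub_mem (hmem 1) (I.radical.mul_mem_left Polynomial.X hq)
      have h2 : v 1 - Polynomial.X * q = p := by simp [hv]
      rwa [h2] at h1
    obtain ⟨a, b, hab⟩ := h
    rw [Ideal.eq_top_iff_one, ← hab]
    exact I.radical.add_mem (I.radical.mul_mem_left _ hp) (I.radical.mul_mem_left _ hq)
  obtain ⟨u, hu⟩ := (Ideal.mem_span_range_iff_exists_fun (x := (1 : k[X]))).mp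
    (by rw [hspan]; trivial)
  set l := ∑ i, u i * S i with hl
  have hlT (j : Fin 3) : l * T j = S j := by
    rw [hl, Finset.sum_mul, ← mul_one (S j), ← hu, Finset.mul_sum]
    refine Finset.sum_congr rfl fun i _ ↦ ?_
    linear_combination u i * hS i j
  have hl0 : l ≠ 0 := by
    intro h0
    refine hne (funext fun j ↦ ?_)
    change S j = 0
    rw [← hlT, h0, zero_mul]
  set e := max p₁.natDegree q₁.natDegree + max p₂.natDegree q₂.natDegree with he
  have hSd (j : Fin 3) : (S j).natDegree ≤ e := by
    have h1 := Polynomial.natDegree_mul_le (p := p₁) (q := p₂)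
    have h2 := Polynomial.natDegree_mul_le (p := p₁) (q := q₂)
    have h3 := Polynomial.natDegree_mul_le (p := p₂) (q := q₁)
    have h4 := Polynomial.natDegree_mul_le (p := q₁) (q := q₂)
    have h5 := Polynomial.natDegree_add_le (p₁ * q₂) (p₂ * q₁)
    fin_cases j
    · change (p₁ * p₂).natDegree ≤ _; omega
    · change (p₁ * q₂ + p₂ * q₁).natDegree ≤ _; omega
    · change (q₁ * q₂).natDegree ≤ _; omega
  have hTd (j : Fin 3) : (T j).natDegree ≤ e := by
    by_cases hj : T j = 0
    · rw [hj]; simp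
    · have := hSd j
      rw [← hlT, Polynomial.natDegree_mul hl0 hj] at this
      omega
  -- one of the variables has degree `d + 1`
  have hvd' (i : Fin 3) : 4 * (v i).natDegree ≤ 2 * (d + 1) + e := by
    rw [← Polynomial.natDegree_pow, ← hcv i]
    refine Polynomial.natDegree_sum_le_of_forall_le _ _ fun j _ ↦ ?_
    exact Polynomial.natDegree_mul_le.trans (add_le_add (hc i j) (hTd j))
  suffices ∃ i, d + 1 ≤ (v i).natDegree by
    obtain ⟨i, hi⟩ := this
    have := hvd' i
    omega
  rcases lt_or_ge p.natDegree q.natDegree with hlt | hge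
  · refine ⟨1, ?_⟩
    have hq0 : q ≠ 0 := by rintro rfl; simp at hlt
    have hXq : (Polynomial.X * q).natDegree = q.natDegree + 1 := Polynomial.natDegree_X_mul hq0
    change _ ≤ (p + Polynomial.X * q).natDegree
    rw [Polynomial.natDegree_add_eq_right_of_natDegree_lt (by omega)]
    omega
  · by_cases hp0 : p = 0
    · refine ⟨1, ?_⟩
      have hq0 : q ≠ 0 := by
        rintro rfl
        subst hp0
        exact not_isCoprime_zero_zero h
      have hXq : (Polynomial.X * q).natDegree = q.natDegree + 1 := Polynomial.natDegree_X_mul hq0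
      change _ ≤ (p + Polynomial.X * q).natDegree
      rw [hp0, zero_add, hXq]
      simp [hd, hp0]
    · refine ⟨0, ?_⟩
      change _ ≤ (Polynomial.X * p).natDegree
      rw [Polynomial.natDegree_X_mul hp0]
      omega

end WeierstrassCurve

/-! ### The number of torsion points -/

namespace WeierstrassCurve

variable {k : Type*} [Field k] (C : WeierstrassCurve k) (p q : k[X])

lemma addSubPoly_zero : C.addSubPoly p q 0 = (Polynomial.X * p) ^ 2 -
    Polynomial.C C.b₄ * (Polynomial.X * p) * q - Polynomial.C C.b₆ * (p + Polynomial.X * q) * q -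
      Polynomial.C C.b₈ * q ^ 2 := by
  simp [addSubPoly, addSubMap]

lemma addSubPoly_one : C.addSubPoly p q 1 = 2 * (p + Polynomial.X * q) * (Polynomial.X * p) +
    Polynomial.C C.b₂ * (Polynomial.X * p) * q + Polynomial.C C.b₄ * (p + Polynomial.X * q) * q +
      Polynomial.C C.b₆ * q ^ 2 := by
  simp [addSubPoly, addSubMap, show Polynomial.C (2 : k) = 2 from rfl]

lemma addSubPoly_two : C.addSubPoly p q 2 = (p - Polynomial.X * q) ^ 2 := by
  simp [addSubPoly, addSubMap, show Polynomial.C (4 : k) = 4 from rfl]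
  ring

lemma forall_mul_eq_mul_of_three {R : Type*} [CommRing R] {S T : Fin 3 → R}
    (h₁ : S 0 * T 1 = S 1 * T 0) (h₂ : S 0 * T 2 = S 2 * T 0) (h₃ : S 1 * T 2 = S 2 * T 1)
    (i j : Fin 3) : S i * T j = S j * T i := by
  fin_cases i <;> fin_cases j <;> first | rfl | assumption | (symm; assumption)

lemma baseChange_b₈ {R : Type*} [CommRing R] (W : WeierstrassCurve R) (A : Type*) [CommRing A]
    [Algebra R A] : (WeierstrassCurve.baseChange W A).b₈ = algebraMap R A W.b₈ := W.map_b₈ _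

end WeierstrassCurve

namespace FunField

open WithZero Point

variable {K : Type*} [Field K] {W : WeierstrassCurve K} [W.IsElliptic]
  {k : Type*} [Field k] [Algebra K k] [CharZero k] [DecidableEq k] [IsAlgClosed k]

variable (W k) in
/-- The `x`-coordinate of the `n`-th multiple of the generic point, as a rational function of `x`,
with the junk value `0` for `n = 0`. -/
noncomputable def xMul (n : ℕ) : RatFunc k := (n • gen W k).xc.re

variable (W k) in
/-- The degree of the rational function `xMul`. -/
noncomputable def degMul (n : ℕ) : ℕ :=
  max (xMul W k n).num.natDegree (xMul W k n).denom.natDegree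

lemma aeval_x_injective : Function.Injective (Polynomial.aeval (R := k) (x W k)) := by
  have := translate_transcendental (0 : (W⁄k).Point)
  rw [translate_zero, gen_xc] at this
  exact transcendental_iff_injective.mp this

lemma nsmul_gen_xc (n : ℕ) : (n • gen W k).xc = algebraMap (RatFunc k) _ (xMul W k n) := by
  have h : conj (n • gen W k).xc = (n • gen W k).xc := by
    rw [← xc_map, map_nsmul, map_conj_gen, smul_neg, xc_neg]
  ext
  · simp [xMul]
  · simpa using im_eq_zero_of_conj_eq h

lemma nsmul_gen_xc_mul (n : ℕ) : (n • gen W k).xc * Polynomial.aeval (x W k) (xMul W k n).denom =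
    Polynomial.aeval (x W k) (xMul W k n).num := by
  have h : algebraMap k[X] (RatFunc k) (xMul W k n).denom ≠ 0 :=
    RatFunc.algebraMap_ne_zero (RatFunc.denom_ne_zero _)
  rw [nsmul_gen_xc, aeval_x, aeval_x, ← map_mul]
  congr 1
  rw [← eq_div_iff h, RatFunc.num_div_denom]

lemma xMul_one : xMul W k 1 = RatFunc.X := by
  rw [xMul, one_smul]; rfl

lemma degMul_zero : degMul W k 0 = 0 := by
  simp [degMul, xMul]

lemma degMul_one : degMul W k 1 = 1 := by
  simp [degMul, xMul_one]

lemma aeval_denom_ne_zero (r : RatFunc k) : Polynomial.aeval (x W k) r.denom ≠ 0 := by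
  rw [ne_eq, map_eq_zero_iff _ aeval_x_injective]
  exact r.denom_ne_zero

lemma degMul_two : 4 ≤ degMul W k 2 := by
  have he : (gen W k).ec ≠ 0 := by
    rw [gen_ec]
    intro h
    have := congrArg QuadraticAlgebra.im h
    simp [e] at this
  obtain ⟨h0, h2⟩ := xc_add_self he
  rw [← two_nsmul] at h0 h2
  have hr := nsmul_gen_xc_mul (W := W) (k := k) 2
  have hE := Psi2Sq_ec (gen_ne_zero (W := W) (k := k))
  have hd := aeval_denom_ne_zero (W := W) (xMul W k 2)
  set p := (xMul W k 2).num
  set q := (xMul W k 2).denom with hq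
  have := two_mul_max_natDegree_add_two_le (W⁄k) (p := Polynomial.X) (q := 1) (p₁ := p) (q₁ := q)
    (p₂ := 1) (q₂ := 0) isCoprime_one_right (by
      intro h
      have := congrFun h 1
      simp at this
      exact RatFunc.denom_ne_zero _ this) (by
      refine forall_mul_eq_mul_of_three ?_ ?_ ?_
      · apply aeval_x_injective (W := W)
        simp only [addSubPoly_zero, addSubPoly_one, Matrix.cons_val_zero, Matrix.cons_val_one,
          map_mul, map_add, map_sub, map_pow, map_one, map_ofNat, _root_.map_zero, Polynomial.aeval_X,
      Polynomial.aeval_C, baseChange_b₂, baseChange_b₄, baseChange_b₆, baseChange_b₈,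
      ← IsScalarTower.algebraMap_apply K k (FunField W k), gen_xc] at hE h2 ⊢
        rw [← hr]
        linear_combination ((2 • gen W k).xc * Polynomial.aeval (x W k) q) * -hE +
          Polynomial.aeval (x W k) q * h2
      · rw [addSubPoly_two]; simp
      · rw [addSubPoly_two]; simp)
  simp at this
  simpa [degMul] using this

lemma two_mul_degMul_add_two_le {n : ℕ} (h : (n + 1) • gen W k ≠ 0)
    (hne : degMul W k (n + 1) ≠ 1) :
    2 * degMul W k (n + 1) + 2 ≤ degMul W k (n + 2) + degMul W k n := by
  have hx : ((n + 1) • gen W k).xc ≠ (gen W k).xc := by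
    intro h
    refine hne ?_
    rw [degMul, xMul, h, ← degMul_one (W := W) (k := k), degMul, xMul_one]
    rfl
  have hS := xc_add_add_xc_sub h gen_ne_zero hx
  have hP := xc_add_mul_xc_sub h gen_ne_zero hx
  rw [← succ_nsmul, succ_nsmul _ n, add_sub_cancel_right, ← succ_nsmul] at hS hP
  have e1 := nsmul_gen_xc_mul (W := W) (k := k) n
  have e2 := nsmul_gen_xc_mul (W := W) (k := k) (n + 1)
  have e3 := nsmul_gen_xc_mul (W := W) (k := k) (n + 2)
  have d1 := aeval_denom_ne_zero (W := W) (xMul W k n)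
  have d2 := aeval_denom_ne_zero (W := W) (xMul W k (n + 1))
  have d3 := aeval_denom_ne_zero (W := W) (xMul W k (n + 2))
  have hc : IsCoprime (xMul W k (n + 1)).num (xMul W k (n + 1)).denom :=
    RatFunc.isCoprime_num_denom _
  rw [degMul, degMul, degMul]
  have c1 : (xMul W k n).denom ≠ 0 := RatFunc.denom_ne_zero _
  have c3 : (xMul W k (n + 2)).denom ≠ 0 := RatFunc.denom_ne_zero _
  generalize (xMul W k n).num = p₁ at *
  generalize (xMul W k n).denom = q₁ at *
  generalize (xMul W k (n + 1)).num = p at *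
  generalize (xMul W k (n + 1)).denom = q at *
  generalize (xMul W k (n + 2)).num = p₃ at *
  generalize (xMul W k (n + 2)).denom = q₃ at *
  have hT2 : (W⁄k).addSubPoly p q 2 ≠ 0 := by
    rw [addSubPoly_two]
    refine pow_ne_zero 2 fun h0 ↦ hx ?_
    rw [gen_xc]
    apply mul_right_cancel₀ d2
    rw [e2, sub_eq_zero.mp h0, map_mul, Polynomial.aeval_X]
  have g02 : p₃ * p₁ * (W⁄k).addSubPoly p q 2 = q₃ * q₁ * (W⁄k).addSubPoly p q 0 := by
    apply aeval_x_injective (W := W)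
    simp only [addSubPoly_zero, addSubPoly_two,
      map_mul, map_add, map_sub, map_pow, Polynomial.aeval_X,
      Polynomial.aeval_C, baseChange_b₄, baseChange_b₆, baseChange_b₈,
      ← IsScalarTower.algebraMap_apply K k (FunField W k), gen_xc] at hP ⊢
    rw [← e1, ← e2, ← e3]
    generalize ((n + 1) • gen W k).xc = f at *
    generalize ((n + 2) • gen W k).xc = g at *
    generalize (n • gen W k).xc = h at *
    generalize Polynomial.aeval (x W k) q = a at *
    generalize Polynomial.aeval (x W k) q₁ = b at *
    generalize Polynomial.aeval (x W k) q₃ = c at *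
    linear_combination a ^ 2 * b * c * hP
  have g12 : (p₃ * q₁ + p₁ * q₃) * (W⁄k).addSubPoly p q 2 =
      q₃ * q₁ * (W⁄k).addSubPoly p q 1 := by
    apply aeval_x_injective (W := W)
    simp only [addSubPoly_one, addSubPoly_two,
      map_mul, map_add, map_sub, map_pow, map_ofNat, Polynomial.aeval_X,
      Polynomial.aeval_C, baseChange_b₂, baseChange_b₄, baseChange_b₆,
      ← IsScalarTower.algebraMap_apply K k (FunField W k), gen_xc] at hS ⊢
    rw [← e1, ← e2, ← e3]
    generalize ((n + 1) • gen W k).xc = f at *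
    generalize ((n + 2) • gen W k).xc = g at *
    generalize (n • gen W k).xc = h at *
    generalize Polynomial.aeval (x W k) q = a at *
    generalize Polynomial.aeval (x W k) q₁ = b at *
    generalize Polynomial.aeval (x W k) q₃ = c at *
    linear_combination a ^ 2 * b * c * hS
  have := two_mul_max_natDegree_add_two_le (W⁄k) hc (p₁ := p₃) (q₁ := q₃) (p₂ := p₁) (q₂ := q₁)
    (fun h ↦ mul_ne_zero c3 c1 (congrFun h 2)) (by
      refine forall_mul_eq_mul_of_three ?_ g02 g12
      apply mul_right_cancel₀ hT2
      change p₃ * p₁ * _ * _ = (p₃ * q₁ + p₁ * q₃) * _ * _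
      linear_combination (W⁄k).addSubPoly p q 1 * g02 - (W⁄k).addSubPoly p q 0 * g12)
  exact this

/-- The degree of multiplication by `n` is at least `n²`, as its differences grow by at least two. -/
lemma degMul_add_le (n : ℕ) : degMul W k n + 2 * n + 1 ≤ degMul W k (n + 1) ∧
    n ^ 2 ≤ degMul W k n := by
  have hne {n : ℕ} (hn : 0 < degMul W k n) : n • gen W k ≠ 0 := by
    intro h0
    rw [degMul, xMul, h0] at hn
    simp at hn
  induction n with
  | zero => simp [degMul_zero, degMul_one]
  | succ n ih =>
    refine ⟨?_, by rw [add_sq]; omega⟩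
    rcases Nat.eq_zero_or_pos n with rfl | hn
    · have := degMul_two (W := W) (k := k)
      rw [degMul_one]
      exact this
    · have h1 : 1 ≤ degMul W k n := (Nat.one_le_pow 2 n hn).trans ih.2
      have := two_mul_degMul_add_two_le (hne (n := n + 1) (by omega)) (by omega)
      change _ ≤ degMul W k (n + 2)
      omega

lemma nsmul_gen_ne_zero {n : ℕ} (hn : n ≠ 0) : n • gen W k ≠ 0 := by
  intro h0
  have h1 := (degMul_add_le (W := W) (k := k) n).2
  rw [degMul, xMul, h0] at h1
  have : 0 < n ^ 2 := by positivity
  simp at h1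
  omega

section reduction

variable {C : WeierstrassCurve K}

omit [IsAlgClosed k] in
lemma val_yc_le_one {P : (C⁄(FunField W k)).Point} (h : val W k P.xc ≤ 1) :
    val W k P.yc ≤ 1 := by
  by_cases hP : P = 0
  · rw [hP, yc_zero, _root_.map_zero]; exact zero_le
  have he := equation_of_ne_zero hP
  rw [baseChange_a₁, baseChange_a₂, baseChange_a₃, baseChange_a₄, baseChange_a₆] at he
  by_contra! hy
  have hb (c : K) : val W k (algebraMap K _ c) ≤ 1 := val_algebraMap_le' c
  have vm {f g : FunField W k} (hf : val W k f ≤ 1) (hg : val W k g ≤ 1) : val W k (f * g) ≤ 1 :=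
    (val W k).map_mul_le_of_le_one hf hg
  have vp {f : FunField W k} (n : ℕ) (hf : val W k f ≤ 1) : val W k (f ^ n) ≤ 1 := by
    rw [map_pow]; exact pow_le_one' hf n
  have h1 : val W k (P.yc + (algebraMap K _ C.a₁ * P.xc + algebraMap K _ C.a₃)) = val W k P.yc :=
    (val W k).map_add_eq_of_lt_left
      (((val W k).map_add_le (vm (hb _) h) (hb _)).trans_lt hy)
  have h2 : val W k (P.yc * (P.yc + (algebraMap K _ C.a₁ * P.xc + algebraMap K _ C.a₃))) ≤ 1 := by
    rw [show P.yc * (P.yc + (algebraMap K _ C.a₁ * P.xc + algebraMap K _ C.a₃)) = P.xc ^ 3 +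
      algebraMap K _ C.a₂ * P.xc ^ 2 + algebraMap K _ C.a₄ * P.xc + algebraMap K _ C.a₆ by
        linear_combination he]
    exact (val W k).map_add_le ((val W k).map_add_le ((val W k).map_add_le (vp 3 h)
      (vm (hb _) (vp 2 h))) (vm (hb _) h)) (hb _)
  rw [map_mul, h1] at h2
  exact (one_lt_mul'' hy hy).not_ge h2

omit [IsAlgClosed k] in
/-- The points that reduce to infinity are closed under addition. -/
lemma add_eq_zero_or_one_lt_val {P Q : (C⁄(FunField W k)).Point} (hP : 1 < val W k P.xc)
    (hQ : 1 < val W k Q.xc) : P + Q = 0 ∨ 1 < val W k (P + Q).xc := by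
  by_contra! h
  obtain ⟨h0, h1⟩ := h
  have := (valuation_coords_add_sub_lt_one (val W k) (by rw [baseChange_a₁]; exact val_algebraMap_le' _)
    (by rw [baseChange_a₂]; exact val_algebraMap_le' _)
    (by rw [baseChange_a₃]; exact val_algebraMap_le' _)
    (by rw [baseChange_a₄]; exact val_algebraMap_le' _)
    (by rw [baseChange_a₆]; exact val_algebraMap_le' _)
    (G := -Q) (by rwa [xc_neg]) h0 h1 (val_yc_le_one h1)).1
  rw [show -Q + (P + Q) = P by abel] at this
  have := (val W k).map_add_le this.le h1
  rw [sub_add_cancel] at this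
  exact hP.not_ge this

end reduction

lemma one_lt_val_nsmul_gen {n : ℕ} (hn : n ≠ 0) : 1 < val W k (n • gen W k).xc := by
  induction n with
  | zero => exact absurd rfl hn
  | succ n ih =>
    rcases Nat.eq_zero_or_pos n with rfl | hp
    · rw [_root_.zero_add, one_smul]; exact one_lt_val_gen
    · have h := nsmul_gen_ne_zero (W := W) (k := k) hn
      rw [succ_nsmul] at h ⊢
      exact (add_eq_zero_or_one_lt_val (ih hp.ne') one_lt_val_gen).resolve_left h

lemma nsmul_translate (n : ℕ) (Q : (W⁄k).Point) :
    n • translate Q = n • gen W k + Point.baseChange k _ (n • Q) := by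
  rw [translate, nsmul_add, map_nsmul]

lemma val_nsmul_translate {n : ℕ} (hn : n ≠ 0) {Q : (W⁄k).Point} (hQ : n • Q ≠ 0) :
    val W k ((n • translate Q).xc - algebraMap k _ (n • Q).xc) < 1 ∧
      val W k ((n • translate Q).yc - algebraMap k _ (n • Q).yc) < 1 := by
  rw [nsmul_translate]
  exact val_coords_add_sub_lt_one (one_lt_val_nsmul_gen hn) hQ

lemma nsmul_translate_xc_mul (n : ℕ) (Q : (W⁄k).Point) :
    (n • translate Q).xc * Polynomial.aeval (translate Q).xc (xMul W k n).denom =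
      Polynomial.aeval (translate Q).xc (xMul W k n).num := by
  have h := congrArg (transl Q) (nsmul_gen_xc_mul (W := W) (k := k) n)
  rwa [map_mul, ← Polynomial.aeval_algHom_apply, ← Polynomial.aeval_algHom_apply, ← xc_map,
    map_nsmul, map_transl_gen, ← gen_xc, ← xc_map, map_transl_gen] at h

omit [DecidableEq k] [IsAlgClosed k] in
lemma mul_sub_lt_one {f g : FunField W k} {a b : k} (hf : val W k (f - algebraMap k _ a) < 1)
    (hg : val W k (g - algebraMap k _ b) < 1) : val W k (f * g - algebraMap k _ (a * b)) < 1 := by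
  have e : f * g - algebraMap k _ (a * b) =
      f * (g - algebraMap k _ b) + algebraMap k _ b * (f - algebraMap k _ a) := by
    rw [map_mul]; ring
  rw [e]
  refine (val W k).map_add_lt ?_ ?_
  · rw [map_mul]
    refine (mul_le_of_le_one_left' ?_).trans_lt hg
    have := (val W k).map_add_le hf.le (val_algebraMap_le a)
    rwa [sub_add_cancel] at this
  · rw [map_mul]
    exact (mul_le_of_le_one_left' (val_algebraMap_le b)).trans_lt hf

omit [DecidableEq k] [IsAlgClosed k] in
lemma eq_of_sub_lt_one {f : FunField W k} {a b : k} (hf : val W k (f - algebraMap k _ a) < 1)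
    (hg : val W k (f - algebraMap k _ b) < 1) : a = b := by
  refine (sub_eq_zero.mp (eq_zero_of_val_lt_one (W := W) (k := k) ?_)).symm
  have := (val W k).map_sub_lt hf hg
  rwa [sub_sub_sub_cancel_left, ← map_sub] at this

/-- The rational function `xMul n` gives the `x`-coordinate of `n • Q`. -/
lemma nsmul_xc_mul {n : ℕ} (hn : n ≠ 0) {Q : (W⁄k).Point} (hQ0 : Q ≠ 0) (hQ : n • Q ≠ 0) :
    (n • Q).xc * (xMul W k n).denom.eval Q.xc = (xMul W k n).num.eval Q.xc := by
  have h1 := mul_sub_lt_one (val_nsmul_translate hn hQ).1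
    (aeval_sub_lt_one (val_translate_xc hQ0) (xMul W k n).denom)
  rw [nsmul_translate_xc_mul] at h1
  exact eq_of_sub_lt_one h1 (aeval_sub_lt_one (val_translate_xc hQ0) _)

/-- Non-zero torsion points are poles of `x(n P)`. -/
lemma eval_denom_eq_zero {n : ℕ} (hn : n ≠ 0) {Q : (W⁄k).Point} (hQ0 : Q ≠ 0) (hQ : n • Q = 0) :
    (xMul W k n).denom.eval Q.xc = 0 := by
  have h1 := nsmul_translate_xc_mul n Q
  rw [nsmul_translate, hQ, _root_.map_zero, _root_.add_zero] at h1
  have hG := one_lt_val_nsmul_gen (W := W) (k := k) hn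
  have hnum := val_le_one_of_sub_lt (aeval_sub_lt_one (val_translate_xc hQ0) (xMul W k n).num)
  have hden := aeval_sub_lt_one (val_translate_xc hQ0) (xMul W k n).denom
  by_contra h0
  have h2 : val W k (Polynomial.aeval (translate Q).xc (xMul W k n).denom) = 1 := by
    rw [← val_algebraMap (W := W) h0] at hden ⊢
    have := (val W k).map_add_eq_of_lt_left hden
    rwa [add_sub_cancel] at this
  rw [← h1, map_mul, h2, mul_one] at hnum
  exact hG.not_ge hnum

lemma _root_.WeierstrassCurve.Affine.Point.finite_setOf_xc_mem {F : Type*} [Field F] {C : Affine F}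
    {s : Set F} (hs : s.Finite) : {P : C.Point | P ≠ 0 ∧ P.xc ∈ s}.Finite := by
  classical
  refine Set.Finite.of_finite_fibers xc (hs.subset (by rintro _ ⟨P, ⟨_, hP⟩, rfl⟩; exact hP)) ?_
  intro a _
  by_cases h : ∃ Q : C.Point, Q ≠ 0 ∧ Q.xc = a
  · obtain ⟨Q, hQ, rfl⟩ := h
    refine (Set.toFinite {Q, -Q}).subset ?_
    rintro P ⟨⟨hP, _⟩, hx⟩
    exact eq_or_eq_neg_of_xc_eq hP hQ hx
  · refine Set.finite_empty.subset ?_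
    rintro P ⟨⟨hP, _⟩, hx⟩
    exact h ⟨P, hP, hx⟩

variable (W k) in
lemma finite_torsion {n : ℕ} (hn : n ≠ 0) : {Q : (W⁄k).Point | n • Q = 0}.Finite := by
  refine ((finite_setOf_xc_mem (C := (W⁄k))
    (Multiset.toFinset (xMul W k n).denom.roots).finite_toSet).insert 0).subset ?_
  intro Q hQ
  by_cases h0 : Q = 0
  · exact Or.inl h0
  · refine Or.inr ⟨h0, ?_⟩
    simp only [Finset.mem_coe, Multiset.mem_toFinset]
    exact (Polynomial.mem_roots (RatFunc.denom_ne_zero _)).mpr (eval_denom_eq_zero hn h0 hQ)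

variable (W k) in
/-- An elliptic curve has at least `n²` points of order dividing `n`: the differences of the points
in a general fibre of multiplication by `n`. -/
lemma sq_le_card_torsion {n : ℕ} (hn : n ≠ 0) : n ^ 2 ≤ Nat.card {Q : (W⁄k).Point // n • Q = 0} := by
  have hd := (degMul_add_le (W := W) (k := k) n).2
  have hpos : 0 < n ^ 2 := by positivity
  obtain ⟨c, s, hs, hsc⟩ := Polynomial.exists_card_fiber_eq
    (RatFunc.isCoprime_num_denom (xMul W k n)) (hpos.trans_le hd)
  obtain ⟨Q, hQ0, hQc⟩ := exists_xc_eq (W⁄k) c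
  have hex (a : s) : ∃ P : (W⁄k).Point, P.xc = a ∧ n • P = Q := by
    obtain ⟨P, hP0, hPa⟩ := exists_xc_eq (W⁄k) (a : k)
    obtain ⟨h1, h2⟩ := hsc a a.2
    have hnP : n • P ≠ 0 := fun h ↦ h2 (by rw [← hPa]; exact eval_denom_eq_zero hn hP0 h)
    have h3 := nsmul_xc_mul hn hP0 hnP
    rw [hPa, h1] at h3
    have h4 := mul_right_cancel₀ h2 h3
    rcases eq_or_eq_neg_of_xc_eq hnP hQ0 (h4.trans hQc.symm) with h | h
    · exact ⟨P, hPa, h⟩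
    · exact ⟨-P, by rw [xc_neg, hPa], by rw [smul_neg, h, neg_neg]⟩
  choose P hPa hPQ using hex
  have hne : s.Nonempty := by
    rw [← Finset.card_pos, hs]
    exact hpos.trans_le hd
  obtain ⟨a₀, ha₀⟩ := hne
  have : Finite {Q : (W⁄k).Point // n • Q = 0} := finite_torsion W k hn
  refine hd.trans ?_
  rw [degMul, ← hs, ← Fintype.card_coe, ← Nat.card_eq_fintype_card]
  refine Nat.card_le_card_of_injective
    (fun a ↦ ⟨P a - P ⟨a₀, ha₀⟩, by rw [nsmul_sub, hPQ, hPQ, sub_self]⟩) fun a b hab ↦ ?_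
  have h1 : P a - P ⟨a₀, ha₀⟩ = P b - P ⟨a₀, ha₀⟩ := congrArg Subtype.val hab
  rw [Subtype.ext_iff, ← hPa, ← hPa, sub_left_injective h1]

end FunField

/-! ### Rationality of the dual isogeny -/

namespace WeierstrassCurve.Affine.Point

lemma map_restrictScalars {K S A B : Type*} [Field A] [Field B] [DecidableEq A] [DecidableEq B]
    [CommRing K] [CommRing S] [Algebra K S] [Algebra S A] [Algebra S B] [Algebra K A] [Algebra K B]
    [IsScalarTower K S A] [IsScalarTower K S B] {W : WeierstrassCurve K} (f : A →ₐ[S] B)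
    (P : (W⁄A).Point) : Point.map (f.restrictScalars K) P = Point.map f P := by
  cases P <;> rfl

/-- Galois descent for points. -/
lemma exists_baseChange_eq {R M L : Type*} [CommRing R] [Field M] [Field L] [DecidableEq M]
    [DecidableEq L] [Algebra R M] [Algebra M L] [Algebra R L] [IsScalarTower R M L] [IsGalois M L]
    {W : WeierstrassCurve R} {P : (W⁄L).Point}
    (h : ∀ σ : L ≃ₐ[M] L, Point.map (σ : L →ₐ[M] L) P = P) :
    ∃ A : (W⁄M).Point, Point.baseChange M L A = P := by
  by_cases hP : P = 0
  · exact ⟨0, by rw [hP, _root_.map_zero]⟩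
  obtain ⟨a, ha⟩ := (InfiniteGalois.mem_range_algebraMap_iff_fixed P.xc).mpr fun σ ↦ by
    have := congrArg xc (h σ)
    rwa [xc_map] at this
  obtain ⟨b, hb⟩ := (InfiniteGalois.mem_range_algebraMap_iff_fixed P.yc).mpr fun σ ↦ by
    have := congrArg yc (h σ)
    rwa [yc_map] at this
  have hns := nonsingular_of_ne_zero hP
  rw [← ha, ← hb] at hns
  refine ⟨.some a b ((baseChange_nonsingular W (f := Algebra.ofId M L)
    (algebraMap M L).injective a b).mp hns), ?_⟩
  refine ext_coords (fun h0 ↦ some_ne_zero _ ((map_eq_zero _).mp h0)) hP ?_ ?_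
  · rw [baseChange, xc_map, ← ha]; rfl
  · rw [baseChange, yc_map, ← hb]; rfl

end WeierstrassCurve.Affine.Point

namespace FunField

open WithZero Point

variable {K : Type*} [Field K] [DecidableEq K] [CharZero K] {W : WeierstrassCurve K}
  [W.IsElliptic] (H : AddSubgroup (W⁄K).Point) [Fintype H]

omit [CharZero K] [W.IsElliptic] [Fintype H] in
lemma nsmul_eq_zero_of_mem {m : ℕ} (hm : ∀ c ∈ H, m • c = 0) {B : Type*} [Field B] [DecidableEq B]
    [Algebra K B] {P : (W⁄B).Point} (hP : P ∈ H.map (Point.baseChange K B)) : m • P = 0 := by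
  obtain ⟨c, hc, rfl⟩ := hP
  rw [← map_nsmul, hm c hc, _root_.map_zero]

section pullback

variable (k : Type*) [Field k] [Algebra K k] [CharZero k] [DecidableEq k] [IsAlgClosed k]

/-- The pull-back of functions along the quotient map `E → E / H`. -/
noncomputable def veluPullback : FunField (veluCurve H) K →ₐ[K] FunField W k :=
  lift (veluPoint H (0 : (W⁄k).Point)) (veluPoint_ne_zero H _) (by
    rw [veluPoint_xc, translate_zero]
    intro h
    obtain ⟨c, hc⟩ := (h.tower_top (L := k)).exists_algebraMap_eq
    exact veluX_gen_ne_algebraMap H c hc)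

lemma map_veluPullback_gen : Point.map (veluPullback H k) (gen (veluCurve H) K) =
    veluPoint H (0 : (W⁄k).Point) :=
  map_lift_gen _ _ _

lemma gen_ne_baseChange_of_tower (c : (W⁄K).Point) : gen W k ≠ Point.baseChange K (FunField W k) c := by
  intro h
  have h1 := map_baseChange_of_tower (Algebra.ofId k (FunField W k)) c
  rw [← h] at h1
  exact gen_ne_baseChange (Point.baseChange K k c) h1.symm

/-- The multiple `m • P` of the generic point of `E` comes from a point over the function field of
`E / H`, if `H` is killed by `m`. -/
lemma exists_map_veluPullback_eq {m : ℕ} (hm : ∀ c ∈ H, m • c = 0) :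
    ∃ A : (W⁄(FunField (veluCurve H) K)).Point,
      Point.map (veluPullback H k) A = m • gen W k := by
  let M := FunField (veluCurve H) K
  let Ω := AlgebraicClosure M
  let Ω' := AlgebraicClosure (FunField W k)
  let i : M →ₐ[K] Ω := IsScalarTower.toAlgHom K M Ω
  let f : FunField W k →ₐ[K] Ω' := IsScalarTower.toAlgHom K (FunField W k) Ω'
  have : CharZero Ω := charZero_of_injective_algebraMap (algebraMap K Ω).injective
  have : CharZero Ω' := charZero_of_injective_algebraMap (algebraMap K Ω').injective
  -- a point over the generic point of the quotient
  obtain ⟨P, hP⟩ := veluHom_surjective H (Point.map i (gen (veluCurve H) K))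
  -- its conjugates differ from it by elements of `H`
  have hfix (σ : Ω ≃ₐ[M] Ω) : Point.map (σ : Ω →ₐ[M] Ω) (m • P) = m • P := by
    have h1 : veluHom H Ω (Point.map ((σ : Ω →ₐ[M] Ω).restrictScalars K) P) = veluHom H Ω P := by
      rw [veluHom_map, hP, Point.map_map]
      congr 2
      ext a
      exact (σ : Ω →ₐ[M] Ω).commutes a
    rw [← sub_eq_zero, ← map_sub, veluHom_eq_zero_iff] at h1
    have h2 := nsmul_eq_zero_of_mem H hm h1
    rw [nsmul_sub, sub_eq_zero] at h2
    rw [map_nsmul, ← map_restrictScalars (K := K), h2]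
  obtain ⟨A, hA⟩ := exists_baseChange_eq hfix
  -- compare with the generic point of `E`
  let : Algebra M Ω' := (f.comp (veluPullback H k)).toRingHom.toAlgebra
  have : IsScalarTower K M Ω' := .of_algebraMap_eq fun c ↦
    ((f.comp (veluPullback H k)).commutes c).symm
  let j : Ω →ₐ[K] Ω' := (IsAlgClosed.lift (R := M) (S := Ω) (M := Ω')).restrictScalars K
  have hj : j.comp i = f.comp (veluPullback H k) := by
    ext a
    exact (IsAlgClosed.lift (R := M) (S := Ω) (M := Ω')).commutes a
  have hgen : veluHom H Ω' (Point.map f (gen W k)) = Point.map f (veluPoint H (0 : (W⁄k).Point)) := by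
    have hn : Point.map f (gen W k) ∉ H.map (Point.baseChange K Ω') := by
      rintro ⟨c, _, hc⟩
      rw [← map_baseChange_of_tower f] at hc
      exact gen_ne_baseChange_of_tower k c (map_injective f hc).symm
    refine ext_coords (fun h0 ↦ hn ((veluHom_eq_zero_iff H).mp h0))
      (fun h0 ↦ veluPoint_ne_zero H _ ((Point.map_eq_zero _).mp h0)) ?_ ?_
    · rw [(veluHom_coords H hn).1, xc_map, veluPoint_xc, translate_zero, veluX_map]
    · rw [(veluHom_coords H hn).2, yc_map, veluPoint_yc, translate_zero, veluE_map, map_div₀,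
        map_ofNat]
  have h1 : veluHom H Ω' (Point.map j P) = veluHom H Ω' (Point.map f (gen W k)) := by
    rw [hgen, veluHom_map, hP, Point.map_map, hj, ← Point.map_map, map_veluPullback_gen]
  rw [← sub_eq_zero, ← map_sub, veluHom_eq_zero_iff] at h1
  have h2 := nsmul_eq_zero_of_mem H hm h1
  rw [nsmul_sub, sub_eq_zero, ← map_nsmul, ← map_nsmul, ← hA,
    show Point.baseChange M Ω A = Point.map i A by cases A <;> rfl, Point.map_map, hj,
    ← Point.map_map] at h2
  exact ⟨A, map_injective f h2⟩

end pullback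

section specialization

variable {k : Type*} [Field k] [Algebra K k] [CharZero k] [DecidableEq k] [IsAlgClosed k]

/-- Numerator and denominator of a function, as polynomials in the coordinates `x` and `y` on a
curve with `η = 2y`. -/
noncomputable def numY {F : WeierstrassCurve K} (h : FunField F K) : K[X][Y] :=
  Polynomial.C (h.re.num * h.im.denom) +
    Polynomial.C (2 * (h.im.num * h.re.denom)) * Polynomial.X

/-- See `FunField.numY`. -/
noncomputable def denY {F : WeierstrassCurve K} (h : FunField F K) : K[X] :=
  h.re.denom * h.im.denom

omit [DecidableEq k] [IsAlgClosed k] in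
lemma aeval_sub_lt_one_of_tower {t : FunField W k} {a : k} (ht : val W k (t - algebraMap k _ a) < 1)
    (p : K[X]) : val W k (Polynomial.aeval t p - algebraMap k _ (Polynomial.aeval a p)) < 1 := by
  have := aeval_sub_lt_one ht (p.map (algebraMap K k))
  rwa [Polynomial.aeval_map_algebraMap, Polynomial.eval_map_algebraMap] at this

lemma mul_aeval_denY (θ : FunField (veluCurve H) K →ₐ[K] FunField W k) (Q : (W⁄k).Point)
    (hθ : Point.map θ (gen (veluCurve H) K) = veluPoint H Q) (h : FunField (veluCurve H) K) :
    θ h * Polynomial.aeval (veluX H (translate Q)) (denY h) =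
      Polynomial.aeval (veluX H (translate Q)) (h.re.num * h.im.denom) +
        Polynomial.aeval (veluX H (translate Q)) (2 * (h.im.num * h.re.denom)) *
          (veluE H (translate Q) / 2) := by
  have hx : θ (x (veluCurve H) K) = veluX H (translate Q) := by
    have := congrArg xc hθ
    rwa [xc_map] at this
  have he : θ (e (veluCurve H) K) = veluE H (translate Q) := by
    have := congrArg ec hθ
    rw [ec_map, gen_ec, ec_of_ne_zero (veluPoint_ne_zero H Q), baseChange_a₁, baseChange_a₃,
      show (veluCurve H).a₁ = 0 from rfl, show (veluCurve H).a₃ = 0 from rfl, _root_.map_zero,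
      veluPoint_yc] at this
    linear_combination this
  have hp (p : K[X]) : Polynomial.aeval (veluX H (translate Q)) p =
      θ (algebraMap (RatFunc K) _ (algebraMap K[X] (RatFunc K) p)) := by
    rw [← aeval_x, ← hx, Polynomial.aeval_algHom_apply]
  have hr (r : RatFunc K) : algebraMap (RatFunc K) (FunField (veluCurve H) K) r *
      algebraMap (RatFunc K) _ (algebraMap K[X] (RatFunc K) r.denom) =
        algebraMap (RatFunc K) _ (algebraMap K[X] (RatFunc K) r.num) := by
    rw [← map_mul]
    congr 1
    rw [← eq_div_iff (RatFunc.algebraMap_ne_zero r.denom_ne_zero), RatFunc.num_div_denom]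
  have hre := congrArg θ (hr h.re)
  have him := congrArg θ (hr h.im)
  rw [eq_re_add_im_mul h, map_add, map_mul, he, ← eq_re_add_im_mul h, denY]
  simp only [map_mul, map_ofNat, hp] at hre him ⊢
  linear_combination (θ ((algebraMap (RatFunc K) (FunField (veluCurve H) K))
    ((algebraMap K[X] (RatFunc K)) h.im.denom))) * hre +
    (θ ((algebraMap (RatFunc K) (FunField (veluCurve H) K))
    ((algebraMap K[X] (RatFunc K)) h.re.denom))) * veluE H (translate Q) * him

lemma mul_aeval_denY_eq (θ : FunField (veluCurve H) K →ₐ[K] FunField W k) {Q : (W⁄k).Point}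
    (hθ : Point.map θ (gen (veluCurve H) K) = veluPoint H Q)
    (hQ : Q ∉ H.map (Point.baseChange K k)) (h : FunField (veluCurve H) K) {c : k}
    (hc : val W k (θ h - algebraMap k _ c) < 1) :
    c * Polynomial.aeval (veluHom H k Q).xc (denY h) =
      Polynomial.aevalAeval (veluHom H k Q).xc (veluHom H k Q).yc (numY h) := by
  obtain ⟨hx, hy⟩ := veluHom_coords H hQ
  have hX := val_veluX_sub H hQ
  have hE := val_veluE_sub H hQ
  have hY : val W k (veluE H (translate Q) / 2 - algebraMap k _ (veluE H Q / 2)) < 1 := by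
    have e : veluE H (translate Q) / 2 - algebraMap k _ (veluE H Q / 2) =
        algebraMap k _ (1 / 2) * (veluE H (translate Q) - algebraMap k _ (veluE H Q)) := by
      simp only [map_div₀, map_one, map_ofNat]; ring
    rw [e, map_mul]
    exact (mul_le_of_le_one_left' (val_algebraMap_le _)).trans_lt hE
  have h1 := mul_sub_lt_one hc (aeval_sub_lt_one_of_tower hX (denY h))
  rw [mul_aeval_denY H θ Q hθ] at h1
  have h2 := mul_sub_lt_one (aeval_sub_lt_one_of_tower hX (2 * (h.im.num * h.re.denom))) hY
  have h3 := (val W k).map_add_lt (aeval_sub_lt_one_of_tower hX (h.re.num * h.im.denom)) h2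
  rw [← add_sub_add_comm, ← map_add] at h3
  have h4 := eq_of_sub_lt_one h1 h3
  rw [hx, hy, h4, numY, map_add, Polynomial.aevalAeval_C, map_mul (Polynomial.aevalAeval _ _),
    Polynomial.aevalAeval_C, Polynomial.aevalAeval_Y]

end specialization

section dual

variable (k : Type*) [Field k] [Algebra K k] [CharZero k] [DecidableEq k] [IsAlgClosed k]

/-- The map `E / H → E` with `ψ(P) ↦ m • P`, for a subgroup `H` killed by `m`. -/
noncomputable def dualHom {m : ℕ} (hm : ∀ c ∈ H, m • c = 0) :
    ((veluCurve H)⁄k).Point →+ (W⁄k).Point :=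
  (veluHom H k).liftOfSurjective (veluHom_surjective H)
    ⟨nsmulAddMonoidHom m, fun _ hP ↦ nsmul_eq_zero_of_mem H hm ((veluHom_eq_zero_iff H).mp hP)⟩

@[simp] lemma dualHom_veluHom {m : ℕ} (hm : ∀ c ∈ H, m • c = 0) (P : (W⁄k).Point) :
    dualHom H k hm (veluHom H k P) = m • P :=
  AddMonoidHom.liftOfRightInverse_comp_apply ..

end dual

/-- The dual of the quotient map, as an isogeny over `K`. -/
noncomputable def dualIsogeny {m : ℕ} (hm0 : m ≠ 0) (hm : ∀ c ∈ H, m • c = 0) :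
    EllipticIsogeny (veluCurve H) W where
  toHom := dualHom H (AlgebraicClosure K) hm
  rational := by
    let k := AlgebraicClosure K
    obtain ⟨A, hA⟩ := exists_map_veluPullback_eq H k hm
    refine ⟨numY A.xc, Polynomial.C (denY A.xc), numY A.yc, Polynomial.C (denY A.yc), ?_⟩
    have hden (h : FunField (veluCurve H) K) : denY h ≠ 0 :=
      mul_ne_zero (RatFunc.denom_ne_zero _) (RatFunc.denom_ne_zero _)
    have hfin (h : FunField (veluCurve H) K) :
        {S : ((veluCurve H)⁄k).Point | S ≠ 0 ∧ S.xc ∈ (denY h).rootSet k}.Finite :=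
      finite_setOf_xc_mem (Polynomial.rootSet_finite _ _)
    have hbad : ({0} ∪ veluHom H k '' {Q | m • Q = 0} ∪
      {S : ((veluCurve H)⁄k).Point | S ≠ 0 ∧ S.xc ∈ (denY A.xc).rootSet k} ∪
      {S : ((veluCurve H)⁄k).Point | S ≠ 0 ∧ S.xc ∈ (denY A.yc).rootSet k}).Finite :=
      (((Set.finite_singleton 0).union ((finite_torsion W k hm0).image _)).union
        (hfin _)).union (hfin _)
    refine hbad.subset fun S hS ↦ ?_
    by_contra hSb
    simp only [Set.mem_union, Set.mem_singleton_iff, Set.mem_ofPred_eq, not_or, Set.mem_image,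
      not_exists, not_and, Polynomial.mem_rootSet, hden, not_false_eq_true, ne_eq,
      true_and] at hSb
    obtain ⟨⟨⟨hS0, hSm⟩, hx⟩, hy⟩ := hSb
    refine hS ?_
    obtain ⟨Q, rfl⟩ := veluHom_surjective H S
    have hQm : m • Q ≠ 0 := fun h ↦ hSm Q h rfl
    have hQ : Q ∉ H.map (Point.baseChange K k) := fun h ↦ hS0 ((veluHom_eq_zero_iff H).mpr h)
    let θ : FunField (veluCurve H) K →ₐ[K] FunField W k :=
      ((transl Q).restrictScalars K).comp (veluPullback H k)
    have hθ : Point.map θ (gen (veluCurve H) K) = veluPoint H Q := by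
      rw [← Point.map_map, map_veluPullback_gen, map_restrictScalars, map_transl_veluPoint,
        _root_.add_zero]
    have hθA : Point.map θ A = m • translate Q := by
      rw [← Point.map_map, hA, map_restrictScalars, map_nsmul, map_transl_gen]
    obtain ⟨h1, h2⟩ := val_nsmul_translate hm0 hQm
    rw [← hθA, xc_map] at h1
    rw [← hθA, yc_map] at h2
    have e1 := mul_aeval_denY_eq H θ hθ hQ A.xc h1
    have e2 := mul_aeval_denY_eq H θ hθ hQ A.yc h2
    refine ⟨_, _, nonsingular_of_ne_zero hS0, _, _, nonsingular_of_ne_zero hQm,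
      eq_some_of_ne_zero hS0, (dualHom_veluHom H k hm Q).trans (eq_some_of_ne_zero hQm), ?_, ?_,
      ?_, ?_⟩
    · rw [Polynomial.aevalAeval_C]; exact hx hS0
    · rw [Polynomial.aevalAeval_C]; exact hy hS0
    · rw [Polynomial.aevalAeval_C, eq_div_iff (hx hS0)]; exact e1
    · rw [Polynomial.aevalAeval_C, eq_div_iff (hy hS0)]; exact e2

end FunField

/-! ### Galois conjugates -/

section conjugates

open WeierstrassCurve.Affine.Point FunField

variable {K L : Type*} [Field K] [DecidableEq K] [Field L] [DecidableEq L] [Algebra K L]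
  {E : WeierstrassCurve K} {m : ℕ}

lemma WeierstrassCurve.Affine.Point.map_algEquiv_mul (σ τ : L ≃ₐ[K] L) (R : (E⁄L).Point) :
    Point.map ((σ * τ : L ≃ₐ[K] L) : L →ₐ[K] L) R =
      Point.map (σ : L →ₐ[K] L) (Point.map (τ : L →ₐ[K] L) R) := by
  rw [Point.map_map]; rfl

lemma WeierstrassCurve.Affine.Point.map_algEquiv_one (R : (E⁄L).Point) :
    Point.map ((1 : L ≃ₐ[K] L) : L →ₐ[K] L) R = R :=
  Point.map_id R

/-- The rational points that are differences of `R` and a conjugate of `R`. They form a group, because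
`σ ↦ R - σ R` is a cocycle, and it is additive where its values are rational. -/
def conjDiffSubgroup (R : (E⁄L).Point) :
    AddSubgroup (E⁄K).Point where
  carrier := {T | ∃ σ : L ≃ₐ[K] L, R - Point.map (σ : L →ₐ[K] L) R = Point.baseChange K L T}
  zero_mem' := ⟨1, by rw [Point.map_algEquiv_one, sub_self, _root_.map_zero]⟩
  add_mem' := by
    rintro T₁ T₂ ⟨σ, h₁⟩ ⟨τ, h₂⟩
    refine ⟨σ * τ, ?_⟩
    have h₃ := congrArg (Point.map (σ : L →ₐ[K] L)) h₂
    rw [map_sub, Point.map_baseChange] at h₃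
    rw [Point.map_algEquiv_mul, map_add, ← h₁, ← h₃]
    abel
  neg_mem' := by
    rintro T ⟨σ, h₁⟩
    refine ⟨σ⁻¹, ?_⟩
    have h₃ := congrArg (Point.map ((σ⁻¹ : L ≃ₐ[K] L) : L →ₐ[K] L)) h₁
    rw [map_sub, Point.map_baseChange, ← Point.map_algEquiv_mul, inv_mul_cancel,
      Point.map_algEquiv_one] at h₃
    rw [map_neg, ← h₃]
    abel

lemma nsmul_eq_zero_of_mem_conjDiffSubgroup {R : (E⁄L).Point}
    (h : ConjDiffsRationalTorsion E m R) : ∀ T ∈ conjDiffSubgroup R, m • T = 0 := by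
  rintro T ⟨σ, hT⟩
  obtain ⟨T', hm, hT'⟩ := h σ
  rwa [map_injective _ (hT.symm.trans hT')]

lemma exists_surjective_conjDiffSubgroup {R : (E⁄L).Point} (h : ConjDiffsRationalTorsion E m R) :
    ∃ f : (L ≃ₐ[K] L) → conjDiffSubgroup R, Function.Surjective f := by
  choose T _ hT using id h
  refine ⟨fun σ ↦ ⟨T σ, σ, hT σ⟩, ?_⟩
  rintro ⟨S, σ, hS⟩
  exact ⟨σ, Subtype.ext (map_injective _ ((hT σ).symm.trans hS))⟩

/-- If `R` differs from its conjugates by `K`-rational points killed by `m`, and has fewer than `m²`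
conjugates, then `m • R` is the image of a rational point under an isogeny. -/
lemma isImageOfRationalPoint_of_conjDiffs [CharZero K] [FiniteDimensional K L] [IsGalois K L]
    [E.IsElliptic] {Q : (E⁄K).Point} {R : (E⁄L).Point} (hR : m • R = Point.baseChange K L Q)
    (hlt : Module.finrank K L < m ^ 2) (h : ConjDiffsRationalTorsion E m R) :
    IsImageOfRationalPoint E Q := by
  have hm0 : m ≠ 0 := by rintro rfl; simp at hlt
  let k := AlgebraicClosure K
  set H := conjDiffSubgroup R
  have hm := nsmul_eq_zero_of_mem_conjDiffSubgroup h
  obtain ⟨s, hs⟩ := exists_surjective_conjDiffSubgroup h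
  have : Finite H := Finite.of_surjective s hs
  have hcard : Nat.card H < m ^ 2 :=
    (Nat.card_le_card_of_surjective s hs).trans_lt (by rwa [IsGalois.card_aut_eq_finrank])
  let : Fintype H := Fintype.ofFinite H
  let f : L →ₐ[K] k := IsAlgClosed.lift
  let : Algebra L k := f.toRingHom.toAlgebra
  have : IsScalarTower K L k := .of_algebraMap_eq fun c ↦ (f.commutes c).symm
  obtain ⟨P, hP⟩ := exists_baseChange_eq (M := K) (P := veluHom H k (Point.map f R)) fun σ ↦ by
    rw [← veluHom_map, Point.map_map]
    have e : (σ : k →ₐ[K] k).comp f = f.comp (σ.restrictNormal L : L →ₐ[K] L) := by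
      ext a
      exact (σ.restrictNormal_commutes L a).symm
    obtain ⟨T, _, hT⟩ := h (σ.restrictNormal L)
    rw [e, ← Point.map_map, ← sub_eq_zero, ← map_sub, veluHom_eq_zero_iff, ← map_sub,
      ← neg_sub, hT, map_neg, Point.map_baseChange]
    exact AddSubgroup.neg_mem _ ⟨T, ⟨_, hT⟩, rfl⟩
  refine ⟨veluCurve H, inferInstance, dualIsogeny H hm0 hm, P, ?_, ?_⟩
  · -- a point killed by `m` outside `H` maps to a non-zero element of the kernel
    have hfin := finite_torsion E k hm0
    have hker : ((dualIsogeny H hm0 hm).toHom.ker : Set _) ⊆ veluHom H k '' {Q | m • Q = 0} := by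
      intro S hS
      obtain ⟨Q, rfl⟩ := veluHom_surjective H S
      exact ⟨Q, (dualHom_veluHom H k hm Q).symm.trans hS, rfl⟩
    have : Finite (dualIsogeny H hm0 hm).toHom.ker := (hfin.image _).subset hker
    rw [EllipticIsogeny.degree, Finite.one_lt_card_iff_nontrivial]
    obtain ⟨Q', hQ', hQH⟩ : ∃ Q' : (E⁄k).Point, m • Q' = 0 ∧ Q' ∉ H.map (Point.baseChange K k) := by
      by_contra! hall
      have h1 := sq_le_card_torsion E k hm0
      have h2 : Nat.card {Q : (E⁄k).Point // m • Q = 0} ≤ Nat.card H := by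
        have : Finite (H.map (Point.baseChange K k)) :=
          Finite.of_surjective _ (AddMonoidHom.addSubgroupMap_surjective (Point.baseChange K k) H)
        refine (Nat.card_mono (Set.toFinite (H.map (Point.baseChange K k) : Set (E⁄k).Point))
          (fun Q hQ ↦ hall Q hQ)).trans ?_
        exact Nat.card_le_card_of_surjective _ (AddMonoidHom.addSubgroupMap_surjective _ H)
      omega
    refine ⟨⟨0, zero_mem _⟩, ⟨veluHom H k Q', ?_⟩, fun h0 ↦ hQH ?_⟩
    · exact (dualHom_veluHom H k hm Q').trans hQ'
    · exact (veluHom_eq_zero_iff H).mp (congrArg Subtype.val h0).symm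
  · rw [hP]
    refine (dualHom_veluHom H k hm _).trans ?_
    rw [← map_nsmul, hR, Point.map_baseChange]

/-- In a quadratic extension the conjugate of `R` is the only one, and conjugation acts on `R - R'`
both as `-1` and, by `2 (R - R') = 0`, as the identity. -/
lemma conjDiffsRationalTorsion_two [FiniteDimensional K L] [IsGalois K L]
    {Q : (E⁄K).Point} {R : (E⁄L).Point} (hR : 2 • R = Point.baseChange K L Q)
    (hle : Module.finrank K L ≤ 2) : ConjDiffsRationalTorsion E 2 R := by
  intro σ
  have h2 : 2 • (R - Point.map (σ : L →ₐ[K] L) R) = 0 := by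
    rw [nsmul_sub, ← map_nsmul, hR, Point.map_baseChange, sub_self]
  obtain ⟨T, hT⟩ := exists_baseChange_eq (M := K) (P := R - Point.map (σ : L →ₐ[K] L) R) fun τ ↦ by
    have hdisj : τ = 1 ∨ σ = 1 ∨ (τ = σ ∧ σ * σ = 1) := by
      by_contra! hne
      obtain ⟨hτ, hσ, hτσ⟩ := hne
      rw [← IsGalois.card_aut_eq_finrank, Nat.card_eq_fintype_card] at hle
      classical
      have key (ρ : L ≃ₐ[K] L) (h1 : ρ ≠ 1) : ρ = σ := by
        by_contra hρ
        have h3 : ({1, σ, ρ} : Finset (L ≃ₐ[K] L)).card = 3 :=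
          Finset.card_eq_three.mpr ⟨1, σ, ρ, hσ.symm, h1.symm, Ne.symm hρ, rfl⟩
        have := Finset.card_le_univ ({1, σ, ρ} : Finset (L ≃ₐ[K] L))
        omega
      refine hτσ (key τ hτ) (by_contra fun h ↦ hσ ?_)
      exact mul_eq_left.mp (key _ h)
    rcases hdisj with rfl | rfl | ⟨rfl, hσ⟩
    · exact Point.map_algEquiv_one _
    · rw [Point.map_algEquiv_one, sub_self, _root_.map_zero]
    · rw [map_sub, ← Point.map_algEquiv_mul, hσ, Point.map_algEquiv_one, ← neg_sub,
        neg_eq_iff_add_eq_zero, ← two_nsmul, h2]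
  refine ⟨T, map_injective (Algebra.ofId K L) ?_, hT.symm⟩
  change Point.baseChange K L (2 • T) = Point.baseChange K L 0
  rw [map_nsmul, hT, h2, _root_.map_zero]

end conjugates

theorem mainTheorem4 {K L : Type*} [Field K] [NumberField K] [DecidableEq K]
    [Field L] [DecidableEq L] [Algebra K L] [FiniteDimensional K L] [IsGalois K L]
    (E : WeierstrassCurve K) [E.IsElliptic] (m : ℕ)
    (Q : (E⁄K).Point) (hQ : ¬ IsOfFinAddOrder Q)
    (R : (E⁄L).Point) (hR : m • R = Point.baseChange K L Q)
    (hL : IntermediateField.adjoin K R.coords = ⊤) :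
    (Module.finrank K L < m ^ 2 → ConjDiffsRationalTorsion E m R →
      IsImageOfRationalPoint E Q) ∧
    (m = 2 → Module.finrank K L ≤ 2 → ConjDiffsRationalTorsion E m R) := by
  refine ⟨isImageOfRationalPoint_of_conjDiffs hR, ?_⟩
  rintro rfl
  exact conjDiffsRationalTorsion_two hR
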